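/- **Setting.** Let $n\ge 1$, let $\lambda_0\ge 2$ be an integer and $M=\lambda_0\,\mathrm{Id}$ on $\mathbb R^n$. Let $\Gamma_0=\{\gamma_1,\dots,\gamma_m\}\subset\mathbb Z^n$ be a complete set of representatives of $\mathbb Z^n/\lambda_0\mathbb Z^n$, and let $T\subset\mathbb R^n$ be a compact set with $\bigcup_{\nu\in\mathbb Z^n}(T+\nu)=\mathbb R^n$ (different translates overlapping only in null sets) and $\bigcup_i(T+\gamma_i)=MT$. The tiles of level $l$ in $T$ are the sets $Q=M^{-l}(T+\nu_Q)$ with $\nu_Q=\lambda_0^{l-1}\gamma_{i_1}+\dots+\gamma_{i_l}$; they form $\Pi_l(T)$, and $\Pi(T)=\bigcup_{l\ge0}\Pi_l(T)$. Put $M_Qy=\lambda_0^ly-\nu_Q$ and $\mu_Q=\mu_{i_1}\cdots\mu_{i_l}$ ($\mu_T=1$), where $\mu_1,\dots,\mu_m\in\mathbb C$ with $0<|\mu_i|<1$. Let $\phi:\mathbb R^n\to\mathbb C$ be bounded, measurable, and zero outside the interior $T^o$, and let $$f(y)=\sum_{Q\in\Pi(T)}\mu_Q\,\phi(M_Qy),\qquad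 y\in\mathbb R^n .$$ **Regularity.** Fix $c\in T^o$, let $Q_0=T-c$ and $Q_l(x)=\lambda_0^{-l}Q_0+x$, and let $\mathrm{osc}^k g(x,l)$ be the distance in $L^\infty(Q_l(x))$ from $g$ to the polynomials of degree at most $k$. For $s>0$ and $k=\lfloor s\rfloor$: $g\in C^s(x)$ means $\sup_{l\ge0}\lambda_0^{ls}\,\mathrm{osc}^kg(x,l)<\infty$; for $U\subset\mathbb R^n$ open, $g\in C^s(U)$ means that $g\in L^\infty(U)$ and $\lambda_0^{ls}\,\mathrm{osc}^kg(x,l)$ is bounded over all $l\ge0$ and almost all $x$ with $Q_l(x)\subset U$; $C^\infty(U)=\bigcap_{s>0}C^s(U)$. Let $\alpha(g,x)$ and $\alpha(g,U)$ in $[0,\infty]$ be the suprema of the $s>0$ with $g\in C^s(x)$, respectively $g\in C^s(U)$ (and $0$ if there is none), and $\alpha(g)=\alpha(g,\mathbb R^n)$. Put $\Omega_i=M^{-1}(T^o+\gamma_i)$. **Exponents.** For $x\in T$ let $$\tau_0(x)=\liminf_{l\to\infty}\ \inf_{Q\in\Pi_l(T),\ Q\cap B(x,\lambda_0^{-l})\ne\emptyset}\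 \frac{\log|\mu_Q|}{\log(\lambda_0^{-l}+|x-\lambda_0^{-l}\nu_Q|)} .$$ Let $\Omega=\bigcap_{l\ge0}\bigcup_{Q\in\Pi_l(T)}Q^o$; for $x\in\Omega$ let $Q_{l,x}$ be the tile in $\Pi_l(T)$ with $x$ in its interior, $\Delta_l(x)=\mathrm{dist}(x,\partial Q_{l,x})$ and $\tau_1(x)=\liminf_{l\to\infty}\log|\mu_{Q_{l,x}}|/\log\Delta_l(x)$. **Littlewood–Paley pieces.** Let $\theta$ be a Schwartz function whose Fourier transform $\hat\theta(\xi)=\int\theta(x)e^{-2\pi i x\cdot\xi}\,dx$ is supported in $\{|\xi|\le1\}$ and equals $1$ for $|\xi|\le\lambda_0^{-1}$. Put $\psi(x)=\lambda_0^n\theta(\lambda_0x)-\theta(x)$, $\psi_l(x)=\lambda_0^{ln}\psi(\lambda_0^lx)$ and $f_l=f*\psi_l$. **Theorem 4 (with its corollary).** (i) $\alpha(f,x)\ge\min(\alpha(\phi),\tau_0(x))$ for every $x\in T$. (ii) $\alpha(f,x)\ge\min\bigl(\min_i\alpha(\phi,\Omega_i),\ \tau_1(x)\bigr)$ for every $x\in\Omega$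 with $\sup_{l\ge0}\Delta_l(x)/\Delta_{l+1}(x)<\infty$. (iii) Suppose that $\phi\in C^\infty(\Omega_i)$ for $i=1,\dots,m$ and that there are $s_0>0$ and $y_0\in T^o$ with $$\sup_{l\ge0}\sup_{y}\frac{|f_l(y)|}{(\lambda_0^{-l}+|y-y_0|)^{s_0}}=\infty .$$ Then $\tau_0(x)\ge\alpha(f,x)$ for every $x\in T$. (iv) Under the hypotheses of (iii), $\alpha(f,x)=\tau_0(x)=\tau_1(x)$ for every $x\in\Omega$ with $\sup_{l\ge0}\Delta_l(x)/\Delta_{l+1}(x)<\infty$. -/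

import Mathlib

open MeasureTheory Filter
open scoped ENNReal NNReal SchwartzMap FourierTransform

noncomputable section

namespace SelfAffine

/-- Euclidean space `ℝⁿ`. -/
abbrev E (n : ℕ) := EuclideanSpace ℝ (Fin n)

/-- An integer vector, seen as a point of `ℝⁿ`. -/
def latticePt {n : ℕ} (ν : Fin n → ℤ) : E n := WithLp.toLp 2 (fun i => (ν i : ℝ))

/-- The translate `T + ν`. -/
def shiftedTile {n : ℕ} (T : Set (E n)) (ν : Fin n → ℤ) : Set (E n) :=
  {y | y - latticePt ν ∈ T}

/-- The compact set `T` generates the self-affine lattice tiling `{T + ν}`, `ν ∈ ℤⁿ`, of `ℝⁿ`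
with dilation matrix `lam • Id` and set of digits `γ 1, …, γ m`. -/
structure IsSelfAffineTile {n m : ℕ} (lam : ℕ) (γ : Fin m → Fin n → ℤ) (T : Set (E n)) :
    Prop where
  isCompact : IsCompact T
  /-- The digits are a complete set of representatives of `ℤⁿ / lam ℤⁿ`. -/
  digits : ∀ ν : Fin n → ℤ, ∃! i : Fin m, ∃ κ : Fin n → ℤ, ν = γ i + (lam : ℤ) • κ
  /-- The translates cover space. -/
  cover : ⋃ ν : Fin n → ℤ, shiftedTile T ν = Set.univ
  /-- Different translates overlap in a null set only. -/
  ae_disjoint : ∀ ν ν' : Fin n → ℤ, ν ≠ ν' → volume (shiftedTile T ν ∩ shiftedTile T ν') = 0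
  /-- `lam • T` is the union of the translates of `T` by the digits (these are almost disjoint by
  the previous clause, the digits being distinct). -/
  dilate : ⋃ i : Fin m, shiftedTile T (γ i) = (fun y : E n => (lam : ℝ) • y) '' T

section Tiles

variable {n m : ℕ} (lam : ℕ) (γ : Fin m → Fin n → ℤ) (T : Set (E n))

/-- The lattice vector `ν_Q = lam^(l-1) γ_{i_1} + ⋯ + γ_{i_l}` of the tile `Q` of level `l` with
digits `i_1, …, i_l`. The tiles `M^{-l}(T + ν)` contained in `T` are exactly those whose `ν` has
this form, and the digits are determined by `ν`; so words of length `l` index the tiles of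
level `l` in `T`. -/
def nuQ {l : ℕ} (w : Fin l → Fin m) : Fin n → ℤ :=
  ∑ j : Fin l, ((lam : ℤ) ^ (l - 1 - (j : ℕ))) • γ (w j)

/-- The map `M_Q y = lam^l y - ν_Q`. -/
def mapQ {l : ℕ} (w : Fin l → Fin m) (y : E n) : E n :=
  ((lam : ℝ) ^ l) • y - latticePt (nuQ lam γ w)

/-- The tile `Q = M^{-l}(T + ν_Q)`, i.e. the set of `y` with `M_Q y ∈ T`. -/
def tile {l : ℕ} (w : Fin l → Fin m) : Set (E n) := mapQ lam γ w ⁻¹' T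

/-- The weight `μ_Q = μ_{i_1} ⋯ μ_{i_l}` (equal to `1` for `l = 0`). -/
def muQ (μ : Fin m → ℂ) {l : ℕ} (w : Fin l → Fin m) : ℂ := ∏ j : Fin l, μ (w j)

/-- The function `f(y) = ∑_Q μ_Q φ(M_Q y)`, the sum being over all tiles of all levels in `T`. -/
def series (μ : Fin m → ℂ) (φ : E n → ℂ) (y : E n) : ℂ :=
  ∑' Q : (Σ l : ℕ, (Fin l → Fin m)), muQ μ Q.2 * φ (mapQ lam γ Q.2 y)

/-- The open set `Ω_i = M^{-1}(T° + γ_i)`. -/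
def subdomain (i : Fin m) : Set (E n) :=
  {y | (lam : ℝ) • y - latticePt (γ i) ∈ interior T}

/-- The set `Ω = ⋂_l ⋃_Q Q°`, `Q` running through the tiles of level `l` in `T`. -/
def Omega : Set (E n) := {x | ∀ l : ℕ, ∃ w : Fin l → Fin m, x ∈ interior (tile lam γ T w)}

/-- The (word of the) tile `Q_{l,x}` of level `l` with `x` in its interior. -/
def wordAt {x : E n} (hx : x ∈ Omega lam γ T) (l : ℕ) : Fin l → Fin m := (hx l).choose

/-- `Δ_l(x)`, the distance from `x` to the boundary of `Q_{l,x}`. -/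
def Delta {x : E n} (hx : x ∈ Omega lam γ T) (l : ℕ) : ℝ :=
  Metric.infDist x (frontier (tile lam γ T (wordAt lam γ T hx l)))

/-- `τ₀(x)`: the lower limit in `l` of the infimum of
`log |μ_Q| / log (lam^{-l} + |x - lam^{-l} ν_Q|)` over the tiles `Q ⊆ T` of level `l` that meet
the ball of radius `lam^{-l}` about `x`. -/
def tau0 (μ : Fin m → ℂ) (x : E n) : EReal :=
  liminf (fun l : ℕ =>
    ⨅ w ∈ {w : Fin l → Fin m | (Metric.ball x (((lam : ℝ) ^ l)⁻¹) ∩ tile lam γ T w).Nonempty},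
      ((Real.log ‖muQ μ w‖ /
        Real.log (((lam : ℝ) ^ l)⁻¹ +
          ‖x - (((lam : ℝ) ^ l)⁻¹) • latticePt (nuQ lam γ w)‖) : ℝ) : EReal)) atTop

/-- `τ₁(x)`: the lower limit of `log |μ_{Q_{l,x}}| / log Δ_l(x)`, for `x ∈ Ω`. -/
def tau1 (μ : Fin m → ℂ) {x : E n} (hx : x ∈ Omega lam γ T) : EReal :=
  liminf (fun l : ℕ =>
    ((Real.log ‖muQ μ (wordAt lam γ T hx l)‖ / Real.log (Delta lam γ T hx l) : ℝ) : EReal)) atTop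

end Tiles

section Regularity

variable {n : ℕ} (lam : ℕ) (T : Set (E n)) (c : E n)

/-- `Q_l(x) = M^{-l} Q₀ + x`, where `Q₀ = T - c`. -/
def cell (l : ℕ) (x : E n) : Set (E n) := {y | ((lam : ℝ) ^ l) • (y - x) + c ∈ T}

/-- The oscillation `osc^k_∞ f(x,l)`: the distance in `L^∞(Q_l(x))` from `f` to the polynomials
of degree at most `k`. -/
def osc (k : ℕ) (f : E n → ℂ) (x : E n) (l : ℕ) : ℝ≥0∞ :=
  ⨅ P ∈ {P : MvPolynomial (Fin n) ℂ | P.totalDegree ≤ k},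
    eLpNorm (fun y : E n => f y - MvPolynomial.eval (fun i => ((y i : ℝ) : ℂ)) P) ∞
      (volume.restrict (cell lam T c l x))

/-- `f ∈ C^s(x)`. Here `⌊s⌋` is the least `k` with `k + 1 > s`. -/
def MemPointwise (s : ℝ) (f : E n → ℂ) (x : E n) : Prop :=
  ∃ C : ℝ≥0, ∀ l : ℕ, ENNReal.ofReal ((lam : ℝ) ^ ((l : ℝ) * s)) * osc lam T c ⌊s⌋₊ f x l ≤ C

/-- `f ∈ C^s(U) = B^s_{∞∞}(U)`: `f` is essentially bounded on `U`, and `lam^{ls} osc^k_∞ f(x,l)`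
is bounded uniformly in `l` and in (almost) all `x` with `Q_l(x) ⊆ U`.
For `U = ℝⁿ` this is the space `B^s_{∞∞}`. -/
def MemHolder (s : ℝ) (f : E n → ℂ) (U : Set (E n)) : Prop :=
  eLpNorm f ∞ (volume.restrict U) < ∞ ∧
  ∃ C : ℝ≥0, ∀ l : ℕ, ∀ᵐ x : E n, cell lam T c l x ⊆ U →
    ENNReal.ofReal ((lam : ℝ) ^ ((l : ℝ) * s)) * osc lam T c ⌊s⌋₊ f x l ≤ C

/-- `f ∈ C^∞(U)`, the intersection of all `C^s(U)`. -/
def MemSmooth (f : E n → ℂ) (U : Set (E n)) : Prop :=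
  ∀ s : ℝ, 0 < s → MemHolder lam T c s f U

/-- The pointwise exponent `α(f,x)`; it is `0` if `f ∈ C^s(x)` for no `s > 0`. -/
def alphaAt (f : E n → ℂ) (x : E n) : EReal :=
  ⨆ s ∈ {s : ℝ | s = 0 ∨ (0 < s ∧ MemPointwise lam T c s f x)}, (s : EReal)

/-- The exponent `α(f,U)`; it is `0` if `f ∈ C^s(U)` for no `s > 0`. -/
def alphaOn (f : E n → ℂ) (U : Set (E n)) : EReal :=
  ⨆ s ∈ {s : ℝ | s = 0 ∨ (0 < s ∧ MemHolder lam T c s f U)}, (s : EReal)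

/-- The global exponent `α(f)`. -/
def alpha (f : E n → ℂ) : EReal := alphaOn lam T c f Set.univ

end Regularity

section LittlewoodPaley

variable {n : ℕ} (lam : ℕ)

/-- The Schwartz function `θ` is admissible for a Littlewood-Paley decomposition: its Fourier
transform is supported in the unit ball and equals `1` on the ball of radius `1 / lam`. -/
def IsLPGenerator (θ : 𝓢(E n, ℂ)) : Prop :=
  tsupport (fun ξ : E n => (𝓕 θ) ξ) ⊆ Metric.closedBall 0 1 ∧
  ∀ ξ : E n, ‖ξ‖ ≤ (lam : ℝ)⁻¹ → (𝓕 θ) ξ = 1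

/-- `ψ(x) = lamⁿ θ(lam x) - θ(x)`. -/
def lpPsi (θ : 𝓢(E n, ℂ)) (x : E n) : ℂ := (lam : ℂ) ^ n * θ ((lam : ℝ) • x) - θ x

/-- The Littlewood-Paley piece `f_l = f * ψ_l`, where `ψ_l(x) = lam^{ln} ψ(lam^l x)`. -/
def lpPiece (θ : 𝓢(E n, ℂ)) (f : E n → ℂ) (l : ℕ) (y : E n) : ℂ :=
  ∫ u : E n, f (y - u) * ((lam : ℂ) ^ (l * n) * lpPsi lam θ (((lam : ℝ) ^ l) • u))

/-- There are `s₀ > 0` and `y₀ ∈ T°` with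
`sup_l sup_y |f_l(y)| / (lam^{-l} + |y - y₀|)^{s₀} = ∞`. -/
def NonSmoothSomewhere (θ : 𝓢(E n, ℂ)) (T : Set (E n)) (f : E n → ℂ) : Prop :=
  ∃ s₀ : ℝ, 0 < s₀ ∧ ∃ y₀ ∈ interior T, ∀ C : ℝ, ∃ (l : ℕ) (y : E n),
    C < ‖lpPiece lam θ f l y‖ / (((lam : ℝ) ^ l)⁻¹ + ‖y - y₀‖) ^ s₀

end LittlewoodPaley

end SelfAffine

end

noncomputable section

namespace SelfAffine

/-! Everything is measured by local polynomial approximation on balls: `ApproxOn K f x r A` lets the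
degree K and the radius float freely, and the exponents of the theorem are recovered from it at the
end. Three facts make this possible. Balls and cells are comparable (section `Cells`);
approximations of too high a degree may be truncated to degree ⌊s⌋ once they have error λ^(-ls) at
all scales (`approxOn_floor_of_approxOn`); the Littlewood-Paley kernels annihilate polynomials, so
approximation of order t at a point bounds all f_l around it (`exists_lpPiece_bound`).

The function satisfies f = φ + ∑ μ_i f(M_i ·), hence f = ∑_{l<L} ∑_Q μ_Q φ(M_Q ·) + ∑_Q μ_Q f(M_Q
·), with Q of level L in the last sum. Both exponents τ describe decay of weights: s < τ₀(x) gives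
|μ_Q| ≤ C λ^(-ls) for all tiles Q near x, and s < τ₁(x) gives it for Q = Q_{l,x}.

Lower bounds (`IsSelfAffineTile.memPointwise_series`): on a ball of radius comparable with λ^(-L)
the remainder is O(λ^(-Ls)), and a term of level l is within C λ^(-ls) λ^(-(L-l)s') of a polynomial,
where s' > s is an exponent of φ. Boundedly many tiles matter per level, so the errors sum
geometrically to O(λ^(-Ls)). For (ii) the bounded ratios force Δ_l(x) to be comparable with λ^(-l)
(`IsSelfAffineTile.exists_le_Delta`), so that only Q_{l,x} matters and φ is used only inside the
Ω_i.

Upper bound: when φ is smooth in the Ω_i, f on Q is μ_Q f(M_Q ·) plus a smooth error proportional to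
μ_Q (`IsSelfAffineTile.approxOn_comp_invQ_sub`). If f ∈ C^s(x) while |μ_Q| λ^(ls) is unbounded near
x, dividing by μ_Q makes f as well approximable as one likes around any point of T°, contradicting
the irregularity at y₀. Part (iv) closes the circle α ≤ τ₀ ≤ τ₁ ≤ α. -/

/-- The coefficients of a one-variable polynomial are controlled by its size on `(0,1)`. -/
lemma exists_coeff_bound (K : ℕ) : ∃ C : ℝ, 1 ≤ C ∧ ∀ (a : ℕ → ℂ) (A : ℝ),
    (∀ t : ℝ, 0 < t → t < 1 → ‖∑ j ∈ Finset.range (K + 1), a j * (t : ℂ) ^ j‖ ≤ A) →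
    ∀ j ∈ Finset.range (K + 1), ‖a j‖ ≤ C * A := by
  set s := Finset.range (K + 1) with hs
  -- These are K + 1 distinct nodes in (0,1). Interpolation at them expresses each coefficient as a
  -- fixed linear combination of values, so the constant depends on K only.
  set v : ℕ → ℂ := fun i => (((i + 1 : ℝ) / (K + 2) : ℝ) : ℂ) with hv
  have hinj : Set.InjOn v s := by
    intro i _ j _ hij
    have h1 := Complex.ofReal_injective hij
    have : (K + 2 : ℝ) ≠ 0 := by positivity
    field_simp at h1
    exact_mod_cast (add_right_cancel h1)
  set C := 1 + ∑ j ∈ s, ∑ i ∈ s, ‖(Lagrange.basis s v i).coeff j‖ with hC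
  refine ⟨C, le_add_of_nonneg_right (by positivity), fun a A hA j hj => ?_⟩
  have hA0 : 0 ≤ A := (norm_nonneg _).trans (hA (1 / 2) (by norm_num) (by norm_num))
  set p : Polynomial ℂ := ∑ j ∈ s, Polynomial.C (a j) * Polynomial.X ^ j with hp
  have hcoeff : ∀ j ∈ s, p.coeff j = a j := by
    intro j hj
    simp only [hp, Polynomial.finsetSum_coeff, Polynomial.coeff_C_mul_X_pow]
    rw [Finset.sum_eq_single j (fun b _ hb => if_neg (Ne.symm hb)) (fun h => absurd hj h)]
    simp
  have hdeg : p.degree < s.card := by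
    rw [hs, Finset.card_range]
    refine lt_of_le_of_lt (Polynomial.degree_sum_le _ _) ?_
    rw [Finset.sup_lt_iff (by exact WithBot.bot_lt_coe _)]
    intro j hj
    exact lt_of_le_of_lt (Polynomial.degree_C_mul_X_pow_le _ _)
      (by exact_mod_cast Finset.mem_range.1 hj)
  have hval : ∀ i ∈ s, ‖p.eval (v i)‖ ≤ A := by
    intro i hi
    have hi' : (i : ℝ) ≤ K := by
      exact_mod_cast Nat.lt_succ_iff.1 (Finset.mem_range.1 hi)
    have := hA ((i + 1 : ℝ) / (K + 2)) (by positivity)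
      (by rw [div_lt_one (by positivity)]; linarith)
    simpa [hp, Polynomial.eval_finsetSum, hv] using this
  have hint := Lagrange.eq_interpolate hinj hdeg
  rw [← hcoeff j hj, hint, Lagrange.interpolate_apply, Polynomial.finsetSum_coeff]
  calc ‖∑ i ∈ s, (Polynomial.C (p.eval (v i)) * Lagrange.basis s v i).coeff j‖
      ≤ ∑ i ∈ s, ‖(Polynomial.C (p.eval (v i)) * Lagrange.basis s v i).coeff j‖ :=
        norm_sum_le _ _
    _ ≤ ∑ i ∈ s, A * ‖(Lagrange.basis s v i).coeff j‖ := by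
        refine Finset.sum_le_sum fun i hi => ?_
        rw [Polynomial.coeff_C_mul, norm_mul]
        exact mul_le_mul_of_nonneg_right (hval i hi) (norm_nonneg _)
    _ = (∑ i ∈ s, ‖(Lagrange.basis s v i).coeff j‖) * A := by
        rw [← Finset.mul_sum, mul_comm]
    _ ≤ C * A := by
        refine mul_le_mul_of_nonneg_right ?_ hA0
        have := Finset.single_le_sum (s := s)
          (f := fun j => ∑ i ∈ s, ‖(Lagrange.basis s v i).coeff j‖)
          (fun _ _ => by positivity) hj
        linarith

/-! ### Polynomials on ℝⁿ: affine substitution, homogeneous parts, growth. -/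

/-- The polynomial function on `ℝⁿ` defined by a complex polynomial. -/
def polyEval {n : ℕ} (P : MvPolynomial (Fin n) ℂ) (y : E n) : ℂ :=
  MvPolynomial.eval (fun i => ((y i : ℝ) : ℂ)) P

section Poly

variable {n : ℕ}

lemma continuous_polyEval (P : MvPolynomial (Fin n) ℂ) : Continuous (polyEval P) := by
  unfold polyEval
  exact (MvPolynomial.continuous_eval P).comp (by fun_prop)

@[simp] lemma polyEval_zero (y : E n) : polyEval (0 : MvPolynomial (Fin n) ℂ) y = 0 := by
  simp [polyEval]

lemma polyEval_add (P Q : MvPolynomial (Fin n) ℂ) (y : E n) :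
    polyEval (P + Q) y = polyEval P y + polyEval Q y := by simp [polyEval]

lemma polyEval_sub (P Q : MvPolynomial (Fin n) ℂ) (y : E n) :
    polyEval (P - Q) y = polyEval P y - polyEval Q y := by simp [polyEval]

lemma polyEval_C_mul (a : ℂ) (P : MvPolynomial (Fin n) ℂ) (y : E n) :
    polyEval (MvPolynomial.C a * P) y = a * polyEval P y := by simp [polyEval]

lemma polyEval_sum {ι : Type*} (s : Finset ι) (P : ι → MvPolynomial (Fin n) ℂ) (y : E n) :
    polyEval (∑ i ∈ s, P i) y = ∑ i ∈ s, polyEval (P i) y := by simp [polyEval]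

/-- The polynomial `P (a y + b)`. -/
def affineSubst (a : ℝ) (b : E n) (P : MvPolynomial (Fin n) ℂ) : MvPolynomial (Fin n) ℂ :=
  MvPolynomial.bind₁ (fun i => MvPolynomial.C (a : ℂ) * MvPolynomial.X i +
    MvPolynomial.C ((b i : ℝ) : ℂ)) P

lemma polyEval_affineSubst (a : ℝ) (b : E n) (P : MvPolynomial (Fin n) ℂ) (y : E n) :
    polyEval (affineSubst a b P) y = polyEval P (a • y + b) := by
  simp only [polyEval, affineSubst, MvPolynomial.eval]
  rw [MvPolynomial.eval₂Hom_bind₁]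
  simp

lemma affineSubst_sub (a : ℝ) (b : E n) (P Q : MvPolynomial (Fin n) ℂ) :
    affineSubst a b (P - Q) = affineSubst a b P - affineSubst a b Q := by
  simp [affineSubst]

lemma totalDegree_affineSubst_le (a : ℝ) (b : E n) (P : MvPolynomial (Fin n) ℂ) :
    (affineSubst a b P).totalDegree ≤ P.totalDegree := by
  unfold affineSubst
  rw [MvPolynomial.bind₁, MvPolynomial.aeval_def, MvPolynomial.eval₂_eq]
  refine MvPolynomial.totalDegree_finsetSum_le fun d hd => ?_
  refine (MvPolynomial.totalDegree_mul _ _).trans ?_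
  rw [MvPolynomial.algebraMap_eq, MvPolynomial.totalDegree_C, zero_add]
  refine (MvPolynomial.totalDegree_finsetProd _ _).trans ?_
  refine le_trans ?_ (MvPolynomial.le_totalDegree hd)
  refine Finset.sum_le_sum fun i _ => ?_
  refine (MvPolynomial.totalDegree_pow _ _).trans ?_
  refine (Nat.mul_le_mul_left _ ?_).trans (mul_one (d i)).le
  refine (MvPolynomial.totalDegree_add _ _).trans (max_le ?_ ?_)
  · refine (MvPolynomial.totalDegree_mul _ _).trans ?_
    simp
  · simp

/-- The homogeneous part of degree `j` of the expansion of `P` about `x`, at the increment `z`. -/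
def homPart (P : MvPolynomial (Fin n) ℂ) (x : E n) (j : ℕ) : MvPolynomial (Fin n) ℂ :=
  MvPolynomial.homogeneousComponent j (affineSubst 1 x P)

lemma polyEval_smul_of_isHomogeneous {P : MvPolynomial (Fin n) ℂ} {j : ℕ}
    (hP : P.IsHomogeneous j) (t : ℝ) (z : E n) :
    polyEval P (t • z) = (t : ℂ) ^ j * polyEval P z := by
  simp only [polyEval, MvPolynomial.eval_eq', Finset.mul_sum]
  refine Finset.sum_congr rfl fun d hd => ?_
  have hdeg : d.degree = j := by
    rw [Finsupp.degree_eq_weight_one (R := ℕ)]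
    exact hP (MvPolynomial.mem_support_iff.1 hd)
  have : (t : ℂ) ^ j = ∏ i, (t : ℂ) ^ d i := by
    rw [Finset.prod_pow_eq_pow_sum, ← hdeg, Finsupp.degree_eq_sum]
  rw [this]
  simp only [PiLp.smul_apply, smul_eq_mul, Complex.ofReal_mul, mul_pow, Finset.prod_mul_distrib]
  ring

lemma polyEval_homPart_smul (P : MvPolynomial (Fin n) ℂ) (x : E n) (j : ℕ) (t : ℝ) (z : E n) :
    polyEval (homPart P x j) (t • z) = (t : ℂ) ^ j * polyEval (homPart P x j) z :=
  polyEval_smul_of_isHomogeneous (MvPolynomial.homogeneousComponent_isHomogeneous _ _) t z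

lemma homPart_sub (P Q : MvPolynomial (Fin n) ℂ) (x : E n) (j : ℕ) :
    homPart (P - Q) x j = homPart P x j - homPart Q x j := by
  simp [homPart, affineSubst_sub]

lemma polyEval_eq_sum_homPart {P : MvPolynomial (Fin n) ℂ} {K : ℕ} (hP : P.totalDegree ≤ K)
    (x z : E n) :
    polyEval P (x + z) = ∑ j ∈ Finset.range (K + 1), polyEval (homPart P x j) z := by
  have h1 : polyEval P (x + z) = polyEval (affineSubst 1 x P) z := by
    rw [polyEval_affineSubst, one_smul, add_comm]
  have hd := (totalDegree_affineSubst_le 1 x P).trans hP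
  rw [h1, ← polyEval_sum]
  congr 1
  unfold homPart
  conv_lhs => rw [← MvPolynomial.sum_homogeneousComponent (affineSubst 1 x P)]
  refine Finset.sum_subset (fun i hi => ?_) (fun i _ hi => ?_)
  · simp only [Finset.mem_range] at hi ⊢; omega
  · apply MvPolynomial.homogeneousComponent_eq_zero
    simp only [Finset.mem_range] at hi; omega

/-- The homogeneous parts about `x` of a polynomial which is at most `A` on the ball of radius `r`
about `x`. -/
lemma exists_homPart_bound (n K : ℕ) : ∃ C : ℝ, 1 ≤ C ∧ ∀ (P : MvPolynomial (Fin n) ℂ) (x : E n)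
    (r A : ℝ), P.totalDegree ≤ K → 0 < r → (∀ y ∈ Metric.ball x r, ‖polyEval P y‖ ≤ A) →
    ∀ j ∈ Finset.range (K + 1), ∀ z : E n, ‖polyEval (homPart P x j) z‖ ≤ C * A * (‖z‖ / r) ^ j := by
  obtain ⟨C, hC1, hC⟩ := exists_coeff_bound K
  refine ⟨C, hC1, fun P x r A hP hr hA j hj z => ?_⟩
  have key : ∀ w : E n, ‖w‖ ≤ r → ‖polyEval (homPart P x j) w‖ ≤ C * A := by
    intro w hw
    -- Along t ↦ x + t w the polynomial P has the values at w of its homogeneous parts as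
    -- coefficients, and for 0 < t < 1 the point stays in the open ball.
    refine hC (fun j => polyEval (homPart P x j) w) A (fun t ht ht1 => ?_) j hj
    have h1 := hA (x + t • w) (by
      simp only [Metric.mem_ball, dist_self_add_left, norm_smul, Real.norm_eq_abs, abs_of_pos ht]
      nlinarith [norm_nonneg w])
    rw [polyEval_eq_sum_homPart hP] at h1
    simpa [polyEval_homPart_smul, mul_comm] using h1
  rcases eq_or_ne z 0 with rfl | hz
  · have h0 := polyEval_homPart_smul P x j 0 (0 : E n)
    have h1 := key 0 (by simpa using hr.le)
    rcases Nat.eq_zero_or_pos j with rfl | hj0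
    · simpa using h1
    · rw [zero_smul] at h0
      rw [h0]; simp [hj0.ne']
  · have hz' : 0 < ‖z‖ := norm_pos_iff.2 hz
    have h1 := key ((r / ‖z‖) • z) (by
      rw [norm_smul, Real.norm_eq_abs, abs_of_pos (by positivity), div_mul_cancel₀ _ hz'.ne'])
    rw [polyEval_homPart_smul, norm_mul, norm_pow, Complex.norm_real, Real.norm_eq_abs,
      abs_of_pos (by positivity)] at h1
    rw [div_pow, mul_div_assoc', le_div_iff₀ (by positivity)]
    rw [div_pow, div_mul_eq_mul_div, div_le_iff₀ (by positivity)] at h1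
    linarith

/-- Each homogeneous part scales by at most (R / r)^K; there are K + 1 of them. The exponent K is
what is later played against an approximation order t > K. -/
lemma exists_growth_bound (n K : ℕ) : ∃ C : ℝ, 1 ≤ C ∧ ∀ (P : MvPolynomial (Fin n) ℂ) (x : E n)
    (r R A : ℝ), P.totalDegree ≤ K → 0 < r → r ≤ R → (∀ y ∈ Metric.ball x r, ‖polyEval P y‖ ≤ A) →
    ∀ y ∈ Metric.ball x R, ‖polyEval P y‖ ≤ C * A * (R / r) ^ K := by
  obtain ⟨C, hC1, hC⟩ := exists_homPart_bound n K
  refine ⟨(K + 1) * C, by nlinarith [(Nat.cast_nonneg K : (0:ℝ) ≤ K)],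
    fun P x r R A hP hr hR hA y hy => ?_⟩
  have hA0 : 0 ≤ A := (norm_nonneg _).trans (hA x (Metric.mem_ball_self hr))
  have hyx : y = x + (y - x) := by abel
  rw [hyx, polyEval_eq_sum_homPart hP]
  have h1 : ∀ j ∈ Finset.range (K + 1),
      ‖polyEval (homPart P x j) (y - x)‖ ≤ C * A * (R / r) ^ K := by
    intro j hj
    refine (hC P x r A hP hr hA j hj (y - x)).trans ?_
    refine mul_le_mul_of_nonneg_left ?_ (by positivity)
    have h2 : ‖y - x‖ / r ≤ R / r := by
      rw [← dist_eq_norm]; gcongr; exact (Metric.mem_ball.1 hy).le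
    calc (‖y - x‖ / r) ^ j ≤ (R / r) ^ j := by gcongr
      _ ≤ (R / r) ^ K := pow_le_pow_right₀ (by rwa [one_le_div hr])
          (Nat.lt_succ_iff.1 (Finset.mem_range.1 hj))
  refine (norm_sum_le _ _).trans ((Finset.sum_le_sum h1).trans ?_)
  rw [Finset.sum_const, Finset.card_range, nsmul_eq_mul]
  push_cast
  apply le_of_eq; ring

/-- The part of degree at most `k` of the expansion of `P` about `x`. -/
def truncAt (P : MvPolynomial (Fin n) ℂ) (x : E n) (k : ℕ) : MvPolynomial (Fin n) ℂ :=
  affineSubst 1 (-x) (∑ j ∈ Finset.range (k + 1), homPart P x j)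

lemma totalDegree_truncAt_le (P : MvPolynomial (Fin n) ℂ) (x : E n) (k : ℕ) :
    (truncAt P x k).totalDegree ≤ k := by
  refine (totalDegree_affineSubst_le _ _ _).trans ?_
  refine MvPolynomial.totalDegree_finsetSum_le fun j hj => ?_
  exact ((MvPolynomial.homogeneousComponent_isHomogeneous _ _).totalDegree_le).trans
    (Nat.lt_succ_iff.1 (Finset.mem_range.1 hj))

lemma polyEval_truncAt (P : MvPolynomial (Fin n) ℂ) (x : E n) (k : ℕ) (z : E n) :
    polyEval (truncAt P x k) (x + z) =
      ∑ j ∈ Finset.range (k + 1), polyEval (homPart P x j) z := by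
  rw [truncAt, polyEval_affineSubst, polyEval_sum]
  simp

end Poly

/-! ### The scales λ^(-l). -/

/-- The scale `lam ^ (-l)`. -/
def scale (lam l : ℕ) : ℝ := ((lam : ℝ) ^ l)⁻¹

section Scale

variable {lam : ℕ}

lemma scale_pos (hlam : 2 ≤ lam) (l : ℕ) : 0 < scale lam l := by
  have : (0 : ℝ) < lam := by exact_mod_cast (by omega : 0 < lam)
  unfold scale; positivity

@[simp] lemma scale_zero : scale lam 0 = 1 := by simp [scale]

lemma scale_add (a b : ℕ) : scale lam (a + b) = scale lam a * scale lam b := by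
  simp [scale, pow_add, mul_comm]

lemma scale_succ (l : ℕ) : scale lam (l + 1) = scale lam l / lam := by
  simp [scale, pow_succ, div_eq_mul_inv, mul_comm]

lemma pow_mul_scale (hlam : 2 ≤ lam) (l : ℕ) : (lam : ℝ) ^ l * scale lam l = 1 := by
  have : (0 : ℝ) < lam := by exact_mod_cast (by omega : 0 < lam)
  unfold scale; field_simp

lemma scale_le_one (hlam : 2 ≤ lam) (l : ℕ) : scale lam l ≤ 1 := by
  have : (1 : ℝ) ≤ lam := by exact_mod_cast (by omega : 1 ≤ lam)
  exact inv_le_one_of_one_le₀ (one_le_pow₀ this)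

lemma scale_anti (hlam : 2 ≤ lam) {a b : ℕ} (h : a ≤ b) : scale lam b ≤ scale lam a := by
  obtain ⟨d, rfl⟩ := Nat.exists_eq_add_of_le h
  rw [scale_add]
  exact mul_le_of_le_one_right (scale_pos hlam a).le (scale_le_one hlam d)

lemma tendsto_scale (hlam : 2 ≤ lam) : Tendsto (scale lam) atTop (nhds 0) := by
  have : (1 : ℝ) < lam := by exact_mod_cast (by omega : 1 < lam)
  exact tendsto_inv_atTop_zero.comp (tendsto_pow_atTop_atTop_of_one_lt this)

lemma exists_scale_le (hlam : 2 ≤ lam) {a : ℝ} (ha : 0 < a) : ∃ N, scale lam N ≤ a :=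
  (((tendsto_scale hlam).eventually (gt_mem_nhds ha)).exists).imp fun _ h => le_of_lt h

lemma rpow_level_mul_scale_rpow (hlam : 2 ≤ lam) (l : ℕ) (s : ℝ) :
    (lam : ℝ) ^ ((l : ℝ) * s) * scale lam l ^ s = 1 := by
  have h0 : (0 : ℝ) < lam := by exact_mod_cast (by omega : 0 < lam)
  rw [Real.rpow_mul h0.le, Real.rpow_natCast, ← Real.mul_rpow (by positivity)
    (scale_pos hlam l).le, pow_mul_scale hlam, Real.one_rpow]

end Scale

/-! ### Local polynomial approximation on balls. -/

/-- Up to a null set, `f` is within `A` of a polynomial of degree at most `K` on the ball of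
radius `r` about `x`. -/
def ApproxOn {n : ℕ} (K : ℕ) (f : E n → ℂ) (x : E n) (r A : ℝ) : Prop :=
  ∃ P : MvPolynomial (Fin n) ℂ, P.totalDegree ≤ K ∧
    ∀ᵐ y : E n, y ∈ Metric.ball x r → ‖f y - polyEval P y‖ ≤ A

section Approx

variable {n : ℕ} {K K' : ℕ} {f g : E n → ℂ} {x : E n} {r r' A A' : ℝ}

lemma ApproxOn.mono (h : ApproxOn K f x r A) (hK : K ≤ K') (hr : r' ≤ r) (hA : A ≤ A') :
    ApproxOn K' f x r' A' := by
  obtain ⟨P, hP, h⟩ := h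
  refine ⟨P, hP.trans hK, ?_⟩
  filter_upwards [h] with y hy hyr
  exact (hy (Metric.ball_subset_ball hr hyr)).trans hA

lemma approxOn_of_norm_le (K : ℕ) (h : ∀ y ∈ Metric.ball x r, ‖f y‖ ≤ A) :
    ApproxOn K f x r A :=
  ⟨0, by simp, Eventually.of_forall fun y hy => by simpa using h y hy⟩

lemma ApproxOn.add (hf : ApproxOn K f x r A) (hg : ApproxOn K g x r A') :
    ApproxOn K (fun y => f y + g y) x r (A + A') := by
  obtain ⟨P, hP, hf⟩ := hf
  obtain ⟨Q, hQ, hg⟩ := hg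
  refine ⟨P + Q, (MvPolynomial.totalDegree_add _ _).trans (max_le hP hQ), ?_⟩
  filter_upwards [hf, hg] with y h1 h2 hy
  rw [polyEval_add, add_sub_add_comm]
  exact (norm_add_le _ _).trans (add_le_add (h1 hy) (h2 hy))

lemma ApproxOn.const_mul (a : ℂ) (hf : ApproxOn K f x r A) :
    ApproxOn K (fun y => a * f y) x r (‖a‖ * A) := by
  obtain ⟨P, hP, hf⟩ := hf
  refine ⟨MvPolynomial.C a * P, ?_, ?_⟩
  · refine (MvPolynomial.totalDegree_mul _ _).trans ?_
    simpa using hP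
  filter_upwards [hf] with y h1 hy
  rw [polyEval_C_mul, ← mul_sub, norm_mul]
  exact mul_le_mul_of_nonneg_left (h1 hy) (norm_nonneg _)

lemma ApproxOn.sum {ι : Type*} {s : Finset ι} {F : ι → E n → ℂ} {B : ι → ℝ}
    (h : ∀ i ∈ s, ApproxOn K (F i) x r (B i)) :
    ApproxOn K (fun y => ∑ i ∈ s, F i y) x r (∑ i ∈ s, B i) := by
  classical
  induction s using Finset.induction_on with
  | empty => exact approxOn_of_norm_le K (by simp)
  | insert i s hi ih =>
    simp only [Finset.sum_insert hi]
    exact (h i (Finset.mem_insert_self _ _)).add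
      (ih fun j hj => h j (Finset.mem_insert_of_mem hj))

lemma ApproxOn.congr (hg : ApproxOn K g x r A) (h : ∀ y ∈ Metric.ball x r, f y = g y) :
    ApproxOn K f x r A := by
  obtain ⟨P, hP, hg⟩ := hg
  refine ⟨P, hP, ?_⟩
  filter_upwards [hg] with y h1 hy
  rw [h y hy]; exact h1 hy

lemma ae_comp_affine {p : E n → Prop} (h : ∀ᵐ y, p y) {a : ℝ} (ha : a ≠ 0) (b : E n) :
    ∀ᵐ y : E n, p (a • y + b) := by
  have h1 : ∀ᵐ y : E n, p (y + b) :=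
    (measurePreserving_add_right volume b).quasiMeasurePreserving.ae h
  exact (Measure.quasiMeasurePreserving_smul (μ := (volume : Measure (E n))) ha).ae h1

lemma ApproxOn.comp_affine (h : ApproxOn K f x r A) {a : ℝ} (ha : a ≠ 0) {b y : E n}
    (hsub : ∀ z ∈ Metric.ball y r', a • z + b ∈ Metric.ball x r) :
    ApproxOn K (fun z => f (a • z + b)) y r' A := by
  obtain ⟨P, hP, h⟩ := h
  refine ⟨affineSubst a b P, (totalDegree_affineSubst_le _ _ _).trans hP, ?_⟩
  filter_upwards [ae_comp_affine h ha b] with z h1 hz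
  rw [polyEval_affineSubst]
  exact h1 (hsub z hz)

/-- A conull set is dense, so a continuous function cannot exceed A on a nonempty open part of the
ball. This makes two almost-everywhere approximants of one function comparable at every point. -/
lemma norm_polyEval_le_of_ae {P : MvPolynomial (Fin n) ℂ}
    (h : ∀ᵐ y : E n, y ∈ Metric.ball x r → ‖polyEval P y‖ ≤ A) :
    ∀ y ∈ Metric.ball x r, ‖polyEval P y‖ ≤ A := by
  intro y hy
  by_contra hlt
  push Not at hlt
  have hopen : IsOpen (Metric.ball x r ∩ {y | A < ‖polyEval P y‖}) :=
    Metric.isOpen_ball.inter (isOpen_lt continuous_const (continuous_polyEval P).norm)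
  have hd := (Measure.dense_of_ae h).inter_open_nonempty _ hopen ⟨y, hy, hlt⟩
  obtain ⟨z, ⟨hz1, hz2⟩, hz3⟩ := hd
  exact absurd (hz3 hz1) (not_le.2 hz2)

lemma norm_polyEval_sub_le {P Q : MvPolynomial (Fin n) ℂ}
    (hP : ∀ᵐ y : E n, y ∈ Metric.ball x r → ‖f y - polyEval P y‖ ≤ A)
    (hQ : ∀ᵐ y : E n, y ∈ Metric.ball x r → ‖f y - polyEval Q y‖ ≤ A') :
    ∀ y ∈ Metric.ball x r, ‖polyEval (P - Q) y‖ ≤ A + A' := by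
  apply norm_polyEval_le_of_ae
  filter_upwards [hP, hQ] with y h1 h2 hy
  rw [polyEval_sub]
  have : polyEval P y - polyEval Q y = -(f y - polyEval P y) + (f y - polyEval Q y) := by ring
  rw [this]
  refine (norm_add_le _ _).trans ?_
  rw [norm_neg]
  exact add_le_add (h1 hy) (h2 hy)

end Approx

/-! ### Passing between oscillations on cells and approximation on balls. -/

section Cells

variable {n : ℕ} {lam : ℕ} {T : Set (E n)} {c : E n} {f : E n → ℂ} {r R : ℝ}

lemma ball_subset_cell (hlam : 2 ≤ lam) (hr : Metric.ball c r ⊆ T) (l : ℕ) (x : E n) :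
    Metric.ball x (r * scale lam l) ⊆ cell lam T c l x := by
  intro y hy
  have h0 : (0 : ℝ) < lam := by exact_mod_cast (by omega : 0 < lam)
  apply hr
  rw [Metric.mem_ball, dist_add_self_left, norm_smul, ← dist_eq_norm, Real.norm_eq_abs,
    abs_of_pos (by positivity)]
  calc (lam : ℝ) ^ l * dist y x < lam ^ l * (r * scale lam l) := by
        gcongr; exact hy
    _ = r := by rw [mul_left_comm, pow_mul_scale hlam, mul_one]

lemma cell_subset_ball (hlam : 2 ≤ lam) (hR : T ⊆ Metric.ball c R) (l : ℕ) (x : E n) :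
    cell lam T c l x ⊆ Metric.ball x (R * scale lam l) := by
  intro y hy
  have h0 : (0 : ℝ) < lam := by exact_mod_cast (by omega : 0 < lam)
  have h1 := hR hy
  rw [Metric.mem_ball, dist_add_self_left, norm_smul, ← dist_eq_norm, Real.norm_eq_abs,
    abs_of_pos (by positivity)] at h1
  rw [Metric.mem_ball, scale, ← div_eq_mul_inv, lt_div_iff₀ (by positivity), mul_comm]
  exact h1

lemma osc_le_of_approxOn (hlam : 2 ≤ lam) (hR : T ⊆ Metric.ball c R) {k l : ℕ} {x : E n}
    {A : ℝ} (h : ApproxOn k f x (R * scale lam l) A) :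
    osc lam T c k f x l ≤ ENNReal.ofReal A := by
  obtain ⟨P, hP, h⟩ := h
  refine (iInf₂_le P hP).trans ?_
  rw [eLpNorm_exponent_top]
  apply eLpNormEssSup_le_of_ae_bound
  refine ae_restrict_of_ae_restrict_of_subset (cell_subset_ball hlam hR l x) ?_
  exact (ae_restrict_iff' measurableSet_ball).2 h

/-- The strict inequality selects a polynomial, so attainment of the infimum in `osc` is not needed.
-/
lemma approxOn_of_osc_lt (hlam : 2 ≤ lam) (hr : Metric.ball c r ⊆ T) {k l : ℕ} {x : E n}
    {A : ℝ} (h : osc lam T c k f x l < ENNReal.ofReal A) :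
    ApproxOn k f x (r * scale lam l) A := by
  have hA : 0 < A := ENNReal.ofReal_pos.1 (bot_le.trans_lt h)
  obtain ⟨P, hP⟩ := iInf_lt_iff.1 h
  obtain ⟨hdeg, hP⟩ := iInf_lt_iff.1 hP
  refine ⟨P, hdeg, ?_⟩
  rw [← ae_restrict_iff' measurableSet_ball]
  have h1 := ae_le_eLpNormEssSup (μ := volume.restrict (cell lam T c l x))
    (f := fun y : E n => f y - MvPolynomial.eval (fun i => ((y i : ℝ) : ℂ)) P)
  refine ae_restrict_of_ae_restrict_of_subset (ball_subset_cell hlam hr l x) ?_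
  filter_upwards [h1] with y hy
  rw [eLpNorm_exponent_top] at hP
  have h2 := hy.trans hP.le
  rw [← ofReal_norm] at h2
  exact (ENNReal.ofReal_le_ofReal_iff hA.le).1 h2

/-- The `+ 1` supplies the strict inequality required by `approxOn_of_osc_lt`, even for C = 0. -/
lemma osc_lt_of_scaled_le (hlam : 2 ≤ lam) {s : ℝ} {k l : ℕ} {x : E n} {C : ℝ≥0}
    (h : ENNReal.ofReal ((lam : ℝ) ^ ((l : ℝ) * s)) * osc lam T c k f x l ≤ C) :
    osc lam T c k f x l < ENNReal.ofReal ((C + 1) * scale lam l ^ s) := by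
  have h0 : (0 : ℝ) < lam := by exact_mod_cast (by omega : 0 < lam)
  have h1 := rpow_level_mul_scale_rpow hlam l s
  have hs : 0 < scale lam l ^ s := Real.rpow_pos_of_pos (scale_pos hlam l) s
  by_contra hlt
  push Not at hlt
  have h2 := (mul_le_mul_right hlt (ENNReal.ofReal ((lam : ℝ) ^ ((l : ℝ) * s)))).trans h
  rw [← ENNReal.ofReal_mul (by positivity), mul_left_comm, h1, mul_one,
    ← ENNReal.ofReal_coe_nnreal, ENNReal.ofReal_le_ofReal_iff C.coe_nonneg] at h2
  linarith

lemma memPointwise_of_osc_le (hlam : 2 ≤ lam) {s C : ℝ} {x : E n}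
    (h : ∀ l, osc lam T c ⌊s⌋₊ f x l ≤ ENNReal.ofReal (C * scale lam l ^ s)) :
    MemPointwise lam T c s f x := by
  refine ⟨C.toNNReal, fun l => ?_⟩
  refine (mul_le_mul_right (h l) _).trans ?_
  rw [← ENNReal.ofReal_mul (Real.rpow_nonneg (Nat.cast_nonneg _) _), mul_left_comm,
    rpow_level_mul_scale_rpow hlam, mul_one]
  rfl

/-- For ρ < r the level with λ^(-l-1) < ρ / r ≤ λ^(-l) is used, at the cost of a factor (λ / r)^s;
for larger ρ the zero polynomial suffices because f is bounded. -/
lemma exists_approxOn_of_memPointwise (hlam : 2 ≤ lam) (hr0 : 0 < r)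
    (hr : Metric.ball c r ⊆ T) {s : ℝ} (hs : 0 < s) {x : E n} {B : ℝ} (hB : ∀ y, ‖f y‖ ≤ B)
    (h : MemPointwise lam T c s f x) :
    ∃ C, 0 ≤ C ∧ ∀ ρ, 0 < ρ → ApproxOn ⌊s⌋₊ f x ρ (C * ρ ^ s) := by
  obtain ⟨C, hC⟩ := h
  have hB0 : 0 ≤ B := (norm_nonneg _).trans (hB 0)
  have h0 : (1 : ℝ) < lam := by exact_mod_cast (by omega : 1 < lam)
  refine ⟨(C + 1) * (lam / r) ^ s + B * (1 / r) ^ s, by positivity, fun ρ hρ => ?_⟩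
  rcases le_or_gt r ρ with hρr | hρr
  · refine approxOn_of_norm_le _ fun y _ => (hB y).trans ?_
    have : 1 ≤ (1 / r) ^ s * ρ ^ s := by
      rw [← Real.mul_rpow (by positivity) hρ.le]
      apply Real.one_le_rpow _ hs.le
      rw [one_div_mul_eq_div, one_le_div hr0]; exact hρr
    have h2 : 0 ≤ (C + 1) * (lam / r) ^ s * ρ ^ s := by positivity
    nlinarith
  · obtain ⟨l, hl1, hl2⟩ := exists_nat_pow_near_of_lt_one (x := ρ / r) (y := (lam : ℝ)⁻¹)
      (by positivity) (by rw [div_le_one hr0]; exact hρr.le) (by positivity)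
      (inv_lt_one_of_one_lt₀ h0)
    refine (approxOn_of_osc_lt hlam hr (osc_lt_of_scaled_le hlam (hC l))).mono le_rfl ?_ ?_
    · rw [inv_pow, div_le_iff₀ hr0] at hl2
      rw [scale, mul_comm]; exact hl2
    · have h3 : scale lam l ≤ lam / r * ρ := by
        rw [inv_pow] at hl1
        change scale lam (l + 1) < _ at hl1
        rw [scale_succ, div_lt_iff₀ (by positivity)] at hl1
        calc scale lam l ≤ _ := hl1.le
          _ = _ := by ring
      have h4 : scale lam l ^ s ≤ (lam / r) ^ s * ρ ^ s := by
        rw [← Real.mul_rpow (by positivity) hρ.le]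
        exact Real.rpow_le_rpow (scale_pos hlam l).le h3 hs.le
      have h5 : 0 ≤ B * (1 / r) ^ s * ρ ^ s := by positivity
      have h6 : (0 : ℝ) ≤ C + 1 := by positivity
      nlinarith

/-- The ball shrinks by δ for two reasons: a cell contained in U has an inscribed ball smaller than
itself, and its centre can be chosen only near x, the Hölder bound being known for almost all
centres. -/
lemma exists_approxOn_of_memHolder (hlam : 2 ≤ lam) (hr0 : 0 < r) (hrR : r ≤ R)
    (hr : Metric.ball c r ⊆ T) (hR : T ⊆ Metric.ball c R) {s : ℝ} (hs : 0 < s)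
    {U : Set (E n)} {B : ℝ} (hB : ∀ y, ‖f y‖ ≤ B) (h : MemHolder lam T c s f U) :
    ∃ C δ, 0 ≤ C ∧ 0 < δ ∧ δ ≤ 1 ∧
      ∀ x ρ, 0 < ρ → Metric.ball x ρ ⊆ U → ApproxOn ⌊s⌋₊ f x (δ * ρ) (C * ρ ^ s) := by
  obtain ⟨-, C, hC⟩ := h
  have hB0 : 0 ≤ B := (norm_nonneg _).trans (hB 0)
  have h0 : (1 : ℝ) < lam := by exact_mod_cast (by omega : 1 < lam)
  have hR0 : 0 < R := hr0.trans_le hrR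
  refine ⟨(C + 1) * (1 / (2 * R)) ^ s + B * (1 / (2 * R)) ^ s, r / (4 * R * lam),
    by positivity, by positivity, ?_, fun x ρ hρ hU => ?_⟩
  · rw [div_le_one (by positivity)]; nlinarith
  rcases le_or_gt (2 * R) ρ with hρr | hρr
  · refine approxOn_of_norm_le _ fun y _ => (hB y).trans ?_
    have : 1 ≤ (1 / (2 * R)) ^ s * ρ ^ s := by
      rw [← Real.mul_rpow (by positivity) hρ.le]
      apply Real.one_le_rpow _ hs.le
      rw [one_div_mul_eq_div, one_le_div (by positivity)]; exact hρr
    have h2 : 0 ≤ (C + 1) * (1 / (2 * R)) ^ s * ρ ^ s := by positivity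
    nlinarith
  · obtain ⟨l, hl1, hl2⟩ := exists_nat_pow_near_of_lt_one (x := ρ / (2 * R)) (y := (lam : ℝ)⁻¹)
      (by positivity) (by rw [div_le_one (by positivity)]; exact hρr.le) (by positivity)
      (inv_lt_one_of_one_lt₀ h0)
    rw [inv_pow] at hl1 hl2
    change scale lam (l + 1) < _ at hl1
    change _ ≤ scale lam l at hl2
    have hsc := scale_pos hlam (l + 1)
    have hl3 : ρ / (2 * R) / lam ≤ scale lam (l + 1) := by
      rw [scale_succ]; gcongr
    -- Good centres are dense. Within r/2 · λ^(-l-1) of x, the cell about x' still lies in the ball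
    -- of radius ρ (as r ≤ R), and its inscribed ball still contains the ball of radius δ ρ about x.
    obtain ⟨x', hx', hx'C⟩ := Metric.dense_iff.1 (Measure.dense_of_ae (hC (l + 1))) x
      (r / 2 * scale lam (l + 1)) (by positivity)
    rw [lt_div_iff₀ (by positivity)] at hl1
    have hsub : cell lam T c (l + 1) x' ⊆ U := by
      refine (cell_subset_ball hlam hR _ _).trans (subset_trans ?_ hU)
      apply Metric.ball_subset_ball'
      have := Metric.mem_ball.1 hx'
      nlinarith
    have h1 := approxOn_of_osc_lt hlam hr (osc_lt_of_scaled_le hlam (hx'C hsub))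
    have h2 : ApproxOn ⌊s⌋₊ f x (r / (4 * R * lam) * ρ)
        ((C + 1) * scale lam (l + 1) ^ s) := by
      obtain ⟨P, hP, hPf⟩ := h1
      refine ⟨P, hP, ?_⟩
      filter_upwards [hPf] with y hy hyx
      apply hy
      refine Metric.ball_subset_ball' ?_ hyx
      have h5 := Metric.mem_ball'.1 hx'
      have h6 : r / (4 * R * lam) * ρ = r / 2 * (ρ / (2 * R) / lam) := by field_simp; ring
      rw [h6]
      nlinarith
    refine h2.mono le_rfl le_rfl ?_
    have h3 : scale lam (l + 1) ≤ 1 / (2 * R) * ρ := by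
      rw [one_div_mul_eq_div, le_div_iff₀ (by positivity)]; exact hl1.le
    have h4 : scale lam (l + 1) ^ s ≤ (1 / (2 * R)) ^ s * ρ ^ s := by
      rw [← Real.mul_rpow (by positivity) hρ.le]
      exact Real.rpow_le_rpow hsc.le h3 hs.le
    have h5 : 0 ≤ B * (1 / (2 * R)) ^ s * ρ ^ s := by positivity
    have h6 : (0 : ℝ) ≤ C + 1 := by positivity
    nlinarith

end Cells

/-! ### Lowering the degree, and extending an approximation to the whole space. -/

section PolynomialApproximation

lemma sum_pow_sub_le {q : ℝ} (hq0 : 0 ≤ q) (hq1 : q < 1) (N : ℕ) :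
    ∑ i ∈ Finset.range N, q ^ (N - i) ≤ (1 - q)⁻¹ := by
  rw [← Finset.sum_range_reflect]
  calc ∑ j ∈ Finset.range N, q ^ (N - (N - 1 - j))
      ≤ ∑ j ∈ Finset.range N, q ^ j := by
        refine Finset.sum_le_sum fun j hj => ?_
        apply pow_le_pow_of_le_one hq0 hq1.le
        have := Finset.mem_range.1 hj
        omega
    _ ≤ ∑' j, q ^ j := (summable_geometric_of_lt_one hq0 hq1).sum_le_tsum _
        fun _ _ => by positivity
    _ = (1 - q)⁻¹ := tsum_geometric_of_lt_one hq0 hq1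

variable {n : ℕ}

lemma scale_rpow_succ {lam : ℕ} (hlam : 2 ≤ lam) (l : ℕ) (s : ℝ) :
    scale lam l ^ s = (lam : ℝ) ^ s * scale lam (l + 1) ^ s := by
  have h0 : (0 : ℝ) < lam := by exact_mod_cast (by omega : 0 < lam)
  rw [← Real.mul_rpow h0.le (scale_pos hlam _).le, scale_succ]
  congr 1
  field_simp

/-- Polynomial approximations of high degree with error `lam ^ (-l s)` at all scales can be
replaced by approximations of degree `⌊s⌋`. -/
lemma approxOn_floor_of_approxOn {lam : ℕ} (hlam : 2 ≤ lam) {f : E n → ℂ} {x : E n}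
    {s : ℝ} {K : ℕ} {C ρ B : ℝ} (hC : 0 ≤ C) (hρ : 0 < ρ) (hB : ∀ y, ‖f y‖ ≤ B)
    (h : ∀ l, ApproxOn K f x (ρ * scale lam l) (C * scale lam l ^ s)) :
    ∃ C', 0 ≤ C' ∧ ∀ l, ApproxOn ⌊s⌋₊ f x (ρ * scale lam l) (C' * scale lam l ^ s) := by
  have h0 : (1 : ℝ) < lam := by exact_mod_cast (by omega : 1 < lam)
  have h00 : (0 : ℝ) < lam := by linarith
  have hB0 : 0 ≤ B := (norm_nonneg _).trans (hB 0)
  choose P hdeg hP using h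
  obtain ⟨CK, hCK1, hCK⟩ := exists_homPart_bound n K
  set k := ⌊s⌋₊ with hk
  -- Parts of degree j ≥ k + 1 > s, normalised by λ^(-ls) on the ball of level l, shrink by λ^(s-j)
  -- ≤ q < 1 when the same polynomial is viewed one level deeper.
  set q : ℝ := (lam : ℝ) ^ (s - (k + 1)) with hq
  have hq0 : 0 < q := by positivity
  have hq1 : q < 1 := by
    apply Real.rpow_lt_one_of_one_lt_of_neg h0
    have := Nat.lt_floor_add_one s
    linarith
  set D := CK * ((1 + (lam : ℝ) ^ s) * C) with hD
  have hD0 : 0 ≤ D := by positivity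
  -- The bound a covers the parts at level 0 and satisfies a q + D ≤ a, where D pays for replacing P
  -- l by P (l + 1); hence it propagates through all levels.
  set a := D / (1 - q) + CK * (B + C) with ha
  have hqd : 0 < 1 - q := by linarith
  have ha0 : 0 ≤ a := by positivity
  have hstep : a * q + D ≤ a := by
    have h1 : D / (1 - q) * (1 - q) = D := div_mul_cancel₀ _ hqd.ne'
    have h2 : 0 ≤ CK * (B + C) * (1 - q) := by positivity
    nlinarith
  have hparts : ∀ j ∈ Finset.range (K + 1), k < j → ∀ l z,
      ‖polyEval (homPart (P l) x j) z‖ ≤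
        a * scale lam l ^ s * (‖z‖ / (ρ * scale lam l)) ^ j := by
    intro j hj hkj l
    induction l with
    | zero =>
      intro z
      have hb : ∀ y ∈ Metric.ball x ρ, ‖polyEval (P 0 - 0) y‖ ≤ C + B := by
        refine norm_polyEval_sub_le (f := f) ?_ (Eventually.of_forall fun y _ => ?_)
        · simpa using hP 0
        · simpa using hB y
      rw [sub_zero] at hb
      refine (hCK (P 0) x ρ (C + B) (hdeg 0) hρ hb j hj z).trans ?_
      simp only [scale_zero, Real.one_rpow, mul_one]
      refine mul_le_mul_of_nonneg_right ?_ (by positivity)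
      have : 0 ≤ D / (1 - q) := by positivity
      rw [ha]; linarith
    | succ l ih =>
      intro z
      have hsc := scale_pos hlam l
      have hsc' := scale_pos hlam (l + 1)
      have hb : ∀ y ∈ Metric.ball x (ρ * scale lam (l + 1)), ‖polyEval (P (l + 1) - P l) y‖ ≤
          C * scale lam (l + 1) ^ s + C * scale lam l ^ s := by
        refine norm_polyEval_sub_le (hP (l + 1)) ?_
        filter_upwards [hP l] with y hy hyr
        apply hy
        refine Metric.ball_subset_ball ?_ hyr
        exact mul_le_mul_of_nonneg_left (scale_anti hlam (Nat.le_succ l)) hρ.le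
      have h1 := hCK _ x _ _ ((MvPolynomial.totalDegree_sub _ _).trans
        (max_le (hdeg (l + 1)) (hdeg l))) (by positivity) hb j hj z
      rw [homPart_sub, polyEval_sub, scale_rpow_succ hlam l] at h1
      have h2 := ih z
      rw [scale_rpow_succ hlam l] at h2
      set w := scale lam (l + 1) ^ s with hw
      have hw0 : 0 < w := Real.rpow_pos_of_pos hsc' s
      set v := (‖z‖ / (ρ * scale lam (l + 1))) ^ j with hv
      have hv0 : 0 ≤ v := by positivity
      have h3 : (‖z‖ / (ρ * scale lam l)) ^ j = v * ((lam : ℝ) ^ j)⁻¹ := by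
        rw [hv, scale_succ, ← inv_pow, ← mul_pow]
        congr 1
        field_simp
      have h4 : (lam : ℝ) ^ s * ((lam : ℝ) ^ j)⁻¹ ≤ q := by
        rw [hq, ← Real.rpow_natCast, ← Real.rpow_neg h00.le, ← Real.rpow_add h00]
        apply Real.rpow_le_rpow_of_exponent_le h0.le
        have : ((k + 1 : ℕ) : ℝ) ≤ j := by exact_mod_cast hkj
        push_cast at this
        linarith
      rw [h3] at h2
      have h5 := norm_add_le (polyEval (homPart (P (l + 1)) x j) z -
        polyEval (homPart (P l) x j) z) (polyEval (homPart (P l) x j) z)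
      rw [sub_add_cancel] at h5
      calc _ ≤ _ := h5
        _ ≤ _ := add_le_add h1 h2
        _ = (a * ((lam : ℝ) ^ s * ((lam : ℝ) ^ j)⁻¹) + D) * (w * v) := by rw [hD]; ring
        _ ≤ (a * q + D) * (w * v) := by gcongr
        _ ≤ a * (w * v) := by gcongr
        _ = a * w * v := by ring
  refine ⟨C + (K + 1) * a, by positivity, fun l => ?_⟩
  have hsc := scale_pos hlam l
  refine ⟨truncAt (P l) x k, totalDegree_truncAt_le _ _ _, ?_⟩
  filter_upwards [hP l] with y hy hyr
  have hyx : y = x + (y - x) := by abel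
  have hw0 : 0 < scale lam l ^ s := Real.rpow_pos_of_pos hsc s
  have hdiff : ‖polyEval (P l) y - polyEval (truncAt (P l) x k) y‖ ≤
      (K + 1) * a * scale lam l ^ s := by
    rw [hyx, polyEval_truncAt, polyEval_eq_sum_homPart (hdeg l)]
    rcases le_or_gt K k with hKk | hKk
    · have : ∑ j ∈ Finset.range (k + 1), polyEval (homPart (P l) x j) (y - x) =
          ∑ j ∈ Finset.range (K + 1), polyEval (homPart (P l) x j) (y - x) := by
        symm
        refine Finset.sum_subset (fun i hi => ?_) (fun i _ hi => ?_)
        · simp only [Finset.mem_range] at hi ⊢; omega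
        · unfold homPart
          rw [MvPolynomial.homogeneousComponent_eq_zero, polyEval_zero]
          have := (totalDegree_affineSubst_le 1 x (P l)).trans (hdeg l)
          simp only [Finset.mem_range] at hi; omega
      rw [this, sub_self, norm_zero]
      positivity
    · rw [← Finset.sum_sdiff (s₁ := Finset.range (k + 1)) (s₂ := Finset.range (K + 1))
        (Finset.range_subset_range.2 (by omega)), add_sub_cancel_right]
      refine (norm_sum_le _ _).trans ((Finset.sum_le_card_nsmul _ _ (a * scale lam l ^ s) ?_).trans ?_)
      · intro j hj
        rw [Finset.mem_sdiff, Finset.mem_range, Finset.mem_range] at hj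
        refine (hparts j (Finset.mem_range.2 hj.1) (by omega) l _).trans ?_
        refine mul_le_of_le_one_right (by positivity) (pow_le_one₀ (by positivity) ?_)
        rw [div_le_one (by positivity), ← dist_eq_norm]
        exact (Metric.mem_ball.1 hyr).le
      · rw [nsmul_eq_mul, mul_assoc]
        refine mul_le_mul_of_nonneg_right ?_ (by positivity)
        have := Finset.card_le_card (Finset.sdiff_subset (s := Finset.range (K + 1))
          (t := Finset.range (k + 1)))
        rw [Finset.card_range] at this
        exact_mod_cast this
  calc _ = ‖(f y - polyEval (P l) y) + (polyEval (P l) y - polyEval (truncAt (P l) x k) y)‖ := by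
        rw [sub_add_sub_cancel]
    _ ≤ C * scale lam l ^ s + (K + 1) * a * scale lam l ^ s :=
        (norm_add_le _ _).trans (add_le_add (hy hyr) hdiff)
    _ = _ := by ring

/-- After lowering the degree, a shift by N levels brings the cell radius R below ρ; the first N
levels are covered by the boundedness of f. -/
lemma memPointwise_of_approxOn {lam : ℕ} (hlam : 2 ≤ lam) {T : Set (E n)} {c : E n} {R : ℝ}
    (hR0 : 0 < R) (hR : T ⊆ Metric.ball c R) {f : E n → ℂ} {x : E n}
    {s : ℝ} (hs : 0 < s) {K : ℕ} {C ρ B : ℝ} (hC : 0 ≤ C) (hρ : 0 < ρ) (hB : ∀ y, ‖f y‖ ≤ B)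
    (h : ∀ l, ApproxOn K f x (ρ * scale lam l) (C * scale lam l ^ s)) :
    MemPointwise lam T c s f x := by
  have h00 : (0 : ℝ) < lam := by exact_mod_cast (by omega : 0 < lam)
  have hB0 : 0 ≤ B := (norm_nonneg _).trans (hB 0)
  obtain ⟨C', hC', h'⟩ := approxOn_floor_of_approxOn hlam hC hρ hB h
  obtain ⟨N, hN⟩ := exists_scale_le hlam (a := ρ / R) (by positivity)
  have hN0 := Real.rpow_pos_of_pos (scale_pos hlam N) s
  refine memPointwise_of_osc_le hlam (C := (B + C') / scale lam N ^ s) fun l => ?_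
  apply osc_le_of_approxOn hlam hR
  rcases le_or_gt N l with hl | hl
  · obtain ⟨d, rfl⟩ := Nat.exists_eq_add_of_le hl
    refine (h' d).mono le_rfl ?_ ?_
    · rw [scale_add]
      have := scale_pos hlam d
      rw [le_div_iff₀ hR0] at hN
      nlinarith
    · rw [scale_add, Real.mul_rpow (scale_pos hlam N).le (scale_pos hlam d).le]
      have := Real.rpow_pos_of_pos (scale_pos hlam d) s
      rw [← mul_assoc, div_mul_cancel₀ _ hN0.ne']
      nlinarith
  · refine approxOn_of_norm_le _ fun y _ => (hB y).trans ?_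
    have h1 : scale lam N ^ s ≤ scale lam l ^ s :=
      Real.rpow_le_rpow (scale_pos hlam N).le (scale_anti hlam hl.le) hs.le
    rw [div_mul_eq_mul_div, le_div_iff₀ hN0]
    nlinarith

/-- Local polynomial approximation of order `t > K` by polynomials of degree at most `K` controls
the error of the approximation at a fixed scale on the whole space. -/
lemma exists_approx_whole_space {f : E n → ℂ} {x : E n} {K : ℕ} {t C : ℝ} (hKt : (K : ℝ) < t)
    (hC : 0 ≤ C) (h : ∀ ρ, 0 < ρ → ApproxOn K f x ρ (C * ρ ^ t)) :
    ∃ C', 0 ≤ C' ∧ ∀ ρ, 0 < ρ → ∃ P : MvPolynomial (Fin n) ℂ,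
      ∀ᵐ y : E n, ‖f y - polyEval P y‖ ≤ C' * (ρ + ‖y - x‖) ^ t := by
  obtain ⟨CK, hCK1, hCK⟩ := exists_growth_bound n K
  have ht0 : 0 < t := (Nat.cast_nonneg K).trans_lt hKt
  set q : ℝ := (2 : ℝ) ^ ((K : ℝ) - t) with hq
  have hq0 : 0 < q := by positivity
  have hq1 : q < 1 := Real.rpow_lt_one_of_one_lt_of_neg (by norm_num) (by linarith)
  have hqd : 0 < (1 - q)⁻¹ := inv_pos.2 (by linarith)
  set D := CK * (C * (1 + 2 ^ t)) with hD
  have hD0 : 0 ≤ D := by positivity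
  set F := (C + D * (1 - q)⁻¹) with hF
  have hF0 : 0 ≤ F := by positivity
  refine ⟨F * 2 ^ t, by positivity, fun ρ hρ => ?_⟩
  choose P hdeg hP using fun i : ℕ => h (2 ^ i * ρ) (by positivity)
  refine ⟨P 0, ?_⟩
  have hmono : ∀ {i I : ℕ}, i ≤ I → (2 : ℝ) ^ i * ρ ≤ 2 ^ I * ρ := fun hiI => by
    gcongr; norm_num
  -- Growing from radius 2^i ρ to 2^I ρ costs 2^((I-i)K), but the bound there is 2^(-(I-i)t) times
  -- that at radius 2^I ρ. As K < t, the net factor q^(I-i) is summable.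
  have hstep : ∀ I, ∀ i ∈ Finset.range I, ∀ y ∈ Metric.ball x (2 ^ I * ρ),
      ‖polyEval (P i - P (i + 1)) y‖ ≤ D * (2 ^ I * ρ) ^ t * q ^ (I - i) := by
    intro I i hi y hy
    have hi' := Finset.mem_range.1 hi
    have hb : ∀ y ∈ Metric.ball x (2 ^ i * ρ), ‖polyEval (P i - P (i + 1)) y‖ ≤
        C * (2 ^ i * ρ) ^ t + C * (2 ^ (i + 1) * ρ) ^ t := by
      refine norm_polyEval_sub_le (hP i) ?_
      filter_upwards [hP (i + 1)] with y hy hyr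
      exact hy (Metric.ball_subset_ball (hmono (Nat.le_succ i)) hyr)
    refine (hCK _ x _ _ _ ((MvPolynomial.totalDegree_sub _ _).trans
      (max_le (hdeg i) (hdeg (i + 1)))) (by positivity) (hmono hi'.le) hb y hy).trans ?_
    obtain ⟨d, rfl⟩ := Nat.exists_eq_add_of_le hi'.le
    rw [Nat.add_sub_cancel_left]
    have e1 : (2 : ℝ) ^ (i + d) * ρ / (2 ^ i * ρ) = 2 ^ d := by
      rw [pow_add]; field_simp
    have e2 : ((2 : ℝ) ^ (i + 1) * ρ) ^ t = 2 ^ t * (2 ^ i * ρ) ^ t := by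
      rw [← Real.mul_rpow (by norm_num) (by positivity), pow_succ]; congr 1; ring
    have e3 : ((2 : ℝ) ^ (i + d) * ρ) ^ t = ((2 : ℝ) ^ t) ^ d * (2 ^ i * ρ) ^ t := by
      rw [Real.rpow_pow_comm (by norm_num), ← Real.mul_rpow (by positivity) (by positivity),
        pow_add]
      congr 1; ring
    have e4 : q ^ d = (2 ^ d) ^ K / ((2 : ℝ) ^ t) ^ d := by
      rw [hq, Real.rpow_sub (by norm_num), div_pow, Real.rpow_natCast, ← pow_mul, ← pow_mul,
        mul_comm]
    rw [e1, e2, e3, e4]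
    have : (0 : ℝ) < (2 ^ t) ^ d := by positivity
    apply le_of_eq
    rw [hD]
    field_simp
  have htot : ∀ I, ∀ y ∈ Metric.ball x (2 ^ I * ρ),
      ‖polyEval (P 0) y - polyEval (P I) y‖ ≤ D * (1 - q)⁻¹ * (2 ^ I * ρ) ^ t := by
    intro I y hy
    rw [← Finset.sum_range_sub' (fun i => polyEval (P i) y) I]
    refine (norm_sum_le _ _).trans ?_
    calc _ ≤ ∑ i ∈ Finset.range I, D * (2 ^ I * ρ) ^ t * q ^ (I - i) := by
          refine Finset.sum_le_sum fun i hi => ?_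
          rw [← polyEval_sub]
          exact hstep I i hi y hy
      _ = D * (2 ^ I * ρ) ^ t * ∑ i ∈ Finset.range I, q ^ (I - i) := by rw [Finset.mul_sum]
      _ ≤ D * (2 ^ I * ρ) ^ t * (1 - q)⁻¹ := by
          gcongr; exact sum_pow_sub_le hq0.le hq1 I
      _ = _ := by ring
  have hall : ∀ I, ∀ᵐ y : E n, y ∈ Metric.ball x (2 ^ I * ρ) →
      ‖f y - polyEval (P 0) y‖ ≤ F * (2 ^ I * ρ) ^ t := by
    intro I
    filter_upwards [hP I] with y hy hyr
    calc _ = ‖(f y - polyEval (P I) y) - (polyEval (P 0) y - polyEval (P I) y)‖ := by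
          congr 1; ring
      _ ≤ C * (2 ^ I * ρ) ^ t + D * (1 - q)⁻¹ * (2 ^ I * ρ) ^ t :=
          (norm_sub_le _ _).trans (add_le_add (hy hyr) (htot I y hyr))
      _ = _ := by ring
  filter_upwards [ae_all_iff.2 hall] with y hy
  have hex : ∃ I : ℕ, y ∈ Metric.ball x (2 ^ I * ρ) ∧ 2 ^ I * ρ ≤ 2 * (ρ + ‖y - x‖) := by
    rcases lt_or_ge ‖y - x‖ ρ with h1 | h1
    · refine ⟨0, ?_, ?_⟩
      · simpa [dist_eq_norm] using h1
      · have := norm_nonneg (y - x)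
        simp only [pow_zero, one_mul]; linarith
    · obtain ⟨I, hI1, hI2⟩ := exists_nat_pow_near (x := ‖y - x‖ / ρ) (y := (2 : ℝ))
        ((one_le_div hρ).2 h1) (by norm_num)
      refine ⟨I + 1, ?_, ?_⟩
      · rw [Metric.mem_ball, dist_eq_norm]
        exact (div_lt_iff₀ hρ).1 hI2
      · rw [le_div_iff₀ hρ] at hI1
        rw [pow_succ]
        linarith
  obtain ⟨I, hI, hI2⟩ := hex
  refine (hy I hI).trans ?_
  rw [mul_assoc]
  refine mul_le_mul_of_nonneg_left ?_ hF0
  rw [← Real.mul_rpow (by norm_num) (by positivity)]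
  exact Real.rpow_le_rpow (by positivity) hI2 ht0.le

end PolynomialApproximation

/-! ### Vanishing moments and reproduction of polynomials. -/

section Moments

variable {n : ℕ} {θ : 𝓢(E n, ℂ)}

/-- Up to a nonzero power of -2πi the integral is the k-th derivative of the Fourier transform at 0,
applied to e; that transform is constant near 0. -/
lemma integral_prod_inner_smul_eq_zero (hθ : (fun ξ => (𝓕 θ) ξ) =ᶠ[nhds 0] fun _ => (1 : ℂ))
    {k : ℕ} (hk : k ≠ 0) (e : Fin k → E n) :
    ∫ u : E n, (∏ a, inner ℝ u (e a)) • θ u = 0 := by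
  have h1 : iteratedFDeriv ℝ k (𝓕 (θ : E n → ℂ)) 0 = 0 := by
    have h2 : (𝓕 (θ : E n → ℂ)) =ᶠ[nhds 0] fun _ => (1 : ℂ) := hθ
    rw [(Filter.EventuallyEq.iteratedFDeriv ℝ h2 k).eq_of_nhds, iteratedFDeriv_const_of_ne hk]
    rfl
  have hint : ∀ m : ℕ, Integrable (fun v : E n => ‖v‖ ^ m * ‖θ v‖) :=
    fun m => θ.integrable_pow_mul volume m
  rw [Real.iteratedFDeriv_fourier (N := ⊤) (fun m _ => hint m)
    θ.continuous.aestronglyMeasurable (by exact_mod_cast le_top)] at h1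
  rw [Real.fourier_eq] at h1
  simp only [inner_zero_right, neg_zero, AddChar.map_zero_eq_one, one_smul] at h1
  have hi := VectorFourier.integrable_fourierPowSMulRight (innerSL ℝ) (hint k)
    θ.continuous.aestronglyMeasurable
  have h3 := congrArg (fun M => (ContinuousMultilinearMap.apply ℝ (fun _ : Fin k => E n) ℂ e) M) h1
  simp only at h3
  rw [← ContinuousLinearMap.integral_comp_comm _ hi] at h3
  simp only [ContinuousMultilinearMap.apply_apply, VectorFourier.fourierPowSMulRight_apply,
    zero_apply] at h3
  rw [integral_smul, smul_eq_zero] at h3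
  refine h3.resolve_left (pow_ne_zero _ ?_)
  simp [Real.pi_ne_zero]

lemma integral_eq_one_of_fourier (hθ : (𝓕 θ) 0 = 1) : ∫ u : E n, θ u = 1 := by
  rw [SchwartzMap.fourier_coe, Real.fourier_eq] at hθ
  simpa using hθ

lemma norm_polyEval_le (P : MvPolynomial (Fin n) ℂ) :
    ∃ C, 0 ≤ C ∧ ∀ u : E n, ‖polyEval P u‖ ≤ C * (1 + ‖u‖ ^ P.totalDegree) := by
  refine ⟨∑ d ∈ P.support, ‖P.coeff d‖, by positivity, fun u => ?_⟩
  rw [polyEval, MvPolynomial.eval_eq', Finset.sum_mul]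
  refine (norm_sum_le _ _).trans (Finset.sum_le_sum fun d hd => ?_)
  rw [norm_mul]
  refine mul_le_mul_of_nonneg_left ?_ (norm_nonneg _)
  rw [norm_prod]
  have h1 : ∏ i, ‖((u i : ℝ) : ℂ) ^ d i‖ ≤ ‖u‖ ^ (∑ i, d i) := by
    rw [← Finset.prod_pow_eq_pow_sum]
    refine Finset.prod_le_prod (fun _ _ => norm_nonneg _) fun i _ => ?_
    rw [norm_pow, Complex.norm_real]
    exact pow_le_pow_left₀ (norm_nonneg _) (PiLp.norm_apply_le u i) _
  refine h1.trans ?_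
  have hle : ∑ i, d i ≤ P.totalDegree := by
    have := MvPolynomial.le_totalDegree hd
    rwa [Finsupp.sum_fintype _ _ (by simp)] at this
  rcases le_total ‖u‖ 1 with hu | hu
  · have := pow_le_one₀ (n := ∑ i, d i) (norm_nonneg u) hu
    have : 0 ≤ ‖u‖ ^ P.totalDegree := by positivity
    linarith
  · have := pow_le_pow_right₀ hu hle
    linarith

lemma integrable_polyEval_mul (P : MvPolynomial (Fin n) ℂ) :
    Integrable (fun u : E n => polyEval P u * θ u) := by
  obtain ⟨C, hC, h⟩ := norm_polyEval_le P
  have h1 : Integrable (fun u : E n => C * (‖θ u‖ + ‖u‖ ^ P.totalDegree * ‖θ u‖)) :=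
    (θ.integrable.norm.add (θ.integrable_pow_mul volume _)).const_mul C
  refine h1.mono' ((continuous_polyEval P).mul θ.continuous).aestronglyMeasurable
    (Eventually.of_forall fun u => ?_)
  rw [norm_mul]
  calc _ ≤ C * (1 + ‖u‖ ^ P.totalDegree) * ‖θ u‖ :=
        mul_le_mul_of_nonneg_right (h u) (norm_nonneg _)
    _ = _ := by ring

/-- A Schwartz function whose Fourier transform is `1` near the origin reproduces polynomials. -/
lemma integral_polyEval_mul (hθ : (fun ξ => (𝓕 θ) ξ) =ᶠ[nhds 0] fun _ => (1 : ℂ))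
    (P : MvPolynomial (Fin n) ℂ) : ∫ u : E n, polyEval P u * θ u = polyEval P 0 := by
  induction P using MvPolynomial.induction_on' with
  | add P Q hP hQ =>
    simp only [polyEval_add, add_mul]
    rw [integral_add (integrable_polyEval_mul P) (integrable_polyEval_mul Q), hP, hQ]
  | monomial d a =>
    have hmon : ∀ u : E n, polyEval (MvPolynomial.monomial d a) u =
        a * (((Finsupp.toMultiset d).toList.map fun i => ((u i : ℝ) : ℂ)).prod) := by
      intro u
      rw [polyEval, MvPolynomial.eval_monomial, ← Multiset.prod_coe, ← Multiset.map_coe,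
        Multiset.coe_toList, Finsupp.toMultiset_map, Finsupp.prod_toMultiset,
        Finsupp.prod_mapDomain_index (by simp) (by simp [pow_add])]
    set L := (Finsupp.toMultiset d).toList with hL
    -- Listing the variables of the monomial with multiplicity writes it as a product of inner
    -- products with basis vectors, the form in which derivatives of the Fourier transform produce
    -- moments.
    have hprod : ∀ u : E n, (L.map fun i => ((u i : ℝ) : ℂ)).prod =
        ((∏ k : Fin L.length, inner ℝ u (EuclideanSpace.single (L.get k) (1 : ℝ)) : ℝ) : ℂ) := by
      intro u
      simp only [EuclideanSpace.inner_single_right]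
      rw [Complex.ofReal_prod, ← List.prod_ofFn]
      congr 1
      conv_lhs => rw [← List.ofFn_get L]
      rw [List.map_ofFn]
      congr 1
      ext k
      simp
    simp only [hmon, hprod]
    rcases eq_or_ne L.length 0 with h0 | h0
    · have : IsEmpty (Fin L.length) := by rw [h0]; infer_instance
      simp only [Finset.univ_eq_empty, Finset.prod_empty, Complex.ofReal_one, mul_one]
      rw [integral_const_mul, integral_eq_one_of_fourier hθ.eq_of_nhds, mul_one]
    · have h1 := integral_prod_inner_smul_eq_zero hθ h0
        (fun k => EuclideanSpace.single (L.get k) (1 : ℝ))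
      have h2 : ∏ k : Fin L.length,
          inner ℝ (0 : E n) (EuclideanSpace.single (L.get k) (1 : ℝ)) = 0 := by
        have : Nonempty (Fin L.length) := ⟨⟨0, Nat.pos_of_ne_zero h0⟩⟩
        simp [h0]
      rw [h2, Complex.ofReal_zero, mul_zero]
      simp only [mul_assoc]
      rw [integral_const_mul]
      simp only [Complex.real_smul] at h1
      rw [h1, mul_zero]

end Moments

/-! ### Littlewood-Paley pieces controlled by polynomial approximation. -/

section LittlewoodPaley

variable {n : ℕ} {lam : ℕ} {θ : 𝓢(E n, ℂ)}

lemma integrable_polyEval_sub_mul_dilate (P : MvPolynomial (Fin n) ℂ) (y : E n) {a : ℝ}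
    (ha : 0 < a) : Integrable (fun u : E n => polyEval P (y - u) * ((a : ℂ) ^ n * θ (a • u))) := by
  have h1 := ((integrable_polyEval_mul (θ := θ) (affineSubst (-a⁻¹) y P)).comp_smul
    ha.ne').const_mul ((a : ℂ) ^ n)
  refine h1.congr (Eventually.of_forall fun u => ?_)
  simp only [polyEval_affineSubst, smul_smul, neg_mul, inv_mul_cancel₀ ha.ne', neg_smul,
    one_smul, neg_add_eq_sub]
  ring

lemma integral_polyEval_sub_mul_dilate
    (hθ : (fun ξ => (𝓕 θ) ξ) =ᶠ[nhds 0] fun _ => (1 : ℂ))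
    (P : MvPolynomial (Fin n) ℂ) (y : E n) {a : ℝ} (ha : 0 < a) :
    ∫ u : E n, polyEval P (y - u) * ((a : ℂ) ^ n * θ (a • u)) = polyEval P y := by
  have h1 := integral_polyEval_mul hθ (affineSubst (-a⁻¹) y P)
  have h2 := Measure.integral_comp_smul_of_nonneg (volume : Measure (E n))
    (fun u => polyEval (affineSubst (-a⁻¹) y P) u * θ u) a (hR := ha.le)
  rw [h1, finrank_euclideanSpace_fin] at h2
  simp only [polyEval_affineSubst, smul_smul, neg_mul, inv_mul_cancel₀ ha.ne', neg_smul,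
    one_smul, smul_zero, zero_add, neg_add_eq_sub, Complex.real_smul] at h2
  have h3 : ∀ u : E n, polyEval P (y - u) * ((a : ℂ) ^ n * θ (a • u)) =
      (a : ℂ) ^ n * (polyEval P (y - u) * θ (a • u)) := fun u => by ring
  simp only [h3]
  rw [integral_const_mul, h2]
  have : (a : ℂ) ≠ 0 := by exact_mod_cast ha.ne'
  push_cast
  field_simp

lemma IsLPGenerator.eventuallyEq (hlam : 2 ≤ lam) (hθ : IsLPGenerator lam θ) :
    (fun ξ => (𝓕 θ) ξ) =ᶠ[nhds 0] fun _ => (1 : ℂ) := by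
  have h0 : (0 : ℝ) < (lam : ℝ)⁻¹ := by
    have : (0 : ℝ) < lam := by exact_mod_cast (by omega : 0 < lam)
    positivity
  filter_upwards [Metric.ball_mem_nhds (0 : E n) h0] with ξ hξ
  exact hθ.2 ξ (mem_ball_zero_iff.1 hξ).le

/-- The kernel is a difference of two dilates of θ, each of which reproduces polynomials, so it
annihilates them. -/
lemma lpKernel_eq (l : ℕ) (u : E n) :
    (lam : ℂ) ^ (l * n) * lpPsi lam θ (((lam : ℝ) ^ l) • u) =
      ((((lam : ℝ) ^ (l + 1) : ℝ) : ℂ)) ^ n * θ (((lam : ℝ) ^ (l + 1)) • u) -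
      ((((lam : ℝ) ^ l : ℝ) : ℂ)) ^ n * θ (((lam : ℝ) ^ l) • u) := by
  rw [lpPsi, smul_smul, ← pow_succ']
  push_cast
  rw [mul_sub, ← mul_assoc, ← pow_mul, ← pow_mul, ← pow_add]
  ring_nf

lemma integrable_polyEval_mul_lpKernel (hlam : 2 ≤ lam) (P : MvPolynomial (Fin n) ℂ) (y : E n)
    (l : ℕ) : Integrable (fun u : E n => polyEval P (y - u) *
      ((lam : ℂ) ^ (l * n) * lpPsi lam θ (((lam : ℝ) ^ l) • u))) := by
  have h0 : (0 : ℝ) < lam := by exact_mod_cast (by omega : 0 < lam)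
  simp only [lpKernel_eq, mul_sub]
  exact (integrable_polyEval_sub_mul_dilate P y (by positivity)).sub
    (integrable_polyEval_sub_mul_dilate P y (by positivity))

/-- The Littlewood-Paley kernels annihilate polynomials. -/
lemma integral_polyEval_mul_lpKernel (hlam : 2 ≤ lam) (hθ : IsLPGenerator lam θ)
    (P : MvPolynomial (Fin n) ℂ) (y : E n) (l : ℕ) :
    ∫ u : E n, polyEval P (y - u) *
      ((lam : ℂ) ^ (l * n) * lpPsi lam θ (((lam : ℝ) ^ l) • u)) = 0 := by
  have h0 : (0 : ℝ) < lam := by exact_mod_cast (by omega : 0 < lam)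
  simp only [lpKernel_eq, mul_sub]
  rw [integral_sub (integrable_polyEval_sub_mul_dilate P y (by positivity))
    (integrable_polyEval_sub_mul_dilate P y (by positivity)),
    integral_polyEval_sub_mul_dilate (hθ.eventuallyEq hlam) P y (by positivity),
    integral_polyEval_sub_mul_dilate (hθ.eventuallyEq hlam) P y (by positivity), sub_self]

lemma integrable_one_add_norm_rpow_mul (t : ℝ) (ht : 0 ≤ t) :
    Integrable (fun u : E n => (1 + ‖u‖) ^ t * ‖θ u‖) := by
  set N := ⌈t⌉₊
  have h1 : Integrable (fun u : E n => 2 ^ N * (‖θ u‖ + ‖u‖ ^ N * ‖θ u‖)) :=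
    (θ.integrable.norm.add (θ.integrable_pow_mul volume N)).const_mul _
  refine h1.mono' ?_ (Eventually.of_forall fun u => ?_)
  · refine Continuous.aestronglyMeasurable (Continuous.mul ?_ θ.continuous.norm)
    exact Continuous.rpow_const (by fun_prop) fun u => Or.inr ht
  · rw [Real.norm_of_nonneg (by positivity)]
    have h2 : (1 + ‖u‖) ^ t ≤ (1 + ‖u‖) ^ N := by
      rw [← Real.rpow_natCast]
      exact Real.rpow_le_rpow_of_exponent_le (by linarith [norm_nonneg u]) (Nat.le_ceil t)
    have h3 : (1 + ‖u‖) ^ N ≤ 2 ^ N * (1 + ‖u‖ ^ N) := by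
      rcases le_total ‖u‖ 1 with hu | hu
      · calc (1 + ‖u‖) ^ N ≤ 2 ^ N := pow_le_pow_left₀ (by positivity) (by linarith) _
          _ ≤ _ := le_mul_of_one_le_right (by positivity) (by
            have : 0 ≤ ‖u‖ ^ N := by positivity
            linarith)
      · calc (1 + ‖u‖) ^ N ≤ (2 * ‖u‖) ^ N := pow_le_pow_left₀ (by positivity) (by linarith) _
          _ = 2 ^ N * ‖u‖ ^ N := mul_pow _ _ _
          _ ≤ _ := by gcongr; linarith
    calc _ ≤ 2 ^ N * (1 + ‖u‖ ^ N) * ‖θ u‖ :=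
          mul_le_mul_of_nonneg_right (h2.trans h3) (norm_nonneg _)
      _ = _ := by ring

lemma integrable_one_add_norm_rpow_mul_lpPsi (hlam : 2 ≤ lam) {t : ℝ} (ht : 0 ≤ t) :
    Integrable (fun u : E n => (1 + ‖u‖) ^ t * ‖lpPsi lam θ u‖) := by
  have h0 : (1 : ℝ) < lam := by exact_mod_cast (by omega : 1 < lam)
  have h1 := integrable_one_add_norm_rpow_mul (θ := θ) t ht
  have h2 := (h1.comp_smul (R := (lam : ℝ)) (by positivity)).const_mul ((lam : ℝ) ^ n)
  have hc : Continuous (lpPsi lam θ) := by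
    unfold lpPsi
    exact (continuous_const.mul (θ.continuous.comp (continuous_const_smul _))).sub θ.continuous
  refine (h2.add h1).mono' ?_ (Eventually.of_forall fun u => ?_)
  · refine Continuous.aestronglyMeasurable (Continuous.mul ?_ hc.norm)
    exact Continuous.rpow_const (by fun_prop) fun u => Or.inr ht
  · rw [Real.norm_of_nonneg (by positivity)]
    have h3 : (1 + ‖u‖) ^ t ≤ (1 + ‖(lam : ℝ) • u‖) ^ t := by
      apply Real.rpow_le_rpow (by positivity) _ ht
      rw [norm_smul, Real.norm_of_nonneg (by positivity)]
      nlinarith [norm_nonneg u]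
    have h4 : ‖lpPsi lam θ u‖ ≤ (lam : ℝ) ^ n * ‖θ ((lam : ℝ) • u)‖ + ‖θ u‖ := by
      refine (norm_sub_le _ _).trans ?_
      simp
    have h5 : 0 ≤ (1 + ‖u‖) ^ t := by positivity
    have h6 : 0 ≤ (lam : ℝ) ^ n * ‖θ ((lam : ℝ) • u)‖ := by positivity
    simp only [Pi.add_apply]
    nlinarith

/-- The Littlewood-Paley pieces of a bounded function are uniformly bounded. -/
lemma exists_norm_lpPiece_le (hlam : 2 ≤ lam) (θ : 𝓢(E n, ℂ)) {f : E n → ℂ} {B : ℝ}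
    (hB : ∀ y, ‖f y‖ ≤ B) : ∃ C, ∀ l y, ‖lpPiece lam θ f l y‖ ≤ C := by
  have h0 : (0 : ℝ) < lam := by exact_mod_cast (by omega : 0 < lam)
  have hG : Integrable (fun u : E n => ‖lpPsi lam θ u‖) := by
    simpa using integrable_one_add_norm_rpow_mul_lpPsi (θ := θ) hlam le_rfl
  refine ⟨B * ∫ u : E n, ‖lpPsi lam θ u‖, fun l y => ?_⟩
  have hlp : (0 : ℝ) < (lam : ℝ) ^ l := by positivity
  refine (norm_integral_le_of_norm_le
    (((hG.comp_smul hlp.ne').const_mul (((lam : ℝ) ^ l) ^ n)).const_mul B)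
    (Eventually.of_forall fun u => ?_)).trans ?_
  · rw [norm_mul, norm_mul]
    refine mul_le_mul (hB _) (le_of_eq ?_) (by positivity) ((norm_nonneg _).trans (hB 0))
    simp [pow_mul]
  · rw [integral_const_mul, integral_const_mul,
      Measure.integral_comp_smul_of_nonneg _ (fun u => ‖lpPsi lam θ u‖) _ (hR := hlp.le),
      finrank_euclideanSpace_fin, smul_eq_mul, mul_inv_cancel_left₀ (by positivity)]

/-- Polynomial approximation of order `t` at a point bounds the Littlewood-Paley pieces. -/
lemma exists_lpPiece_bound (hlam : 2 ≤ lam) (hθ : IsLPGenerator lam θ) {f : E n → ℂ} {x : E n}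
    {K : ℕ} {t C : ℝ} (hKt : (K : ℝ) < t) (hC : 0 ≤ C)
    (h : ∀ ρ, 0 < ρ → ApproxOn K f x ρ (C * ρ ^ t)) :
    ∃ C', 0 ≤ C' ∧ ∀ l y, ‖lpPiece lam θ f l y‖ ≤ C' * (scale lam l + ‖y - x‖) ^ t := by
  have ht : 0 ≤ t := (Nat.cast_nonneg K).trans hKt.le
  have h0 : (0 : ℝ) < lam := by exact_mod_cast (by omega : 0 < lam)
  obtain ⟨D, hD, hP⟩ := exists_approx_whole_space hKt hC h
  set J := ∫ u : E n, (1 + ‖u‖) ^ t * ‖lpPsi lam θ u‖ with hJ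
  have hJ0 : 0 ≤ J := integral_nonneg fun u => by positivity
  refine ⟨D * 2 ^ t * J, by positivity, fun l y => ?_⟩
  -- With the radius adapted to y, the error at y - u is at most a constant times ρ^t (1 + |λ^l
  -- u|)^t, and the second factor is absorbed by the decay of ψ.
  set ρ := scale lam l + ‖y - x‖ with hρ
  have hsc := scale_pos hlam l
  have hρ0 : 0 < ρ := by positivity
  obtain ⟨P, hP⟩ := hP ρ hρ0
  set k : E n → ℂ := fun u => (lam : ℂ) ^ (l * n) * lpPsi lam θ (((lam : ℝ) ^ l) • u) with hk
  have hdef : lpPiece lam θ f l y = ∫ u, f (y - u) * k u := rfl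
  -- A non-integrable integrand has integral 0 by convention, which satisfies the bound.
  by_cases hint : Integrable (fun u => f (y - u) * k u)
  swap
  · rw [hdef, integral_undef hint, norm_zero]; positivity
  have hPint := integrable_polyEval_mul_lpKernel (θ := θ) hlam P y l
  have h1 : lpPiece lam θ f l y = ∫ u, (f (y - u) - polyEval P (y - u)) * k u := by
    simp only [sub_mul]
    rw [integral_sub hint hPint, integral_polyEval_mul_lpKernel hlam hθ, sub_zero, hdef]
  have hae : ∀ᵐ u : E n, ‖f (y - u) - polyEval P (y - u)‖ ≤ D * (ρ + ‖y - u - x‖) ^ t :=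
    (Measure.measurePreserving_sub_left volume y).quasiMeasurePreserving.ae hP
  set G : E n → ℝ := fun u => (1 + ‖u‖) ^ t * ‖lpPsi lam θ u‖ with hG
  have hGint : Integrable G := integrable_one_add_norm_rpow_mul_lpPsi hlam ht
  have hlp : (0 : ℝ) < (lam : ℝ) ^ l := by positivity
  have hbound : ∀ᵐ u : E n, ‖(f (y - u) - polyEval P (y - u)) * k u‖ ≤
      D * 2 ^ t * ρ ^ t * (((lam : ℝ) ^ l) ^ n * G (((lam : ℝ) ^ l) • u)) := by
    filter_upwards [hae] with u hu
    have h2 : ρ + ‖y - u - x‖ ≤ 2 * ρ * (1 + ‖((lam : ℝ) ^ l) • u‖) := by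
      have h3 : ‖y - u - x‖ ≤ ‖y - x‖ + ‖u‖ := by
        rw [sub_right_comm]; exact norm_sub_le _ _
      have h4 : ‖u‖ ≤ ρ * ‖((lam : ℝ) ^ l) • u‖ := by
        rw [norm_smul, Real.norm_of_nonneg hlp.le, ← mul_assoc]
        refine le_mul_of_one_le_left (norm_nonneg _) ?_
        have h6 := pow_mul_scale hlam l
        have : scale lam l ≤ ρ := by rw [hρ]; linarith [norm_nonneg (y - x)]
        nlinarith
      have h5 : ‖y - x‖ ≤ ρ := by rw [hρ]; linarith
      have h7 : 0 ≤ ‖u‖ := norm_nonneg u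
      nlinarith
    have h3 : (ρ + ‖y - u - x‖) ^ t ≤ 2 ^ t * ρ ^ t * (1 + ‖((lam : ℝ) ^ l) • u‖) ^ t := by
      rw [← Real.mul_rpow (by norm_num) hρ0.le, ← Real.mul_rpow (by positivity) (by positivity)]
      exact Real.rpow_le_rpow (by positivity) h2 ht
    have h4 : ‖k u‖ = ((lam : ℝ) ^ l) ^ n * ‖lpPsi lam θ (((lam : ℝ) ^ l) • u)‖ := by
      rw [hk]; simp [pow_mul]
    rw [norm_mul, h4]
    calc _ ≤ (D * (2 ^ t * ρ ^ t * (1 + ‖((lam : ℝ) ^ l) • u‖) ^ t)) *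
          (((lam : ℝ) ^ l) ^ n * ‖lpPsi lam θ (((lam : ℝ) ^ l) • u)‖) := by
          refine mul_le_mul_of_nonneg_right (hu.trans ?_) (by positivity)
          exact mul_le_mul_of_nonneg_left h3 hD
      _ = _ := by rw [hG]; ring
  rw [h1]
  refine (norm_integral_le_of_norm_le
    (((hGint.comp_smul hlp.ne').const_mul _).const_mul _) hbound).trans ?_
  rw [integral_const_mul, integral_const_mul,
    Measure.integral_comp_smul_of_nonneg _ G _ (hR := hlp.le), finrank_euclideanSpace_fin,
    smul_eq_mul, mul_inv_cancel_left₀ (by positivity)]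
  apply le_of_eq
  ring

end LittlewoodPaley

/-! ### Words, tiles and weights. -/

section Words

variable {n m : ℕ} {lam : ℕ} {γ : Fin m → Fin n → ℤ} {T : Set (E n)} {μ : Fin m → ℂ}

@[simp] lemma latticePt_apply (ν : Fin n → ℤ) (i : Fin n) : latticePt ν i = (ν i : ℝ) := rfl

@[simp] lemma latticePt_zero : latticePt (0 : Fin n → ℤ) = 0 := by
  ext i; simp

lemma latticePt_add (ν κ : Fin n → ℤ) : latticePt (ν + κ) = latticePt ν + latticePt κ := by
  ext i; simp

lemma latticePt_zsmul (a : ℤ) (ν : Fin n → ℤ) : latticePt (a • ν) = (a : ℝ) • latticePt ν := by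
  ext i; simp

@[simp] lemma nuQ_zero (w : Fin 0 → Fin m) : nuQ lam γ w = 0 := by simp [nuQ]

/-- Appending a digit passes to a child of Q, which is used for refining tiles; prepending one, as
in `nuQ_cons`, precomposes M_Q with a first-level map, which is used for the functional equation. -/
lemma nuQ_snoc {l : ℕ} (w : Fin l → Fin m) (i : Fin m) :
    nuQ lam γ (Fin.snoc w i : Fin (l + 1) → Fin m) = (lam : ℤ) • nuQ lam γ w + γ i := by
  simp only [nuQ, Fin.sum_univ_castSucc, Fin.snoc_castSucc, Fin.snoc_last, Finset.smul_sum]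
  congr 1
  · refine Finset.sum_congr rfl fun j _ => ?_
    rw [smul_smul, ← pow_succ', Fin.val_castSucc]
    congr 2
    omega
  · simp

lemma nuQ_cons {l : ℕ} (i : Fin m) (w : Fin l → Fin m) :
    nuQ lam γ (Fin.cons i w : Fin (l + 1) → Fin m) = (lam : ℤ) ^ l • γ i + nuQ lam γ w := by
  simp only [nuQ, Fin.sum_univ_succ, Fin.cons_zero, Fin.cons_succ]
  congr 1
  refine Finset.sum_congr rfl fun j _ => ?_
  congr 2
  rw [Fin.val_succ]
  omega

@[simp] lemma mapQ_zero (w : Fin 0 → Fin m) (y : E n) : mapQ lam γ w y = y := by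
  simp [mapQ]

lemma mapQ_snoc {l : ℕ} (w : Fin l → Fin m) (i : Fin m) (y : E n) :
    mapQ lam γ (Fin.snoc w i : Fin (l + 1) → Fin m) y =
      (lam : ℝ) • mapQ lam γ w y - latticePt (γ i) := by
  simp only [mapQ, nuQ_snoc, latticePt_add, latticePt_zsmul, smul_sub, smul_smul, ← pow_succ']
  push_cast
  abel

lemma mapQ_cons {l : ℕ} (i : Fin m) (w : Fin l → Fin m) (y : E n) :
    mapQ lam γ (Fin.cons i w : Fin (l + 1) → Fin m) y =
      mapQ lam γ w ((lam : ℝ) • y - latticePt (γ i)) := by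
  simp only [mapQ, nuQ_cons, latticePt_add, latticePt_zsmul, smul_sub, smul_smul, ← pow_succ]
  push_cast
  abel

@[simp] lemma muQ_zero (w : Fin 0 → Fin m) : muQ μ w = 1 := by simp [muQ]

lemma muQ_snoc {l : ℕ} (w : Fin l → Fin m) (i : Fin m) :
    muQ μ (Fin.snoc w i : Fin (l + 1) → Fin m) = muQ μ w * μ i := by
  simp [muQ, Fin.prod_univ_castSucc]

lemma muQ_cons {l : ℕ} (i : Fin m) (w : Fin l → Fin m) :
    muQ μ (Fin.cons i w : Fin (l + 1) → Fin m) = μ i * muQ μ w := by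
  simp [muQ, Fin.prod_univ_succ]

lemma exists_eq_snoc {l : ℕ} (w : Fin (l + 1) → Fin m) :
    ∃ (v : Fin l → Fin m) (i : Fin m), w = (Fin.snoc v i : Fin (l + 1) → Fin m) :=
  ⟨Fin.init w, w (Fin.last l), (Fin.snoc_init_self w).symm⟩

lemma muQ_ne_zero (hμ : ∀ i, μ i ≠ 0) {l : ℕ} (w : Fin l → Fin m) : muQ μ w ≠ 0 :=
  Finset.prod_ne_zero_iff.2 fun j _ => hμ (w j)

lemma norm_muQ_le {q : ℝ} (hq : ∀ i, ‖μ i‖ ≤ q) {l : ℕ} (w : Fin l → Fin m) :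
    ‖muQ μ w‖ ≤ q ^ l := by
  rw [muQ, norm_prod]
  calc ∏ j, ‖μ (w j)‖ ≤ ∏ _j : Fin l, q :=
        Finset.prod_le_prod (fun _ _ => norm_nonneg _) fun j _ => hq (w j)
    _ = q ^ l := by simp

lemma norm_muQ_le_one (hμ : ∀ i, ‖μ i‖ ≤ 1) {l : ℕ} (w : Fin l → Fin m) : ‖muQ μ w‖ ≤ 1 := by
  simpa using norm_muQ_le hμ w

lemma exists_norm_le_lt_one (hμ : ∀ i, ‖μ i‖ < 1) : ∃ q, 0 ≤ q ∧ q < 1 ∧ ∀ i, ‖μ i‖ ≤ q := by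
  rcases isEmpty_or_nonempty (Fin m) with h | h
  · exact ⟨0, le_rfl, one_pos, fun i => h.elim i⟩
  · obtain ⟨i, hi⟩ := Finite.exists_max fun i => ‖μ i‖
    exact ⟨‖μ i‖, norm_nonneg _, hμ i, hi⟩

lemma exists_pos_le_norm (hμ : ∀ i, 0 < ‖μ i‖) : ∃ p, 0 < p ∧ ∀ i, p ≤ ‖μ i‖ := by
  rcases isEmpty_or_nonempty (Fin m) with h | h
  · exact ⟨1, one_pos, fun i => h.elim i⟩
  · obtain ⟨i, hi⟩ := Finite.exists_min fun i => ‖μ i‖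
    exact ⟨‖μ i‖, hμ i, hi⟩

lemma sum_words_snoc {l : ℕ} (F : (Fin (l + 1) → Fin m) → ℂ) :
    ∑ w, F w = ∑ w : Fin l → Fin m, ∑ i, F (Fin.snoc w i : Fin (l + 1) → Fin m) := by
  rw [← (Fin.snocEquiv (fun _ : Fin (l + 1) => Fin m)).sum_comp, Fintype.sum_prod_type_right]
  rfl

lemma sum_words_cons {l : ℕ} (F : (Fin (l + 1) → Fin m) → ℂ) :
    ∑ w, F w = ∑ i, ∑ w : Fin l → Fin m, F (Fin.cons i w : Fin (l + 1) → Fin m) := by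
  rw [← (Fin.consEquiv (fun _ : Fin (l + 1) => Fin m)).sum_comp, Fintype.sum_prod_type]
  rfl

/-- The map `M_Q` as a homeomorphism. -/
def mapQHomeo (hlam : 2 ≤ lam) {l : ℕ} (γ : Fin m → Fin n → ℤ) (w : Fin l → Fin m) :
    E n ≃ₜ E n :=
  (Homeomorph.smulOfNeZero ((lam : ℝ) ^ l)
    (pow_ne_zero l (by exact_mod_cast (by omega : lam ≠ 0)))).trans
    (Homeomorph.subRight (latticePt (nuQ lam γ w)))

@[simp] lemma mapQHomeo_apply (hlam : 2 ≤ lam) {l : ℕ} (w : Fin l → Fin m) (y : E n) :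
    mapQHomeo hlam γ w y = mapQ lam γ w y := rfl

lemma interior_tile (hlam : 2 ≤ lam) {l : ℕ} (w : Fin l → Fin m) :
    interior (tile lam γ T w) = mapQ lam γ w ⁻¹' interior T :=
  ((mapQHomeo hlam γ w).preimage_interior T).symm

lemma isClosed_tile (hlam : 2 ≤ lam) (hT : IsClosed T) {l : ℕ} (w : Fin l → Fin m) :
    IsClosed (tile lam γ T w) :=
  hT.preimage (mapQHomeo hlam γ w).continuous

lemma mapQ_eq {l : ℕ} (w : Fin l → Fin m) (y : E n) :
    mapQ lam γ w y = ((lam : ℝ) ^ l) • y + -latticePt (nuQ lam γ w) := by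
  rw [mapQ, sub_eq_add_neg]

lemma dist_mapQ {l : ℕ} (w : Fin l → Fin m) (y z : E n) :
    dist (mapQ lam γ w y) (mapQ lam γ w z) = (lam : ℝ) ^ l * dist y z := by
  rw [mapQ_eq, mapQ_eq, dist_add_right, dist_smul₀, Real.norm_of_nonneg (by positivity)]

end Words

/-! ### Nesting, disjointness and counting of tiles. -/

section Tiling

variable {n m : ℕ} {lam : ℕ} {γ : Fin m → Fin n → ℤ} {T : Set (E n)}

lemma IsSelfAffineTile.mem_iff (hT : IsSelfAffineTile lam γ T) (hlam : 2 ≤ lam) {y : E n} :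
    y ∈ T ↔ ∃ i, (lam : ℝ) • y - latticePt (γ i) ∈ T := by
  have h0 : (lam : ℝ) ≠ 0 := by exact_mod_cast (by omega : lam ≠ 0)
  have h := Set.ext_iff.1 hT.dilate ((lam : ℝ) • y)
  simp only [Set.mem_iUnion, Set.mem_image] at h
  rw [show (∃ i, (lam : ℝ) • y - latticePt (γ i) ∈ T) ↔ _ from h]
  constructor
  · exact fun hy => ⟨y, hy, rfl⟩
  · rintro ⟨z, hz, hzy⟩
    rwa [← smul_right_injective _ h0 hzy]

lemma IsSelfAffineTile.tile_eq_iUnion (hT : IsSelfAffineTile lam γ T) (hlam : 2 ≤ lam) {l : ℕ}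
    (w : Fin l → Fin m) :
    tile lam γ T w = ⋃ i, tile lam γ T (Fin.snoc w i : Fin (l + 1) → Fin m) := by
  ext y
  simp only [tile, Set.mem_preimage, Set.mem_iUnion, mapQ_snoc]
  exact hT.mem_iff hlam

lemma IsSelfAffineTile.tile_snoc_subset (hT : IsSelfAffineTile lam γ T) (hlam : 2 ≤ lam) {l : ℕ}
    (w : Fin l → Fin m) (i : Fin m) :
    tile lam γ T (Fin.snoc w i : Fin (l + 1) → Fin m) ⊆ tile lam γ T w := by
  rw [hT.tile_eq_iUnion hlam w]
  exact Set.subset_iUnion (fun i => tile lam γ T (Fin.snoc w i : Fin (l + 1) → Fin m)) i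

lemma IsSelfAffineTile.subdomain_subset (hT : IsSelfAffineTile lam γ T) (hlam : 2 ≤ lam)
    (i : Fin m) : subdomain lam γ T i ⊆ interior T := by
  apply interior_maximal
  · intro y hy
    exact (hT.mem_iff hlam).2 ⟨i, interior_subset hy⟩
  · refine isOpen_interior.preimage (f := fun y : E n => (lam : ℝ) • y - latticePt (γ i)) ?_
    fun_prop

/-- The last digit is determined by the residue class of ν_Q modulo λ; it is stripped off and the
rest divided by λ. -/
lemma IsSelfAffineTile.nuQ_injective (hT : IsSelfAffineTile lam γ T) (hlam : 2 ≤ lam) (l : ℕ) :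
    Function.Injective (nuQ lam γ : (Fin l → Fin m) → _) := by
  have h0 : (lam : ℤ) ≠ 0 := by exact_mod_cast (by omega : lam ≠ 0)
  induction l with
  | zero => exact fun w v _ => Subsingleton.elim w v
  | succ l ih =>
    intro w v h
    obtain ⟨w, i, rfl⟩ := exists_eq_snoc w
    obtain ⟨v, j, rfl⟩ := exists_eq_snoc v
    rw [nuQ_snoc, nuQ_snoc] at h
    obtain ⟨k, -, huniq⟩ := hT.digits ((lam : ℤ) • nuQ lam γ w + γ i)
    have hi := huniq i ⟨nuQ lam γ w, add_comm _ _⟩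
    have hj := huniq j ⟨nuQ lam γ v, by rw [h, add_comm]⟩
    obtain rfl : i = j := hi.trans hj.symm
    have h1 := smul_right_injective _ h0 (add_right_cancel h)
    rw [ih h1]

/-- Two overlapping interiors would share a nonempty open set, of positive measure, against almost
disjointness. -/
lemma IsSelfAffineTile.eq_of_sub_mem_interior (hT : IsSelfAffineTile lam γ T)
    {ν κ : Fin n → ℤ} {y : E n} (hν : y - latticePt ν ∈ interior T)
    (hκ : y - latticePt κ ∈ interior T) : ν = κ := by
  by_contra hne
  have hopen : ∀ ν : Fin n → ℤ, IsOpen {z : E n | z - latticePt ν ∈ interior T} := fun ν =>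
    isOpen_interior.preimage (f := fun z : E n => z - latticePt ν) (by fun_prop)
  have hpos := ((hopen ν).inter (hopen κ)).measure_pos volume ⟨y, hν, hκ⟩
  refine hpos.ne' (measure_mono_null ?_ (hT.ae_disjoint ν κ hne))
  exact fun z hz => ⟨interior_subset (s := T) hz.1, interior_subset (s := T) hz.2⟩

lemma IsSelfAffineTile.word_unique (hT : IsSelfAffineTile lam γ T) (hlam : 2 ≤ lam) {l : ℕ}
    {w v : Fin l → Fin m} {y : E n} (hw : mapQ lam γ w y ∈ interior T)
    (hv : mapQ lam γ v y ∈ interior T) : w = v :=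
  hT.nuQ_injective hlam l (hT.eq_of_sub_mem_interior hw hv)

/-- At each level, the number of tiles that meet a ball comparable with the tiles is bounded. -/
lemma IsSelfAffineTile.exists_card_near_le (hT : IsSelfAffineTile lam γ T) (hlam : 2 ≤ lam)
    (ρ : ℝ) : ∃ N : ℕ, ∀ (l : ℕ) (x : E n) (S : Finset (Fin l → Fin m)),
      (∀ w ∈ S, ∃ y ∈ tile lam γ T w, dist y x ≤ ρ * scale lam l) → S.card ≤ N := by
  obtain ⟨R, hR⟩ := hT.isCompact.isBounded.subset_closedBall 0
  -- The vector ν_Q is within R + ρ of λ^l x. Subtracting the integer part of λ^l x instead costs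
  -- less than 1 per coordinate, hence the `+ 1`; the integer points of the resulting cube are
  -- counted.
  set M : ℤ := ⌈R + ρ⌉ + 1 with hM
  refine ⟨(Fintype.piFinset fun _ : Fin n => Finset.Icc (-M) M).card, fun l x S hS => ?_⟩
  refine Finset.card_le_card_of_injOn
    (fun w k => nuQ lam γ w k - ⌊(((lam : ℝ) ^ l) • x) k⌋) (fun w hw => ?_) ?_
  · obtain ⟨y, hy, hyx⟩ := hS w hw
    rw [Finset.mem_coe, Fintype.mem_piFinset]
    intro k
    have h1 : ‖mapQ lam γ w y‖ ≤ R := mem_closedBall_zero_iff.1 (hR hy)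
    have h2 : ‖((lam : ℝ) ^ l) • (y - x)‖ ≤ ρ := by
      rw [norm_smul, ← dist_eq_norm, Real.norm_of_nonneg (by positivity)]
      calc (lam : ℝ) ^ l * dist y x ≤ lam ^ l * (ρ * scale lam l) := by gcongr
        _ = ρ := by rw [mul_left_comm, pow_mul_scale hlam, mul_one]
    have h3 : ‖latticePt (nuQ lam γ w) - ((lam : ℝ) ^ l) • x‖ ≤ R + ρ := by
      have : latticePt (nuQ lam γ w) - ((lam : ℝ) ^ l) • x =
          ((lam : ℝ) ^ l) • (y - x) - mapQ lam γ w y := by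
        rw [mapQ, smul_sub]; abel
      rw [this, add_comm]
      exact (norm_sub_le _ _).trans (add_le_add h2 h1)
    have h4 := (PiLp.norm_apply_le (latticePt (nuQ lam γ w) - ((lam : ℝ) ^ l) • x) k).trans h3
    rw [PiLp.sub_apply, latticePt_apply, Real.norm_eq_abs, abs_le] at h4
    have h5 := Int.floor_le ((((lam : ℝ) ^ l) • x) k)
    have h6 := Int.lt_floor_add_one ((((lam : ℝ) ^ l) • x) k)
    have h7 := Int.le_ceil (R + ρ)
    have h8 : (M : ℝ) = ⌈R + ρ⌉ + 1 := by rw [hM]; push_cast; ring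
    rw [Finset.mem_Icc]
    constructor
    · have : (-(M : ℝ)) ≤ (nuQ lam γ w k : ℝ) - (⌊(((lam : ℝ) ^ l) • x) k⌋ : ℝ) := by linarith
      exact_mod_cast this
    · have : (nuQ lam γ w k : ℝ) - (⌊(((lam : ℝ) ^ l) • x) k⌋ : ℝ) ≤ (M : ℝ) := by linarith
      exact_mod_cast this
  · intro w _ v _ h
    apply hT.nuQ_injective hlam l
    ext k
    exact sub_left_injective (congrFun h k)

end Tiling

/-! ### The series, its functional equation and its finite expansions. -/

section Series

variable {n m : ℕ} {lam : ℕ} {γ : Fin m → Fin n → ℤ} {T : Set (E n)} {μ : Fin m → ℂ}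
  {φ : E n → ℂ}

lemma norm_sum_le_of_subsingleton_support {ι : Type*} (s : Finset ι) {F : ι → ℂ} {C : ℝ}
    (hC : 0 ≤ C) (h1 : ∀ i ∈ s, ‖F i‖ ≤ C)
    (h2 : ∀ i ∈ s, ∀ j ∈ s, F i ≠ 0 → F j ≠ 0 → i = j) : ‖∑ i ∈ s, F i‖ ≤ C := by
  by_cases h : ∃ i ∈ s, F i ≠ 0
  · obtain ⟨i, hi, hFi⟩ := h
    rw [Finset.sum_eq_single i (fun j hj hne => ?_) (fun hn => absurd hi hn)]
    · exact h1 i hi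
    · by_contra hFj
      exact hne (h2 j hj i hi hFj hFi)
  · push Not at h
    rw [Finset.sum_eq_zero h, norm_zero]
    exact hC

/-- Interiors of tiles of one level are disjoint, so at most one term is nonzero at y and the number
of words plays no role. -/
lemma IsSelfAffineTile.norm_sum_muQ_mul_le (hT : IsSelfAffineTile lam γ T) (hlam : 2 ≤ lam)
    (hφT : ∀ y, y ∉ interior T → φ y = 0) {B : ℝ} (hB : ∀ y, ‖φ y‖ ≤ B) {l : ℕ} {y : E n}
    {A : ℝ} (hA : 0 ≤ A) (hμA : ∀ w : Fin l → Fin m, mapQ lam γ w y ∈ interior T → ‖muQ μ w‖ ≤ A) :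
    ‖∑ w : Fin l → Fin m, muQ μ w * φ (mapQ lam γ w y)‖ ≤ A * B := by
  have hB0 : 0 ≤ B := (norm_nonneg _).trans (hB 0)
  have hmem : ∀ w : Fin l → Fin m, muQ μ w * φ (mapQ lam γ w y) ≠ 0 →
      mapQ lam γ w y ∈ interior T := by
    intro w hw
    by_contra hn
    exact hw (by rw [hφT _ hn, mul_zero])
  refine norm_sum_le_of_subsingleton_support _ (by positivity) (fun w _ => ?_)
    (fun w _ v _ hw hv => hT.word_unique hlam (hmem w hw) (hmem v hv))
  by_cases hw : mapQ lam γ w y ∈ interior T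
  · rw [norm_mul]
    exact mul_le_mul (hμA w hw) (hB _) (norm_nonneg _) hA
  · rw [hφT _ hw, mul_zero, norm_zero]
    positivity

/-- The preceding bound is applied to |φ| and the |μ_i|; it yields absolute convergence with a
geometric rate. -/
lemma IsSelfAffineTile.sum_norm_muQ_mul_le (hT : IsSelfAffineTile lam γ T) (hlam : 2 ≤ lam)
    (hφT : ∀ y, y ∉ interior T → φ y = 0) {B : ℝ} (hB : ∀ y, ‖φ y‖ ≤ B) {q : ℝ} (hq0 : 0 ≤ q)
    (hq : ∀ i, ‖μ i‖ ≤ q) (l : ℕ) (y : E n) :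
    ∑ w : Fin l → Fin m, ‖muQ μ w * φ (mapQ lam γ w y)‖ ≤ q ^ l * B := by
  have h := hT.norm_sum_muQ_mul_le (φ := fun y => (‖φ y‖ : ℂ)) (μ := fun i => (‖μ i‖ : ℂ)) hlam
    (fun y hy => by simp [hφT y hy]) (B := B) (fun y => by simpa using hB y) (l := l) (y := y)
    (A := q ^ l) (by positivity) (fun w _ => norm_muQ_le (by simpa using hq) w)
  have h2 : ∑ w : Fin l → Fin m, muQ (fun i => (‖μ i‖ : ℂ)) w * (‖φ (mapQ lam γ w y)‖ : ℂ) =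
      ((∑ w : Fin l → Fin m, ‖muQ μ w * φ (mapQ lam γ w y)‖ : ℝ) : ℂ) := by
    push_cast
    refine Finset.sum_congr rfl fun w _ => ?_
    simp [muQ, norm_prod]
  rw [h2, Complex.norm_real, Real.norm_of_nonneg (by positivity)] at h
  exact h

lemma IsSelfAffineTile.summable_series (hT : IsSelfAffineTile lam γ T) (hlam : 2 ≤ lam)
    (hμ : ∀ i, ‖μ i‖ < 1) (hφT : ∀ y, y ∉ interior T → φ y = 0) {B : ℝ} (hB : ∀ y, ‖φ y‖ ≤ B)
    (y : E n) :
    Summable fun Q : (Σ l : ℕ, (Fin l → Fin m)) => muQ μ Q.2 * φ (mapQ lam γ Q.2 y) := by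
  obtain ⟨q, hq0, hq1, hq⟩ := exists_norm_le_lt_one hμ
  apply Summable.of_norm
  rw [summable_sigma_of_nonneg fun _ => norm_nonneg _]
  refine ⟨fun l => Summable.of_finite, ?_⟩
  refine Summable.of_nonneg_of_le (fun l => tsum_nonneg fun _ => norm_nonneg _) (fun l => ?_)
    ((summable_geometric_of_lt_one hq0 hq1).mul_right B)
  rw [tsum_fintype]
  exact hT.sum_norm_muQ_mul_le hlam hφT hB hq0 hq l y

/-- The functional equation of the self-affine function `f`. -/
lemma IsSelfAffineTile.series_eq (hT : IsSelfAffineTile lam γ T) (hlam : 2 ≤ lam)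
    (hμ : ∀ i, ‖μ i‖ < 1) (hφT : ∀ y, y ∉ interior T → φ y = 0) {B : ℝ} (hB : ∀ y, ‖φ y‖ ≤ B)
    (y : E n) :
    series lam γ μ φ y =
      φ y + ∑ i, μ i * series lam γ μ φ ((lam : ℝ) • y - latticePt (γ i)) := by
  set A : ℕ → E n → ℂ := fun l y => ∑ w : Fin l → Fin m, muQ μ w * φ (mapQ lam γ w y) with hA
  have hs := hT.summable_series hlam hμ hφT hB
  have h1 : ∀ y, HasSum (fun l => A l y) (series lam γ μ φ y) := fun y =>
    (hs y).hasSum.sigma fun l => hasSum_fintype _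
  have h2 : ∀ l, A (l + 1) y = ∑ i, μ i * A l ((lam : ℝ) • y - latticePt (γ i)) := by
    intro l
    simp only [hA, sum_words_cons, mapQ_cons, muQ_cons, Finset.mul_sum, mul_assoc]
  have h3 : HasSum (fun l => A (l + 1) y)
      (∑ i, μ i * series lam γ μ φ ((lam : ℝ) • y - latticePt (γ i))) := by
    simp only [h2]
    exact hasSum_sum fun i _ => (h1 _).mul_left (μ i)
  -- Removing level 0, whose only term is φ y, leaves the shifted sum computed in `h3`.
  have h4 := (hasSum_nat_add_iff' 1).2 (h1 y)
  have h5 := h3.unique h4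
  rw [h5]
  simp [hA]

lemma IsSelfAffineTile.series_eq_zero (hT : IsSelfAffineTile lam γ T) (hlam : 2 ≤ lam)
    (hφT : ∀ y, y ∉ interior T → φ y = 0) {y : E n} (hy : y ∉ interior T) :
    series lam γ μ φ y = 0 := by
  have hsub : ∀ (l : ℕ) (w : Fin l → Fin m), mapQ lam γ w y ∈ interior T → y ∈ interior T := by
    intro l
    induction l with
    | zero => intro w hw; simpa using hw
    | succ l ih =>
      intro w hw
      obtain ⟨v, i, rfl⟩ := exists_eq_snoc w
      rw [mapQ_snoc] at hw
      exact ih v (hT.subdomain_subset hlam i hw)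
  rw [series, ← tsum_zero (α := ℂ) (β := Σ l : ℕ, (Fin l → Fin m))]
  congr 1
  ext ⟨l, w⟩
  rw [hφT _ fun h => hy (hsub l w h), mul_zero]

lemma IsSelfAffineTile.exists_norm_series_le (hT : IsSelfAffineTile lam γ T) (hlam : 2 ≤ lam)
    (hμ : ∀ i, ‖μ i‖ < 1) (hφT : ∀ y, y ∉ interior T → φ y = 0) {B : ℝ} (hB : ∀ y, ‖φ y‖ ≤ B) :
    ∃ B', ∀ y, ‖series lam γ μ φ y‖ ≤ B' := by
  obtain ⟨q, hq0, hq1, hq⟩ := exists_norm_le_lt_one hμ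
  refine ⟨∑' l : ℕ, q ^ l * B, fun y => ?_⟩
  have hs := hT.summable_series hlam hμ hφT hB y
  rw [series, hs.tsum_sigma' fun l => Summable.of_finite]
  refine tsum_of_norm_bounded ((summable_geometric_of_lt_one hq0 hq1).mul_right B).hasSum
    fun l => ?_
  rw [tsum_fintype]
  exact (norm_sum_le _ _).trans (hT.sum_norm_muQ_mul_le hlam hφT hB hq0 hq l y)

/-- This is the functional equation iterated L times. The tail is expressed through f itself, so
boundedness of f controls it. -/
lemma IsSelfAffineTile.series_eq_sum_add (hT : IsSelfAffineTile lam γ T) (hlam : 2 ≤ lam)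
    (hμ : ∀ i, ‖μ i‖ < 1) (hφT : ∀ y, y ∉ interior T → φ y = 0) {B : ℝ} (hB : ∀ y, ‖φ y‖ ≤ B)
    (L : ℕ) (y : E n) :
    series lam γ μ φ y =
      ∑ l ∈ Finset.range L, ∑ w : Fin l → Fin m, muQ μ w * φ (mapQ lam γ w y) +
        ∑ w : Fin L → Fin m, muQ μ w * series lam γ μ φ (mapQ lam γ w y) := by
  induction L with
  | zero => simp
  | succ L ih =>
    rw [ih, Finset.sum_range_succ, add_assoc]
    congr 1
    rw [sum_words_snoc, ← Finset.sum_add_distrib]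
    refine Finset.sum_congr rfl fun w _ => ?_
    rw [hT.series_eq hlam hμ hφT hB (mapQ lam γ w y), mul_add, Finset.mul_sum]
    congr 1
    refine Finset.sum_congr rfl fun i _ => ?_
    rw [muQ_snoc, mapQ_snoc, mul_assoc]

/-- On a tile of the first level only one term of the functional equation is left. -/
lemma IsSelfAffineTile.series_eq_of_mem (hT : IsSelfAffineTile lam γ T) (hlam : 2 ≤ lam)
    (hμ : ∀ i, ‖μ i‖ < 1) (hφT : ∀ y, y ∉ interior T → φ y = 0) {B : ℝ} (hB : ∀ y, ‖φ y‖ ≤ B)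
    {y : E n} {i : Fin m} (hy : y ∈ subdomain lam γ T i) :
    series lam γ μ φ y = φ y + μ i * series lam γ μ φ ((lam : ℝ) • y - latticePt (γ i)) := by
  rw [hT.series_eq hlam hμ hφT hB y]
  congr 1
  refine Finset.sum_eq_single i (fun j _ hj => ?_) (by simp)
  rw [hT.series_eq_zero hlam hφT, mul_zero]
  intro hj'
  have h1 := hT.eq_of_sub_mem_interior hj' hy
  obtain ⟨k, -, huniq⟩ := hT.digits (γ i)
  exact hj ((huniq j ⟨0, by simp [h1]⟩).trans (huniq i ⟨0, by simp⟩).symm)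

end Series

/-! ### Exponents as decay rates of the weights. -/

section Exponents

variable {lam : ℕ}

lemma le_log_div_log_iff {a X t : ℝ} (ha : 0 < a) (hX0 : 0 < X) (hX1 : X < 1) :
    t ≤ Real.log a / Real.log X ↔ a ≤ X ^ t := by
  rw [le_div_iff_of_neg (Real.log_neg hX0 hX1), ← Real.log_rpow hX0,
    Real.log_le_log_iff ha (Real.rpow_pos_of_pos hX0 t)]

lemma eventually_const_mul_scale_lt (hlam : 2 ≤ lam) (C : ℝ) {ε : ℝ} (hε : 0 < ε) :
    ∀ᶠ l in atTop, C * scale lam l < ε := by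
  have h := (tendsto_scale hlam).const_mul C
  rw [mul_zero] at h
  exact h.eventually (gt_mem_nhds hε)

/-- From the level at which C λ^(-l) < 1, the logarithm of X is negative and the quotient inequality
reads a ≤ X^s. -/
lemma eventually_le_of_lt_log_div_log (hlam : 2 ≤ lam) {s : ℝ} (hs : 0 < s) (C : ℝ) :
    ∀ᶠ l in atTop, ∀ a X : ℝ, 0 < a → 0 < X → X ≤ C * scale lam l →
      s < Real.log a / Real.log X → a ≤ C ^ s * scale lam l ^ s := by
  filter_upwards [eventually_const_mul_scale_lt hlam C one_pos] with l hl a X ha hX hXC h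
  have hsc := scale_pos hlam l
  have hC : 0 ≤ C := by
    by_contra hC
    push Not at hC
    nlinarith
  rw [← Real.mul_rpow hC hsc.le]
  exact ((le_log_div_log_iff ha hX (hXC.trans_lt hl)).1 h.le).trans
    (Real.rpow_le_rpow hX.le hXC hs.le)

/-- The loss from s to t < s gives a factor λ^(-l(s-t)) tending to 0, which absorbs the constants.
For t ≤ 0 it is enough that a ≤ 1 ≤ X^t. -/
lemma eventually_le_log_div_log (hlam : 2 ≤ lam) {s t : ℝ} (hts : t < s) {c : ℝ} (hc : 0 < c)
    (C C' : ℝ) :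
    ∀ᶠ l in atTop, ∀ a X : ℝ, 0 < a → a ≤ 1 → c * scale lam l ≤ X → X ≤ C * scale lam l →
      a ≤ C' * scale lam l ^ s → t ≤ Real.log a / Real.log X := by
  have h1 : Tendsto (fun l => C' * scale lam l ^ (s - t)) atTop (nhds 0) := by
    have h2 := ((tendsto_scale hlam).rpow_const (p := s - t)
      (Or.inr (by linarith))).const_mul C'
    rwa [Real.zero_rpow (by linarith), mul_zero] at h2
  have hct : 0 < c ^ t := Real.rpow_pos_of_pos hc t
  filter_upwards [eventually_const_mul_scale_lt hlam C one_pos,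
    h1.eventually (gt_mem_nhds hct)] with l hl hl2 a X ha ha1 hcX hXC haC
  have hsc := scale_pos hlam l
  have hX : 0 < X := lt_of_lt_of_le (by positivity) hcX
  rw [le_log_div_log_iff ha hX (hXC.trans_lt hl)]
  rcases le_or_gt t 0 with ht | ht
  · exact ha1.trans (Real.one_le_rpow_of_pos_of_le_one_of_nonpos hX (hXC.trans hl.le) ht)
  · have h3 : scale lam l ^ s = scale lam l ^ (s - t) * scale lam l ^ t := by
      rw [← Real.rpow_add hsc]; congr 1; ring
    have h4 : 0 < scale lam l ^ t := Real.rpow_pos_of_pos hsc t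
    calc a ≤ C' * scale lam l ^ s := haC
      _ = C' * scale lam l ^ (s - t) * scale lam l ^ t := by rw [h3]; ring
      _ ≤ c ^ t * scale lam l ^ t := by gcongr
      _ = (c * scale lam l) ^ t := (Real.mul_rpow hc.le hsc.le).symm
      _ ≤ X ^ t := Real.rpow_le_rpow (by positivity) hcX ht.le

/-- A bound valid from some level on extends, with another constant, to all levels. -/
lemma exists_bound_of_eventually (hlam : 2 ≤ lam) {s : ℝ} (hs : 0 ≤ s) {C : ℝ} (hC : 0 ≤ C)
    {a : ℕ → Set ℝ} (h1 : ∀ l, ∀ r ∈ a l, r ≤ 1)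
    (h : ∀ᶠ l in atTop, ∀ r ∈ a l, r ≤ C * scale lam l ^ s) :
    ∃ C', 0 ≤ C' ∧ ∀ l, ∀ r ∈ a l, r ≤ C' * scale lam l ^ s := by
  obtain ⟨N, hN⟩ := eventually_atTop.1 h
  have hscN := Real.rpow_pos_of_pos (scale_pos hlam N) s
  refine ⟨C + (scale lam N ^ s)⁻¹, by positivity, fun l r hr => ?_⟩
  have hsc := Real.rpow_pos_of_pos (scale_pos hlam l) s
  rcases le_or_gt N l with hl | hl
  · refine (hN l hl r hr).trans ?_
    gcongr
    exact le_add_of_nonneg_right (by positivity)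
  · refine (h1 l r hr).trans ?_
    have h2 : scale lam N ^ s ≤ scale lam l ^ s :=
      Real.rpow_le_rpow (scale_pos hlam N).le (scale_anti hlam hl.le) hs
    have h3 : 1 ≤ (scale lam N ^ s)⁻¹ * scale lam l ^ s := by
      rw [inv_mul_eq_div, one_le_div hscN]; exact h2
    have h4 : 0 ≤ C * scale lam l ^ s := by positivity
    linarith

variable {n m : ℕ} {γ : Fin m → Fin n → ℤ} {T : Set (E n)} {μ : Fin m → ℂ} {x : E n}

/-- The distance from `x` to the reference point of a tile near `x`. -/
lemma norm_sub_scale_smul_le (hlam : 2 ≤ lam) {R : ℝ} (hR : T ⊆ Metric.closedBall 0 R) {l : ℕ}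
    {w : Fin l → Fin m} (hw : (Metric.ball x (((lam : ℝ) ^ l)⁻¹) ∩ tile lam γ T w).Nonempty) :
    ((lam : ℝ) ^ l)⁻¹ + ‖x - (((lam : ℝ) ^ l)⁻¹) • latticePt (nuQ lam γ w)‖ ≤
      (2 + R) * scale lam l := by
  obtain ⟨y, hyx, hy⟩ := hw
  have hsc := scale_pos hlam l
  change scale lam l + ‖x - scale lam l • latticePt (nuQ lam γ w)‖ ≤ _
  have h1 : ‖mapQ lam γ w y‖ ≤ R := mem_closedBall_zero_iff.1 (hR hy)
  have h2 : x - scale lam l • latticePt (nuQ lam γ w) =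
      (x - y) + scale lam l • mapQ lam γ w y := by
    rw [mapQ, smul_sub, smul_smul, mul_comm (scale lam l), pow_mul_scale hlam, one_smul]
    abel
  have h3 : ‖x - y‖ < scale lam l := by rw [← dist_eq_norm, dist_comm]; exact hyx
  rw [h2]
  have h4 := norm_add_le (x - y) (scale lam l • mapQ lam γ w y)
  rw [norm_smul, Real.norm_of_nonneg hsc.le] at h4
  nlinarith

/-- For tiles near x the base λ^(-l) + |x - λ^(-l) ν_Q| is comparable with λ^(-l), so τ₀ is the
critical rate of decay of |μ_Q| over these tiles; `le_tau0_of_norm_muQ_le` is the other half. -/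
lemma exists_norm_muQ_le_of_lt_tau0 (hlam : 2 ≤ lam) (hT : IsCompact T)
    (hμ : ∀ i, 0 < ‖μ i‖ ∧ ‖μ i‖ < 1) {s : ℝ} (hs : 0 < s)
    (h : (s : EReal) < tau0 lam γ T μ x) :
    ∃ C, 0 ≤ C ∧ ∀ (l : ℕ) (w : Fin l → Fin m),
      (Metric.ball x (scale lam l) ∩ tile lam γ T w).Nonempty →
        ‖muQ μ w‖ ≤ C * scale lam l ^ s := by
  obtain ⟨R', hR'⟩ := hT.isBounded.subset_closedBall 0
  set R := max R' 0 with hRdef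
  have hR : T ⊆ Metric.closedBall 0 R :=
    hR'.trans (Metric.closedBall_subset_closedBall (le_max_left _ _))
  have hR0 : 0 ≤ R := le_max_right _ _
  have h2 := eventually_lt_of_lt_liminf h
  obtain ⟨C, hC, hb⟩ := exists_bound_of_eventually hlam hs.le (C := (2 + R) ^ s) (by positivity)
    (a := fun l => {r | ∃ w : Fin l → Fin m,
      (Metric.ball x (scale lam l) ∩ tile lam γ T w).Nonempty ∧ r = ‖muQ μ w‖})
    (by rintro l r ⟨w, -, rfl⟩; exact norm_muQ_le_one (fun i => (hμ i).2.le) w)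
    (by
      filter_upwards [h2, eventually_le_of_lt_log_div_log hlam hs (2 + R)] with l hl1 hl2
      rintro r ⟨w, hw, rfl⟩
      refine hl2 _ _ (norm_pos_iff.2 (muQ_ne_zero (fun i => norm_pos_iff.1 (hμ i).1) w)) ?_
        (norm_sub_scale_smul_le hlam hR hw)
        (EReal.coe_lt_coe_iff.1 (hl1.trans_le (iInf₂_le w hw)))
      exact lt_of_lt_of_le (scale_pos hlam l) (le_add_of_nonneg_right (norm_nonneg _)))
  exact ⟨C, hC, fun l w hw => hb l _ ⟨w, hw, rfl⟩⟩

lemma le_tau0_of_norm_muQ_le (hlam : 2 ≤ lam) (hT : IsCompact T)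
    (hμ : ∀ i, 0 < ‖μ i‖ ∧ ‖μ i‖ < 1) {s C : ℝ}
    (h : ∀ (l : ℕ) (w : Fin l → Fin m),
      (Metric.ball x (scale lam l) ∩ tile lam γ T w).Nonempty →
        ‖muQ μ w‖ ≤ C * scale lam l ^ s) :
    (s : EReal) ≤ tau0 lam γ T μ x := by
  obtain ⟨R, hR⟩ := hT.isBounded.subset_closedBall 0
  rw [← EReal.ge_of_forall_gt_iff_ge]
  intro t ht
  refine le_liminf_of_le (by isBoundedDefault) ?_
  filter_upwards [eventually_le_log_div_log hlam (EReal.coe_lt_coe_iff.1 ht) one_pos (2 + R) C]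
    with l hl
  refine le_iInf₂ fun w hw => EReal.coe_le_coe_iff.2 ?_
  refine hl _ _ (norm_pos_iff.2 (muQ_ne_zero (fun i => norm_pos_iff.1 (hμ i).1) w))
    (norm_muQ_le_one (fun i => (hμ i).2.le) w) ?_ (norm_sub_scale_smul_le hlam hR hw) (h l w hw)
  rw [one_mul]
  exact le_add_of_nonneg_right (norm_nonneg _)

end Exponents

/-! ### Points of Ω and their distance to tile boundaries. -/

section Boundary

variable {n m : ℕ} {lam : ℕ} {γ : Fin m → Fin n → ℤ} {T : Set (E n)} {μ : Fin m → ℂ} {x : E n}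

lemma mapQ_wordAt_mem (hlam : 2 ≤ lam) (hx : x ∈ Omega lam γ T) (l : ℕ) :
    mapQ lam γ (wordAt lam γ T hx l) x ∈ interior T := by
  have := (hx l).choose_spec
  rwa [interior_tile hlam] at this

/-- The digits of the tiles around `x ∈ Ω`. -/
def digitAt (hx : x ∈ Omega lam γ T) (l : ℕ) : Fin m :=
  wordAt lam γ T hx (l + 1) (Fin.last l)

/-- The words are chosen separately at each level, but a tile with x in its interior is unique at
its level, so the choices form one digit sequence. -/
lemma IsSelfAffineTile.wordAt_succ (hT : IsSelfAffineTile lam γ T) (hlam : 2 ≤ lam)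
    (hx : x ∈ Omega lam γ T) (l : ℕ) :
    wordAt lam γ T hx (l + 1) =
      (Fin.snoc (wordAt lam γ T hx l) (digitAt hx l) : Fin (l + 1) → Fin m) := by
  have h1 := mapQ_wordAt_mem hlam hx (l + 1)
  rw [← Fin.snoc_init_self (α := fun _ => Fin m) (wordAt lam γ T hx (l + 1)), mapQ_snoc] at h1
  have h2 := hT.subdomain_subset hlam _ h1
  rw [← Fin.snoc_init_self (α := fun _ => Fin m) (wordAt lam γ T hx (l + 1)),
    hT.word_unique hlam h2 (mapQ_wordAt_mem hlam hx l)]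
  rfl

lemma IsSelfAffineTile.wordAt_apply (hT : IsSelfAffineTile lam γ T) (hlam : 2 ≤ lam)
    (hx : x ∈ Omega lam γ T) (l : ℕ) (j : Fin l) :
    wordAt lam γ T hx l j = digitAt hx j := by
  induction l with
  | zero => exact j.elim0
  | succ l ih =>
    rw [hT.wordAt_succ hlam hx l]
    refine Fin.lastCases ?_ (fun j => ?_) j
    · simp
    · rw [Fin.snoc_castSucc, ih]; rfl

/-- A nonempty compact set without frontier would be clopen, hence all of ℝⁿ, which is not compact
for n > 0. This excludes the default value 0 of `Metric.infDist` to the empty set. -/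
lemma IsSelfAffineTile.frontier_tile_nonempty (hT : IsSelfAffineTile lam γ T) (hlam : 2 ≤ lam)
    (hn : 0 < n) {l : ℕ} {w : Fin l → Fin m} (hne : (tile lam γ T w).Nonempty) :
    (frontier (tile lam γ T w)).Nonempty := by
  have : Nonempty (Fin n) := ⟨⟨0, hn⟩⟩
  have hcomp : IsCompact (tile lam γ T w) :=
    (mapQHomeo hlam γ w).isCompact_preimage.2 hT.isCompact
  rw [Set.nonempty_iff_ne_empty]
  intro h
  rcases isClopen_iff.1 (isClopen_iff_frontier_eq_empty.2 h) with h1 | h1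
  · exact hne.ne_empty h1
  · exact noncompact_univ (E n) (h1 ▸ hcomp)

lemma mem_tile_wordAt (hx : x ∈ Omega lam γ T) (l : ℕ) :
    x ∈ interior (tile lam γ T (wordAt lam γ T hx l)) := (hx l).choose_spec

lemma IsSelfAffineTile.exists_frontier_dist (hT : IsSelfAffineTile lam γ T) (hlam : 2 ≤ lam)
    (hn : 0 < n) (hx : x ∈ Omega lam γ T) (l : ℕ) :
    ∃ p ∈ frontier (tile lam γ T (wordAt lam γ T hx l)), Delta lam γ T hx l = dist x p :=
  isClosed_frontier.exists_infDist_eq_dist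
    (hT.frontier_tile_nonempty hlam hn ⟨x, interior_subset (mem_tile_wordAt hx l)⟩) x

lemma IsSelfAffineTile.Delta_pos (hT : IsSelfAffineTile lam γ T) (hlam : 2 ≤ lam)
    (hn : 0 < n) (hx : x ∈ Omega lam γ T) (l : ℕ) : 0 < Delta lam γ T hx l := by
  obtain ⟨p, hp, hd⟩ := hT.exists_frontier_dist hlam hn hx l
  rw [hd, dist_pos]
  rintro rfl
  exact hp.2 (mem_tile_wordAt hx l)

/-- The ball is connected and contains no frontier point, so it cannot leave the interior. -/
lemma ball_Delta_subset (hx : x ∈ Omega lam γ T) (l : ℕ) :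
    Metric.ball x (Delta lam γ T hx l) ⊆ interior (tile lam γ T (wordAt lam γ T hx l)) := by
  rcases le_or_gt (Delta lam γ T hx l) 0 with h0 | h0
  · rw [Metric.ball_eq_empty.2 h0]; exact Set.empty_subset _
  set Q := tile lam γ T (wordAt lam γ T hx l) with hQ
  refine (convex_ball x (Delta lam γ T hx l)).isPreconnected.subset_left_of_subset_union
    isOpen_interior (v := (closure Q)ᶜ) isClosed_closure.isOpen_compl ?_ ?_
    ⟨x, Metric.mem_ball_self h0, mem_tile_wordAt hx l⟩
  · exact disjoint_compl_right.mono_left (interior_subset.trans subset_closure)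
  · intro y hy
    by_contra hn
    rw [Set.mem_union, not_or, Set.mem_compl_iff, not_not] at hn
    have h1 : y ∈ frontier Q := ⟨hn.2, hn.1⟩
    have h2 : Delta lam γ T hx l ≤ dist x y := Metric.infDist_le_dist_of_mem h1
    rw [Metric.mem_ball'] at hy
    linarith

lemma IsSelfAffineTile.exists_Delta_le (hT : IsSelfAffineTile lam γ T) (hlam : 2 ≤ lam)
    (hn : 0 < n) (hx : x ∈ Omega lam γ T) :
    ∃ C, 0 < C ∧ ∀ l, Delta lam γ T hx l ≤ C * scale lam l := by
  obtain ⟨R, hR⟩ := hT.isCompact.isBounded.subset_closedBall 0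
  refine ⟨|2 * R| + 1, by positivity, fun l => ?_⟩
  obtain ⟨p, hp, hd⟩ := hT.exists_frontier_dist hlam hn hx l
  have h1 : mapQ lam γ (wordAt lam γ T hx l) p ∈ T :=
    (isClosed_tile hlam hT.isCompact.isClosed _).frontier_subset hp
  have h2 := interior_subset (mapQ_wordAt_mem hlam hx l)
  have h3 := dist_mapQ (lam := lam) (γ := γ) (wordAt lam γ T hx l) x p
  have h4 := dist_triangle_right (mapQ lam γ (wordAt lam γ T hx l) x)
    (mapQ lam γ (wordAt lam γ T hx l) p) 0
  have h5 := Metric.mem_closedBall.1 (hR h1)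
  have h6 := Metric.mem_closedBall.1 (hR h2)
  have h7 := le_abs_self (2 * R)
  have h8 : (lam : ℝ) ^ l * dist x p ≤ |2 * R| + 1 := by linarith
  have h9 := pow_mul_scale hlam l
  have hsc := scale_pos hlam l
  rw [hd]
  calc dist x p = (lam : ℝ) ^ l * dist x p * scale lam l := by
        rw [mul_right_comm, h9, one_mul]
    _ ≤ _ := by gcongr

lemma IsSelfAffineTile.exists_word_extending (hT : IsSelfAffineTile lam γ T) (hlam : 2 ≤ lam)
    {k : ℕ} {v : Fin k → Fin m} {y : E n} (hy : y ∈ tile lam γ T v) (d : ℕ) :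
    ∃ w : Fin (k + d) → Fin m, y ∈ tile lam γ T w ∧
      ∀ (j : ℕ) (hj : j < k), w ⟨j, by omega⟩ = v ⟨j, hj⟩ := by
  induction d with
  | zero => exact ⟨v, hy, fun _ _ => rfl⟩
  | succ d ih =>
    obtain ⟨w, hw, hwv⟩ := ih
    rw [hT.tile_eq_iUnion hlam w] at hw
    obtain ⟨i, hi⟩ := Set.mem_iUnion.1 hw
    refine ⟨(Fin.snoc w i : Fin (k + d + 1) → Fin m), hi, fun j hj => ?_⟩
    rw [← hwv j hj]
    exact Fin.snoc_castSucc (α := fun _ => Fin m) i w ⟨j, by omega⟩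

/-- Where the distance to the boundary drops, the boundary point lies in a sibling tile. -/
lemma IsSelfAffineTile.exists_sibling_word (hT : IsSelfAffineTile lam γ T) (hlam : 2 ≤ lam)
    (hn : 0 < n) (hx : x ∈ Omega lam γ T) {b l : ℕ} (hbl : b < l)
    (hdrop : Delta lam γ T hx (b + 1) < Delta lam γ T hx b) :
    ∃ (w : Fin l → Fin m) (y : E n), y ∈ tile lam γ T w ∧
      dist y x = Delta lam γ T hx (b + 1) ∧ w ⟨b, hbl⟩ ≠ digitAt hx b ∧
      ∀ (j : ℕ) (hj : j < b), w ⟨j, by omega⟩ = digitAt hx j := by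
  obtain ⟨p, hp, hd⟩ := hT.exists_frontier_dist hlam hn hx (b + 1)
  set v := wordAt lam γ T hx b with hv
  have hTc := hT.isCompact.isClosed
  rw [hT.wordAt_succ hlam hx b, ← hv] at hp
  have hpb : p ∈ interior (tile lam γ T v) := by
    by_contra hpn
    have h1 : p ∈ frontier (tile lam γ T v) :=
      ⟨subset_closure (hT.tile_snoc_subset hlam v _
        ((isClosed_tile hlam hTc _).frontier_subset hp)), hpn⟩
    have h2 : Delta lam γ T hx b ≤ dist x p := Metric.infDist_le_dist_of_mem h1
    linarith
  -- If no sibling contained p, a neighbourhood of p in the parent tile would be covered by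
  -- Q_{b+1,x} alone, and p would be interior to it.
  have hsib : ∃ i, i ≠ digitAt hx b ∧
      p ∈ tile lam γ T (Fin.snoc v i : Fin (b + 1) → Fin m) := by
    by_contra hno
    push Not at hno
    apply hp.2
    rw [mem_interior]
    refine ⟨interior (tile lam γ T v) ∩ ⋂ i ∈ {i | i ≠ digitAt hx b},
      (tile lam γ T (Fin.snoc v i : Fin (b + 1) → Fin m))ᶜ, ?_, ?_, hpb, ?_⟩
    · rintro y ⟨hy1, hy2⟩
      have hy3 := interior_subset hy1
      rw [hT.tile_eq_iUnion hlam v] at hy3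
      obtain ⟨i, hi⟩ := Set.mem_iUnion.1 hy3
      by_cases hib : i = digitAt hx b
      · rwa [hib] at hi
      · exact absurd hi (Set.mem_iInter₂.1 hy2 i hib)
    · exact isOpen_interior.inter ((Set.toFinite _).isOpen_biInter fun i _ =>
        (isClosed_tile hlam hTc _).isOpen_compl)
    · exact Set.mem_iInter₂.2 fun i hi => hno i hi
  obtain ⟨i, hi, hpi⟩ := hsib
  obtain ⟨d, rfl⟩ := Nat.exists_eq_add_of_le (Nat.succ_le_of_lt hbl)
  obtain ⟨w, hw, hwv⟩ := hT.exists_word_extending hlam hpi d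
  refine ⟨w, p, hw, by rw [dist_comm, hd], ?_, fun j hj => ?_⟩
  · rw [hwv b (Nat.lt_succ_self b)]
    have : (Fin.snoc v i : Fin (b + 1) → Fin m) (Fin.last b) = i := Fin.snoc_last _ _
    exact fun h => hi (this.symm.trans h)
  · rw [hwv j (by omega)]
    have h1 : (Fin.snoc v i : Fin (b + 1) → Fin m) (Fin.castSucc ⟨j, hj⟩) = v ⟨j, hj⟩ :=
      Fin.snoc_castSucc _ _ _
    exact h1.trans (hT.wordAt_apply hlam hx b ⟨j, hj⟩)

/-- If the distances `Δ_l` have bounded ratios, they are comparable with the size of the tiles: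
the successive drops of `Δ_l` below a given scale are caused by different neighbouring tiles of
that scale, whose number is bounded. -/
lemma IsSelfAffineTile.exists_le_Delta (hT : IsSelfAffineTile lam γ T) (hlam : 2 ≤ lam)
    (hn : 0 < n) (hx : x ∈ Omega lam γ T)
    (hbdd : BddAbove (Set.range fun l : ℕ => Delta lam γ T hx l / Delta lam γ T hx (l + 1))) :
    ∃ c, 0 < c ∧ ∀ l, c * scale lam l ≤ Delta lam γ T hx l := by
  classical
  obtain ⟨B', hB'⟩ := hbdd
  set B := max B' 1 with hBdef
  have hB1 : 1 ≤ B := le_max_right _ _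
  have hB0 : 0 < B := by linarith
  have hpos := hT.Delta_pos hlam hn hx
  have hB : ∀ l, Delta lam γ T hx l ≤ B * Delta lam γ T hx (l + 1) := by
    intro l
    have h1 := hB' ⟨l, rfl⟩
    simp only at h1
    rw [← div_le_iff₀ (hpos _)]
    exact h1.trans (le_max_left _ _)
  obtain ⟨N, hN⟩ := hT.exists_card_near_le hlam 1
  refine ⟨min 1 (Delta lam γ T hx 0) / B ^ N,
    div_pos (lt_min one_pos (hpos 0)) (by positivity), fun l => ?_⟩
  have hsc := scale_pos hlam l
  -- These are the drops that end at or below λ^(-l). Each yields a word of length l, of a tile near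
  -- x, that first departs from the digits of x at position b; so different drops yield different
  -- words.
  set p : ℕ → Prop := fun b => Delta lam γ T hx (b + 1) < Delta lam γ T hx b ∧
    Delta lam γ T hx (b + 1) ≤ scale lam l with hp
  have hcard : ((Finset.range l).filter p).card ≤ N := by
    have hex : ∀ b : {b // b < l ∧ p b}, ∃ (w : Fin l → Fin m) (y : E n), y ∈ tile lam γ T w ∧
        dist y x = Delta lam γ T hx (b + 1) ∧ w ⟨b, b.2.1⟩ ≠ digitAt hx b ∧
        ∀ (j : ℕ) (hj : j < b), w ⟨j, hj.trans b.2.1⟩ = digitAt hx j :=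
      fun b => hT.exists_sibling_word hlam hn hx b.2.1 b.2.2.1
    choose W Y hY1 hY2 hY3 hY4 using hex
    have hinj : Function.Injective W := by
      have key : ∀ a b : {b // b < l ∧ p b}, (a : ℕ) < b → W a ≠ W b := by
        intro a b hab h
        exact hY3 a (by rw [h]; exact hY4 b a hab)
      intro a b h
      rcases lt_trichotomy (a : ℕ) b with h1 | h1 | h1
      · exact absurd h (key a b h1)
      · exact Subtype.ext h1
      · exact absurd h.symm (key b a h1)
    have h1 := hN l x (((Finset.range l).filter p).attach.image fun b =>
      W ⟨b.1, Finset.mem_range.1 (Finset.mem_filter.1 b.2).1, (Finset.mem_filter.1 b.2).2⟩) (by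
        intro w hw
        obtain ⟨b, -, rfl⟩ := Finset.mem_image.1 hw
        refine ⟨_, hY1 _, ?_⟩
        rw [hY2, one_mul]
        exact (Finset.mem_filter.1 b.2).2.2)
    rw [Finset.card_image_of_injective, Finset.card_attach] at h1
    · exact h1
    · intro a b h
      exact Subtype.ext (Subtype.mk.inj (hinj h))
  -- A counted drop costs at most a factor B. At any other step either the distance does not
  -- decrease or it still exceeds λ^(-l).
  have hmain : ∀ b, min (scale lam l) (Delta lam γ T hx 0) ≤
      Delta lam γ T hx b * B ^ ((Finset.range b).filter p).card := by
    intro b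
    induction b with
    | zero => simp
    | succ b ih =>
      rw [Finset.range_add_one, Finset.filter_insert]
      have hpow : ∀ k : ℕ, 1 ≤ B ^ k := fun k => one_le_pow₀ hB1
      split_ifs with hpb
      · rw [Finset.card_insert_of_notMem (by simp), pow_succ]
        refine ih.trans ?_
        have := hB b
        calc Delta lam γ T hx b * B ^ ((Finset.range b).filter p).card
            ≤ B * Delta lam γ T hx (b + 1) * B ^ ((Finset.range b).filter p).card := by gcongr
          _ = _ := by ring
      · by_cases h1 : Delta lam γ T hx (b + 1) ≤ scale lam l
        · have h2 : Delta lam γ T hx b ≤ Delta lam γ T hx (b + 1) := by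
            by_contra h3
            exact hpb ⟨not_le.1 h3, h1⟩
          exact ih.trans (by gcongr)
        · refine (min_le_left _ _).trans ((not_le.1 h1).le.trans ?_)
          exact le_mul_of_one_le_right (hpos _).le (hpow _)
  have h1 := hmain l
  have h2 : min 1 (Delta lam γ T hx 0) * scale lam l ≤ min (scale lam l) (Delta lam γ T hx 0) := by
    apply le_min
    · exact mul_le_of_le_one_left hsc.le (min_le_left _ _)
    · calc _ ≤ min 1 (Delta lam γ T hx 0) * 1 := by
            have := lt_min one_pos (hpos 0)
            gcongr
            exact scale_le_one hlam l
        _ ≤ _ := by rw [mul_one]; exact min_le_right _ _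
  rw [div_mul_eq_mul_div, div_le_iff₀ (by positivity)]
  refine h2.trans (h1.trans ?_)
  have := hpos l
  gcongr

/-- Only Δ_l ≤ C λ^(-l) enters here, so no control of the ratios is needed. -/
lemma IsSelfAffineTile.exists_norm_muQ_wordAt_le_of_lt_tau1 (hT : IsSelfAffineTile lam γ T)
    (hlam : 2 ≤ lam) (hn : 0 < n) (hμ : ∀ i, 0 < ‖μ i‖ ∧ ‖μ i‖ < 1) (hx : x ∈ Omega lam γ T)
    {s : ℝ} (hs : 0 < s) (h : (s : EReal) < tau1 lam γ T μ hx) :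
    ∃ C, 0 ≤ C ∧ ∀ l, ‖muQ μ (wordAt lam γ T hx l)‖ ≤ C * scale lam l ^ s := by
  obtain ⟨C, hC, hCD⟩ := hT.exists_Delta_le hlam hn hx
  have h2 := eventually_lt_of_lt_liminf h
  obtain ⟨C', hC', hb⟩ := exists_bound_of_eventually hlam hs.le (C := C ^ s) (by positivity)
    (a := fun l => {‖muQ μ (wordAt lam γ T hx l)‖})
    (by rintro l r rfl; exact norm_muQ_le_one (fun i => (hμ i).2.le) _)
    (by
      filter_upwards [h2, eventually_le_of_lt_log_div_log hlam hs C] with l hl1 hl2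
      rintro r rfl
      exact hl2 _ _ (norm_pos_iff.2 (muQ_ne_zero (fun i => norm_pos_iff.1 (hμ i).1) _))
        (hT.Delta_pos hlam hn hx l) (hCD l) (EReal.coe_lt_coe_iff.1 hl1))
  exact ⟨C', hC', fun l => hb l _ rfl⟩

/-- The tile Q_{l,x} is one of those near x, so its weight decays at the rate τ₀; since Δ_l is
comparable with λ^(-l), the same rate bounds τ₁ from below. -/
lemma IsSelfAffineTile.tau0_le_tau1 (hT : IsSelfAffineTile lam γ T)
    (hlam : 2 ≤ lam) (hn : 0 < n) (hμ : ∀ i, 0 < ‖μ i‖ ∧ ‖μ i‖ < 1) (hx : x ∈ Omega lam γ T)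
    (hbdd : BddAbove (Set.range fun l : ℕ => Delta lam γ T hx l / Delta lam γ T hx (l + 1))) :
    tau0 lam γ T μ x ≤ tau1 lam γ T μ hx := by
  obtain ⟨C, hC, hCD⟩ := hT.exists_Delta_le hlam hn hx
  obtain ⟨c, hc, hcD⟩ := hT.exists_le_Delta hlam hn hx hbdd
  have key : ∀ s C' : ℝ, (∀ l, ‖muQ μ (wordAt lam γ T hx l)‖ ≤ C' * scale lam l ^ s) →
      (s : EReal) ≤ tau1 lam γ T μ hx := by
    intro s C' h
    rw [← EReal.ge_of_forall_gt_iff_ge]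
    intro t ht
    refine le_liminf_of_le (by isBoundedDefault) ?_
    filter_upwards [eventually_le_log_div_log hlam (EReal.coe_lt_coe_iff.1 ht) hc C C'] with l hl
    exact EReal.coe_le_coe_iff.2 (hl _ _
      (norm_pos_iff.2 (muQ_ne_zero (fun i => norm_pos_iff.1 (hμ i).1) _))
      (norm_muQ_le_one (fun i => (hμ i).2.le) _) (hcD l) (hCD l) (h l))
  rw [← EReal.ge_of_forall_gt_iff_ge]
  intro s hs
  rcases le_or_gt s 0 with h0 | h0
  · refine (EReal.coe_le_coe_iff.2 h0).trans (key 0 1 fun l => ?_)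
    simpa using norm_muQ_le_one (fun i => (hμ i).2.le) (wordAt lam γ T hx l)
  · obtain ⟨C', -, h⟩ := exists_norm_muQ_le_of_lt_tau0 hlam hT.isCompact hμ h0 hs
    exact key s C' fun l => h l _ ⟨x, Metric.mem_ball_self (scale_pos hlam l),
      interior_subset (mem_tile_wordAt hx l)⟩

end Boundary

/-! ### From suprema of exponents to individual exponents. -/

section Suprema

variable {n : ℕ} {lam : ℕ} {T : Set (E n)} {c : E n} {f : E n → ℂ} {U : Set (E n)} {x : E n}

lemma exists_memHolder_of_lt_alphaOn {s : ℝ} (hs : 0 < s)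
    (h : (s : EReal) < alphaOn lam T c f U) : ∃ s', s < s' ∧ MemHolder lam T c s' f U := by
  obtain ⟨s', hs'⟩ := lt_iSup_iff.1 h
  obtain ⟨h1, hs'⟩ := lt_iSup_iff.1 hs'
  have h2 := EReal.coe_lt_coe_iff.1 hs'
  rcases h1 with rfl | h1
  · exact absurd h2 (not_lt.2 hs.le)
  · exact ⟨s', h2, h1.2⟩

lemma alphaOn_eq_top (h : MemSmooth lam T c f U) : alphaOn lam T c f U = ⊤ := by
  rw [eq_top_iff, ← EReal.ge_of_forall_gt_iff_ge]
  intro z _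
  have hz : 0 < max z 1 := lt_max_of_lt_right one_pos
  refine (EReal.coe_le_coe_iff.2 (le_max_left z 1)).trans ?_
  exact le_iSup₂ (f := fun s (_ : s ∈ {s : ℝ | s = 0 ∨ (0 < s ∧ MemHolder lam T c s f U)}) =>
    (s : EReal)) (max z 1) (Or.inr ⟨hz, h _ hz⟩)

lemma le_alphaAt_of_forall {a : EReal}
    (h : ∀ s : ℝ, 0 < s → (s : EReal) < a → MemPointwise lam T c s f x) :
    a ≤ alphaAt lam T c f x := by
  rw [← EReal.ge_of_forall_gt_iff_ge]
  intro s hs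
  have key : ∀ s : ℝ, (s = 0 ∨ (0 < s ∧ MemPointwise lam T c s f x)) →
      (s : EReal) ≤ alphaAt lam T c f x := fun s hs =>
    le_iSup₂ (f := fun s (_ : s ∈ {s : ℝ | s = 0 ∨ (0 < s ∧ MemPointwise lam T c s f x)}) =>
      (s : EReal)) s hs
  rcases le_or_gt s 0 with h0 | h0
  · exact (EReal.coe_le_coe_iff.2 h0).trans (key 0 (Or.inl rfl))
  · exact key s (Or.inr ⟨h0, h s h0 hs⟩)

lemma exists_ball_radii (hT : IsCompact T) (hc : c ∈ interior T) :
    ∃ r R, 0 < r ∧ r ≤ R ∧ Metric.ball c r ⊆ T ∧ T ⊆ Metric.ball c R := by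
  obtain ⟨r, hr, hrT⟩ := Metric.isOpen_iff.1 isOpen_interior c hc
  obtain ⟨R, hR⟩ := hT.isBounded.subset_ball c
  exact ⟨r, max r R, hr, le_max_left _ _, hrT.trans interior_subset,
    hR.trans (Metric.ball_subset_ball (le_max_right _ _))⟩

/-- Uniform local polynomial approximation on a finite family of domains. -/
lemma exists_approxOn_of_forall_memHolder {m : ℕ} (hlam : 2 ≤ lam) (hT : IsCompact T)
    (hc : c ∈ interior T) {U : Fin m → Set (E n)} {s : ℝ} (hs : 0 < s) {S : Fin m → ℝ}
    (hS : ∀ i, s ≤ S i) {K : ℕ} (hK : ∀ i, ⌊S i⌋₊ ≤ K) {B : ℝ} (hB : ∀ y, ‖f y‖ ≤ B)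
    (h : ∀ i, MemHolder lam T c (S i) f (U i)) :
    ∃ C δ, 0 ≤ C ∧ 0 < δ ∧ δ ≤ 1 ∧
      ∀ i x ρ, 0 < ρ → Metric.ball x ρ ⊆ U i → ApproxOn K f x (δ * ρ) (C * ρ ^ s) := by
  obtain ⟨r, R, hr0, hrR, hr, hR⟩ := exists_ball_radii hT hc
  have hB0 : 0 ≤ B := (norm_nonneg _).trans (hB 0)
  choose C δ hC hδ0 hδ1 happ using fun i =>
    exists_approxOn_of_memHolder hlam hr0 hrR hr hR (hs.trans_le (hS i)) hB (h i)
  obtain ⟨d, hd0, hd1, hd⟩ : ∃ d, 0 < d ∧ d ≤ 1 ∧ ∀ i, d ≤ δ i := by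
    rcases isEmpty_or_nonempty (Fin m) with hm | hm
    · exact ⟨1, one_pos, le_rfl, fun i => hm.elim i⟩
    · obtain ⟨i, hi⟩ := Finite.exists_min δ
      exact ⟨δ i, hδ0 i, hδ1 i, hi⟩
  have hCsum : 0 ≤ ∑ i, C i := Finset.sum_nonneg fun i _ => hC i
  refine ⟨∑ i, C i + B, d, by positivity, hd0, hd1, fun i x ρ hρ hU => ?_⟩
  have hρs : 0 < ρ ^ s := Real.rpow_pos_of_pos hρ s
  rcases le_or_gt 1 ρ with h1 | h1
  · refine approxOn_of_norm_le _ fun y _ => (hB y).trans ?_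
    have := Real.one_le_rpow h1 hs.le
    nlinarith
  · refine (happ i x ρ hρ hU).mono (hK i) (by gcongr; exact hd i) ?_
    have h2 : C i ≤ ∑ i, C i := Finset.single_le_sum (fun i _ => hC i) (Finset.mem_univ i)
    have h3 : ρ ^ S i ≤ ρ ^ s := Real.rpow_le_rpow_of_exponent_ge hρ h1.le (hS i)
    calc C i * ρ ^ S i ≤ C i * ρ ^ s := mul_le_mul_of_nonneg_left h3 (hC i)
      _ ≤ (∑ i, C i + B) * ρ ^ s := by gcongr; linarith

end Suprema

/-! ### Lower bounds for the pointwise exponent. -/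

section LowerBounds

variable {n m : ℕ} {lam : ℕ} {γ : Fin m → Fin n → ℤ} {T : Set (E n)} {c : E n} {μ : Fin m → ℂ}
  {φ : E n → ℂ} {x : E n}

lemma scale_rpow_eq_pow (hlam : 2 ≤ lam) (d : ℕ) (e : ℝ) :
    scale lam d ^ e = (scale lam 1 ^ e) ^ d := by
  rw [Real.rpow_pow_comm (scale_pos hlam 1).le]
  simp [scale]

/-- The regularity of `f` at `x` is governed by the weights of the tiles near `x`. -/
lemma IsSelfAffineTile.memPointwise_series (hT : IsSelfAffineTile lam γ T) (hlam : 2 ≤ lam)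
    (hc : c ∈ interior T) (hμ : ∀ i, ‖μ i‖ < 1) (hφT : ∀ y, y ∉ interior T → φ y = 0) {B : ℝ}
    (hB : ∀ y, ‖φ y‖ ≤ B) {s s' ρ C C' : ℝ} (hs : 0 < s) (hss' : s < s') (hρ : 0 < ρ)
    (hC : 0 ≤ C) (hC' : 0 ≤ C') {K N : ℕ} {W : ∀ l, Finset (Fin l → Fin m)}
    (hN : ∀ l, (W l).card ≤ N) (hμW : ∀ l, ∀ w ∈ W l, ‖muQ μ w‖ ≤ C * scale lam l ^ s)
    (hW : ∀ l, ∀ y ∈ Metric.ball x (ρ * scale lam l), ∀ w : Fin l → Fin m,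
      mapQ lam γ w y ∈ interior T → w ∈ W l)
    (happ : ∀ l d, ∀ w ∈ W l, ApproxOn K (fun y => φ (mapQ lam γ w y)) x
      (ρ * scale lam (l + (d + 1))) (C' * scale lam (d + 1) ^ s')) :
    MemPointwise lam T c s (series lam γ μ φ) x := by
  obtain ⟨r, R, hr0, hrR, -, hR⟩ := exists_ball_radii hT.isCompact hc
  obtain ⟨B', hB'⟩ := hT.exists_norm_series_le hlam hμ hφT hB
  have hB'0 : 0 ≤ B' := (norm_nonneg _).trans (hB' 0)
  -- At scale λ^(-L), a term of level l has error λ^(-ls) λ^(-(L-l)s') = λ^(-Ls) q^(L-l) up to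
  -- constants; the surplus s' - s makes the sum over l converge uniformly in L.
  set q := scale lam 1 ^ (s' - s) with hq
  have hq0 : 0 ≤ q := Real.rpow_nonneg (scale_pos hlam 1).le _
  have hq1 : q < 1 := by
    apply Real.rpow_lt_one (scale_pos hlam 1).le _ (by linarith)
    have : (1 : ℝ) < lam := by exact_mod_cast (by omega : 1 < lam)
    simpa [scale] using inv_lt_one_of_one_lt₀ this
  have hq2 : 0 ≤ (1 - q)⁻¹ := inv_nonneg.2 (by linarith)
  refine memPointwise_of_approxOn hlam (hr0.trans_le hrR) hR hs (K := K)
    (C := N * (C * C') * (1 - q)⁻¹ + C * B') (by positivity) hρ hB' fun L => ?_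
  have hscL := Real.rpow_pos_of_pos (scale_pos hlam L) s
  have h1 : ∀ l ∈ Finset.range L,
      ApproxOn K (fun y => ∑ w ∈ W l, muQ μ w * φ (mapQ lam γ w y)) x (ρ * scale lam L)
        (N * (C * C') * scale lam L ^ s * q ^ (L - l)) := by
    intro l hl
    obtain ⟨d, rfl⟩ := Nat.exists_eq_add_of_lt (Finset.mem_range.1 hl)
    rw [add_assoc, Nat.add_sub_cancel_left]
    have hsd := scale_pos hlam (d + 1)
    refine (ApproxOn.sum fun w hw => (happ l d w hw).const_mul (muQ μ w)).mono le_rfl le_rfl ?_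
    have h2 : ∀ w ∈ W l, ‖muQ μ w‖ * (C' * scale lam (d + 1) ^ s') ≤
        C * C' * scale lam (l + (d + 1)) ^ s * q ^ (d + 1) := by
      intro w hw
      have h3 : scale lam (d + 1) ^ s' = scale lam (d + 1) ^ s * q ^ (d + 1) := by
        rw [hq, ← scale_rpow_eq_pow hlam, ← Real.rpow_add hsd]
        congr 1; ring
      rw [scale_add (lam := lam) l (d + 1), Real.mul_rpow (scale_pos hlam l).le hsd.le, h3]
      calc _ ≤ C * scale lam l ^ s * (C' * (scale lam (d + 1) ^ s * q ^ (d + 1))) :=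
            mul_le_mul_of_nonneg_right (hμW l w hw) (by positivity)
        _ = _ := by ring
    refine (Finset.sum_le_card_nsmul _ _ _ h2).trans ?_
    rw [nsmul_eq_mul]
    have h4 : ((W l).card : ℝ) ≤ N := by exact_mod_cast hN l
    calc _ ≤ (N : ℝ) * (C * C' * scale lam (l + (d + 1)) ^ s * q ^ (d + 1)) := by
          refine mul_le_mul_of_nonneg_right h4 ?_
          have := Real.rpow_nonneg (scale_pos hlam (l + (d + 1))).le s
          positivity
      _ = _ := by ring
  have h2 : ApproxOn K (fun y => ∑ w : Fin L → Fin m,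
      muQ μ w * series lam γ μ φ (mapQ lam γ w y)) x (ρ * scale lam L)
        (C * scale lam L ^ s * B') := by
    refine approxOn_of_norm_le _ fun y hy => ?_
    exact hT.norm_sum_muQ_mul_le hlam (fun y hy => hT.series_eq_zero hlam hφT hy) hB'
      (by positivity) fun w hw => hμW L w (hW L y hy w hw)
  refine (((ApproxOn.sum h1).add h2).congr fun y hy => ?_).mono le_rfl le_rfl ?_
  · rw [hT.series_eq_sum_add hlam hμ hφT hB L y]
    congr 1
    refine Finset.sum_congr rfl fun l hl => ?_
    symm
    refine Finset.sum_subset (Finset.subset_univ _) fun w _ hw => ?_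
    rw [hφT, mul_zero]
    refine fun hmem => hw (hW l y ?_ w hmem)
    refine Metric.ball_subset_ball ?_ hy
    exact mul_le_mul_of_nonneg_left (scale_anti hlam (Finset.mem_range.1 hl).le) hρ.le
  · rw [← Finset.mul_sum]
    calc _ ≤ N * (C * C') * scale lam L ^ s * (1 - q)⁻¹ + C * scale lam L ^ s * B' := by
          gcongr
          exact sum_pow_sub_le hq0 hq1 L
      _ = _ := by ring

lemma pow_mul_mul_scale_add (hlam : 2 ≤ lam) (δ : ℝ) (l d : ℕ) :
    (lam : ℝ) ^ l * (δ * scale lam (l + d)) = δ * scale lam d := by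
  rw [scale_add]
  calc _ = (lam : ℝ) ^ l * scale lam l * (δ * scale lam d) := by ring
    _ = _ := by rw [pow_mul_scale hlam, one_mul]

lemma mapQ_mem_ball (hlam : 2 ≤ lam) {l d : ℕ} (w : Fin l → Fin m) {δ : ℝ} {y : E n}
    (hy : y ∈ Metric.ball x (δ * scale lam (l + d))) :
    mapQ lam γ w y ∈ Metric.ball (mapQ lam γ w x) (δ * scale lam d) := by
  have h0 : (0 : ℝ) < lam := by exact_mod_cast (by omega : 0 < lam)
  rw [Metric.mem_ball, dist_mapQ, ← pow_mul_mul_scale_add hlam δ l d]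
  have := Metric.mem_ball.1 hy
  gcongr

lemma ApproxOn.comp_mapQ (hlam : 2 ≤ lam) {l d K : ℕ} {w : Fin l → Fin m} {δ A : ℝ}
    (h : ApproxOn K φ (mapQ lam γ w x) (δ * scale lam d) A) :
    ApproxOn K (fun y => φ (mapQ lam γ w y)) x (δ * scale lam (l + d)) A := by
  simp only [mapQ_eq w]
  refine h.comp_affine (pow_ne_zero l (by exact_mod_cast (by omega : lam ≠ 0))) fun z hz => ?_
  rw [← mapQ_eq w]
  exact mapQ_mem_ball hlam w hz

/-- Every tile meeting the ball is kept, a bounded number per level. As φ is regular on all of ℝⁿ,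
the position of M_Q x does not matter. -/
lemma IsSelfAffineTile.min_alpha_tau0_le (hT : IsSelfAffineTile lam γ T) (hlam : 2 ≤ lam)
    (hc : c ∈ interior T) (hμ : ∀ i, 0 < ‖μ i‖ ∧ ‖μ i‖ < 1)
    (hφT : ∀ y, y ∉ interior T → φ y = 0) {B : ℝ} (hB : ∀ y, ‖φ y‖ ≤ B) (x : E n) :
    min (alpha lam T c φ) (tau0 lam γ T μ x) ≤ alphaAt lam T c (series lam γ μ φ) x := by
  classical
  refine le_alphaAt_of_forall fun s hs hlt => ?_
  obtain ⟨h1, h2⟩ := lt_min_iff.1 hlt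
  obtain ⟨s', hss', hφ⟩ := exists_memHolder_of_lt_alphaOn hs h1
  obtain ⟨C, hC, hCμ⟩ := exists_norm_muQ_le_of_lt_tau0 hlam hT.isCompact hμ hs h2
  obtain ⟨r, R, hr0, hrR, hr, hR⟩ := exists_ball_radii hT.isCompact hc
  obtain ⟨C', δ, hC', hδ0, hδ1, happ⟩ :=
    exists_approxOn_of_memHolder hlam hr0 hrR hr hR (hs.trans hss') hB hφ
  obtain ⟨N, hN⟩ := hT.exists_card_near_le hlam 1
  set W : ∀ l, Finset (Fin l → Fin m) := fun l =>
    Finset.univ.filter fun w => (Metric.ball x (scale lam l) ∩ tile lam γ T w).Nonempty with hW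
  refine hT.memPointwise_series hlam hc (fun i => (hμ i).2) hφT hB hs hss' hδ0 hC hC' (W := W)
    (fun l => hN l x (W l) fun w hw => ?_)
    (fun l w hw => hCμ l w (Finset.mem_filter.1 hw).2)
    (fun l y hy w hw => Finset.mem_filter.2 ⟨Finset.mem_univ _, y, ?_,
      interior_subset (s := T) hw⟩)
    (fun l d w _ => ApproxOn.comp_mapQ hlam
      (happ _ _ (scale_pos hlam (d + 1)) (Set.subset_univ _)))
  · obtain ⟨y, hy1, hy2⟩ := (Finset.mem_filter.1 hw).2
    exact ⟨y, hy2, by rw [one_mul]; exact (Metric.mem_ball.1 hy1).le⟩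
  · refine Metric.ball_subset_ball ?_ hy
    exact mul_le_of_le_one_left (scale_pos hlam l).le hδ1

/-- A ball of radius comparable with λ^(-l) about x stays in Q_{l,x}, so one tile per level
suffices. For L > l the term of level l is seen only within the child Q_{l+1,x}, which M_Q sends
into a single Ω_i; the behaviour of φ across the boundaries of the Ω_i is irrelevant. -/
lemma IsSelfAffineTile.min_alphaOn_tau1_le (hT : IsSelfAffineTile lam γ T) (hlam : 2 ≤ lam)
    (hn : 0 < n) (hc : c ∈ interior T) (hμ : ∀ i, 0 < ‖μ i‖ ∧ ‖μ i‖ < 1)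
    (hφT : ∀ y, y ∉ interior T → φ y = 0) {B : ℝ} (hB : ∀ y, ‖φ y‖ ≤ B) (hx : x ∈ Omega lam γ T)
    (hbdd : BddAbove (Set.range fun l : ℕ => Delta lam γ T hx l / Delta lam γ T hx (l + 1))) :
    min (⨅ i : Fin m, alphaOn lam T c φ (subdomain lam γ T i)) (tau1 lam γ T μ hx) ≤
      alphaAt lam T c (series lam γ μ φ) x := by
  refine le_alphaAt_of_forall fun s hs hlt => ?_
  obtain ⟨h1, h2⟩ := lt_min_iff.1 hlt
  choose S hsS hS using fun i =>
    exists_memHolder_of_lt_alphaOn hs (h1.trans_le (iInf_le _ i))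
  obtain ⟨C, hC, hCμ⟩ := hT.exists_norm_muQ_wordAt_le_of_lt_tau1 hlam hn hμ hx hs h2
  obtain ⟨e, he, heΔ⟩ := hT.exists_le_Delta hlam hn hx hbdd
  obtain ⟨s', hss', hs'S⟩ : ∃ s', s < s' ∧ ∀ i, s' ≤ S i := by
    have : Nonempty (Fin m) := ⟨digitAt hx 0⟩
    obtain ⟨i, hi⟩ := Finite.exists_min S
    exact ⟨S i, hsS i, hi⟩
  obtain ⟨C', δ, hC', hδ0, hδ1, happ⟩ := exists_approxOn_of_forall_memHolder hlam hT.isCompact hc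
    (hs.trans hss') hs'S (K := ∑ i, ⌊S i⌋₊)
    (fun i => Finset.single_le_sum (f := fun i => ⌊S i⌋₊) (fun _ _ => Nat.zero_le _)
      (Finset.mem_univ i)) hB hS
  have he' : 0 ≤ C' * e ^ s' := mul_nonneg hC' (Real.rpow_nonneg he.le _)
  have hball : ∀ l, Metric.ball x (e * scale lam l) ⊆
      interior (tile lam γ T (wordAt lam γ T hx l)) := fun l =>
    (Metric.ball_subset_ball (heΔ l)).trans (ball_Delta_subset hx l)
  refine hT.memPointwise_series hlam hc (fun i => (hμ i).2) hφT hB hs hss' (ρ := δ * e)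
    (by positivity) hC he' (K := ∑ i, ⌊S i⌋₊) (N := 1) (W := fun l => {wordAt lam γ T hx l})
    (fun l => by simp)
    (fun l w hw => by rw [Finset.mem_singleton.1 hw]; exact hCμ l)
    (fun l y hy w hw => ?_) (fun l d w hw => ?_)
  · rw [Finset.mem_singleton]
    refine hT.word_unique hlam hw ?_
    have h3 : y ∈ interior (tile lam γ T (wordAt lam γ T hx l)) := by
      refine hball l (Metric.ball_subset_ball ?_ hy)
      have := scale_pos hlam l
      gcongr
      exact mul_le_of_le_one_left he.le hδ1
    rwa [interior_tile hlam] at h3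
  · rw [Finset.mem_singleton.1 hw]
    apply ApproxOn.comp_mapQ hlam
    have hsd := scale_pos hlam (d + 1)
    have h3 := happ (digitAt hx l) (mapQ lam γ (wordAt lam γ T hx l) x)
      (e * scale lam (d + 1)) (by positivity) (fun z hz => ?_)
    · rw [Real.mul_rpow he.le hsd.le] at h3
      rw [mul_assoc, mul_assoc]
      exact h3
    · obtain ⟨y, rfl⟩ := (mapQHomeo hlam γ (wordAt lam γ T hx l)).surjective z
      rw [mapQHomeo_apply, Metric.mem_ball, dist_mapQ,
        ← pow_mul_mul_scale_add hlam e l (d + 1)] at hz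
      have h0 : (0 : ℝ) < lam := by exact_mod_cast (by omega : 0 < lam)
      have h4 : y ∈ Metric.ball x (e * scale lam (l + 1)) := by
        refine (lt_of_mul_lt_mul_left hz (by positivity)).trans_le ?_
        exact mul_le_mul_of_nonneg_left (scale_anti hlam (by omega)) he.le
      have h5 := hball (l + 1) h4
      rw [interior_tile hlam, Set.mem_preimage, hT.wordAt_succ hlam hx l, mapQ_snoc] at h5
      exact h5

end LowerBounds

/-! ### Upper bounds: transporting regularity at x to an interior point. -/

section UpperBounds

variable {n m : ℕ} {lam : ℕ} {γ : Fin m → Fin n → ℤ} {T : Set (E n)} {c : E n} {μ : Fin m → ℂ}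
  {φ : E n → ℂ} {x : E n}

/-- The inverse of the map `M_Q`. -/
def invQ (lam : ℕ) (γ : Fin m → Fin n → ℤ) {l : ℕ} (w : Fin l → Fin m) (z : E n) : E n :=
  scale lam l • z + scale lam l • latticePt (nuQ lam γ w)

lemma mapQ_invQ (hlam : 2 ≤ lam) {l : ℕ} (w : Fin l → Fin m) (z : E n) :
    mapQ lam γ w (invQ lam γ w z) = z := by
  rw [mapQ, invQ, smul_add, smul_smul, smul_smul, pow_mul_scale hlam, one_smul, one_smul,
    add_sub_cancel_right]

lemma invQ_snoc (hlam : 2 ≤ lam) {l : ℕ} (w : Fin l → Fin m) (i : Fin m) (z : E n) :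
    invQ lam γ (Fin.snoc w i : Fin (l + 1) → Fin m) z =
      invQ lam γ w ((lam : ℝ)⁻¹ • z + (lam : ℝ)⁻¹ • latticePt (γ i)) := by
  have h0 : (lam : ℝ) ≠ 0 := by exact_mod_cast (by omega : lam ≠ 0)
  apply (mapQHomeo hlam γ (Fin.snoc w i : Fin (l + 1) → Fin m)).injective
  rw [mapQHomeo_apply, mapQHomeo_apply, mapQ_invQ hlam, mapQ_snoc, mapQ_invQ hlam, smul_add,
    smul_smul, smul_smul, mul_inv_cancel₀ h0, one_smul, one_smul, add_sub_cancel_right]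

/-- On each tile `Q`, the function `f` differs from `μ_Q f ∘ M_Q` by a function which is smooth at
the scale of `Q`, with bounds proportional to `|μ_Q|`. -/
lemma IsSelfAffineTile.approxOn_comp_invQ_sub (hT : IsSelfAffineTile lam γ T) (hlam : 2 ≤ lam)
    (hμ : ∀ i, ‖μ i‖ < 1) (hφT : ∀ y, y ∉ interior T → φ y = 0) {B : ℝ} (hB : ∀ y, ‖φ y‖ ≤ B)
    {s C δ p : ℝ} {K : ℕ} (hC : 0 ≤ C) (hδ1 : δ ≤ 1)
    (hp : ∀ i, p ≤ ‖μ i‖) (hps : 2 * ((lam : ℝ)⁻¹) ^ s ≤ p)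
    (happ : ∀ i x ρ, 0 < ρ → Metric.ball x ρ ⊆ subdomain lam γ T i →
      ApproxOn K φ x (δ * ρ) (C * ρ ^ s))
    {l : ℕ} (w : Fin l → Fin m) {y : E n} {ρ : ℝ} (hρ : 0 < ρ)
    (hball : Metric.ball y ρ ⊆ interior T) :
    ApproxOn K (fun z => series lam γ μ φ (invQ lam γ w z) - muQ μ w * series lam γ μ φ z)
      y (δ * ρ) (C * ‖muQ μ w‖ * ρ ^ s) := by
  have h0 : (0 : ℝ) < lam := by exact_mod_cast (by omega : 0 < lam)
  induction l generalizing y ρ with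
  | zero =>
    refine approxOn_of_norm_le _ fun z _ => ?_
    have hz : invQ lam γ w z = z := by simp [invQ]
    rw [hz, muQ_zero, one_mul, sub_self, norm_zero]
    positivity
  | succ l ih =>
    obtain ⟨v, i, rfl⟩ := exists_eq_snoc w
    set b : E n := (lam : ℝ)⁻¹ • latticePt (γ i) with hb
    set y' : E n := (lam : ℝ)⁻¹ • y + b with hy'
    set ρ' : ℝ := (lam : ℝ)⁻¹ * ρ with hρ'
    have hρ'0 : 0 < ρ' := by positivity
    have hsub : Metric.ball y' ρ' ⊆ subdomain lam γ T i := by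
      intro z hz
      apply hball
      have h1 : (lam : ℝ) • z - latticePt (γ i) - y = (lam : ℝ) • (z - y') := by
        rw [hy', hb, smul_sub, smul_add, smul_smul, smul_smul, mul_inv_cancel₀ h0.ne', one_smul,
          one_smul]
        abel
      rw [Metric.mem_ball, dist_eq_norm, h1, norm_smul, Real.norm_of_nonneg h0.le,
        ← dist_eq_norm]
      calc (lam : ℝ) * dist z y' < lam * ρ' := by gcongr; exact hz
        _ = ρ := by rw [hρ', mul_inv_cancel_left₀ h0.ne']
    -- For the parent word v and z' = M_i⁻¹ z, the induction compares f at the given point with μ_v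
    -- f(z'), and f(z') = φ(z') + μ_i f(z). The second summand approximates the new term μ_v φ(z').
    have h1 := (ih v hρ'0 (hsub.trans (hT.subdomain_subset hlam i))).add
      ((happ i y' ρ' hρ'0 hsub).const_mul (muQ μ v))
    have h2 := h1.comp_affine (inv_ne_zero h0.ne') (b := b) (y := y) (r' := δ * ρ) fun z hz => by
      rw [hy', Metric.mem_ball, dist_add_right, dist_smul₀, Real.norm_of_nonneg (by positivity),
        hρ', mul_left_comm]
      gcongr
      exact hz
    refine (h2.congr fun z hz => ?_).mono le_rfl le_rfl ?_
    · have hzT : z ∈ interior T :=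
        hball (Metric.ball_subset_ball (mul_le_of_le_one_left hρ.le hδ1) hz)
      have hz' : (lam : ℝ) • ((lam : ℝ)⁻¹ • z + b) - latticePt (γ i) = z := by
        rw [hb, smul_add, smul_smul, smul_smul, mul_inv_cancel₀ h0.ne', one_smul, one_smul,
          add_sub_cancel_right]
      have hmem : (lam : ℝ)⁻¹ • z + b ∈ subdomain lam γ T i := by
        change (lam : ℝ) • ((lam : ℝ)⁻¹ • z + b) - latticePt (γ i) ∈ interior T
        rwa [hz']
      rw [invQ_snoc hlam, ← hb, muQ_snoc, hT.series_eq_of_mem hlam hμ hφT hB hmem, hz']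
      ring
    · rw [muQ_snoc, norm_mul, hρ', Real.mul_rpow (by positivity) hρ.le]
      have hρs : 0 < ρ ^ s := Real.rpow_pos_of_pos hρ s
      -- The two errors, both at radius ρ / λ, give 2 λ^(-s); since this is at most |μ_i|, the
      -- constant C does not grow with the level.
      calc _ = C * ‖muQ μ v‖ * (2 * ((lam : ℝ)⁻¹) ^ s) * ρ ^ s := by ring
        _ ≤ C * ‖muQ μ v‖ * ‖μ i‖ * ρ ^ s := by
          gcongr
          exact hps.trans (hp i)
        _ = _ := by ring

/-- If `f` is irregular somewhere in `T°`, its regularity at `x` bounds the weights of the tiles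
near `x`. -/
lemma IsSelfAffineTile.exists_norm_muQ_le_of_memPointwise (hT : IsSelfAffineTile lam γ T)
    (hlam : 2 ≤ lam) (hc : c ∈ interior T) (hμ : ∀ i, 0 < ‖μ i‖ ∧ ‖μ i‖ < 1)
    (hφT : ∀ y, y ∉ interior T → φ y = 0) {B : ℝ} (hB : ∀ y, ‖φ y‖ ≤ B)
    {θ : 𝓢(E n, ℂ)} (hθ : IsLPGenerator lam θ)
    (hsm : ∀ i : Fin m, MemSmooth lam T c φ (subdomain lam γ T i))
    (hns : NonSmoothSomewhere lam θ T (series lam γ μ φ)) {s : ℝ} (hs : 0 < s)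
    (hf : MemPointwise lam T c s (series lam γ μ φ) x) :
    ∃ C, ∀ (l : ℕ) (w : Fin l → Fin m),
      (Metric.ball x (scale lam l) ∩ tile lam γ T w).Nonempty →
        ‖muQ μ w‖ ≤ C * scale lam l ^ s := by
  by_contra hcon
  push Not at hcon
  have h0 : (1 : ℝ) < lam := by exact_mod_cast (by omega : 1 < lam)
  have hμ1 : ∀ i, ‖μ i‖ < 1 := fun i => (hμ i).2
  obtain ⟨s₀, hs₀, y₀, hy₀, hns⟩ := hns
  obtain ⟨r, R, hr0, hrR, hr, hR⟩ := exists_ball_radii hT.isCompact hc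
  obtain ⟨Bf, hBf⟩ := hT.exists_norm_series_le hlam hμ1 hφT hB
  have hBf0 : 0 ≤ Bf := (norm_nonneg _).trans (hBf 0)
  obtain ⟨p, hp0, hp⟩ := exists_pos_le_norm fun i => (hμ i).1
  obtain ⟨N₀, hN₀⟩ := exists_scale_le hlam (a := p / 2) (by positivity)
  -- The three summands ensure 2 λ^(-t) ≤ min |μ_i|, degree at least ⌊s⌋, and t ≥ s₀. Taking t = N +
  -- 1/2 gives ⌊t⌋ ≤ N < t, as both approximation lemmas require.
  set N := N₀ + ⌊s⌋₊ + ⌈s₀⌉₊ with hN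
  set t : ℝ := N + 1 / 2 with ht
  have hNt : (N : ℝ) < t := by rw [ht]; linarith
  have ht0 : 0 < t := (Nat.cast_nonneg N).trans_lt hNt
  have hs₀t : s₀ ≤ t := by
    have h1 := Nat.le_ceil s₀
    have h2 : ((⌈s₀⌉₊ : ℕ) : ℝ) ≤ N := by exact_mod_cast (by omega : ⌈s₀⌉₊ ≤ N)
    linarith
  have hfloor : ⌊t⌋₊ ≤ N := by
    rw [← Nat.lt_succ_iff, Nat.floor_lt ht0.le, ht]
    push_cast
    linarith
  have hps : 2 * ((lam : ℝ)⁻¹) ^ t ≤ p := by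
    have h1 : ((lam : ℝ)⁻¹) ^ t ≤ scale lam N₀ := by
      rw [scale, ← inv_pow, ← Real.rpow_natCast]
      apply Real.rpow_le_rpow_of_exponent_ge (by positivity) (inv_le_one_of_one_le₀ h0.le)
      have h2 : (N₀ : ℝ) ≤ N := by exact_mod_cast (by omega : N₀ ≤ N)
      linarith
    linarith
  obtain ⟨C, δ, hC, hδ0, hδ1, happ⟩ := exists_approxOn_of_forall_memHolder hlam hT.isCompact hc
    ht0 (S := fun _ => t) (fun _ => le_rfl) (fun _ => hfloor) hB (fun i => hsm i t ht0)
  obtain ⟨Cx, hCx, happx⟩ := exists_approxOn_of_memPointwise hlam hr0 hr hs hBf hf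
  obtain ⟨ρ₁, hρ₁, hball⟩ := Metric.isOpen_iff.1 isOpen_interior y₀ hy₀
  have hall : ∀ ρ, 0 < ρ → ApproxOn N (series lam γ μ φ) y₀ ρ
      ((1 + C * (δ⁻¹) ^ t + Bf * ((δ * ρ₁)⁻¹) ^ t) * ρ ^ t) := by
    intro ρ hρ
    have hρt : 0 < ρ ^ t := Real.rpow_pos_of_pos hρ t
    rcases le_or_gt (δ * ρ₁) ρ with h1 | h1
    · refine approxOn_of_norm_le _ fun y _ => (hBf y).trans ?_
      have h2 : 1 ≤ ((δ * ρ₁)⁻¹) ^ t * ρ ^ t := by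
        rw [← Real.mul_rpow (by positivity) hρ.le]
        apply Real.one_le_rpow _ ht0.le
        rw [inv_mul_eq_div, one_le_div (by positivity)]
        exact h1
      have h3 : 0 ≤ (1 + C * (δ⁻¹) ^ t) * ρ ^ t := by positivity
      nlinarith
    · set ρ' := δ⁻¹ * ρ with hρ'
      have hρ'0 : 0 < ρ' := by positivity
      have hρδ : δ * ρ' = ρ := by rw [hρ', mul_inv_cancel_left₀ hδ0.ne']
      have hρ'1 : ρ' ≤ ρ₁ := by
        rw [← hρδ] at h1
        exact (lt_of_mul_lt_mul_left h1 hδ0.le).le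
      have hρρ' : ρ ≤ ρ' := by rw [← hρδ]; exact mul_le_of_le_one_left hρ'0.le hδ1
      have hb' : Metric.ball y₀ ρ' ⊆ interior T := (Metric.ball_subset_ball hρ'1).trans hball
      -- The tile depends on ρ: its weight is so large that, after division by μ_Q, the error of f
      -- on Q coming from f ∈ C^s(x) is at most ρ^t.
      obtain ⟨l, w, hw, hbig⟩ := hcon (Cx * (1 + 2 * R) ^ s / ρ ^ t)
      have hsc := scale_pos hlam l
      have hscs := Real.rpow_pos_of_pos hsc s
      have hR0 : 0 < R := hr0.trans_le hrR
      have hμw : muQ μ w ≠ 0 := muQ_ne_zero (fun i => norm_pos_iff.1 (hμ i).1) w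
      have hμw0 : 0 < ‖muQ μ w‖ := norm_pos_iff.2 hμw
      have h2 := (hT.approxOn_comp_invQ_sub hlam hμ1 hφT hB hC hδ1 hp hps happ w hρ'0
        hb').const_mul (-(muQ μ w)⁻¹)
      rw [hρδ] at h2
      have h3 : ApproxOn ⌊s⌋₊ (fun z => series lam γ μ φ (invQ lam γ w z)) y₀ ρ
          (Cx * ((1 + 2 * R) * scale lam l) ^ s) := by
        refine (happx ((1 + 2 * R) * scale lam l) (by positivity)).comp_affine hsc.ne'
          fun z hz => ?_
        change invQ lam γ w z ∈ _
        obtain ⟨u, hux, hu⟩ := hw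
        have hzT : z ∈ T := interior_subset (hb' (Metric.ball_subset_ball hρρ' hz))
        have h4 := dist_mapQ (lam := lam) (γ := γ) w (invQ lam γ w z) u
        rw [mapQ_invQ hlam] at h4
        have h5 : dist z (mapQ lam γ w u) < 2 * R := by
          have h6 := dist_triangle_right z (mapQ lam γ w u) c
          have h7 := Metric.mem_ball.1 (hR hzT)
          have h8 := Metric.mem_ball.1 (hR hu)
          linarith
        have h6 : dist (invQ lam γ w z) u < 2 * R * scale lam l := by
          calc dist (invQ lam γ w z) u
              = (lam : ℝ) ^ l * dist (invQ lam γ w z) u * scale lam l := by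
                rw [mul_right_comm, pow_mul_scale hlam, one_mul]
            _ < 2 * R * scale lam l := by rw [← h4]; gcongr
        have h7 := dist_triangle (invQ lam γ w z) u x
        have h8 := Metric.mem_ball.1 hux
        rw [Metric.mem_ball]
        linarith
      have h4 := (h3.const_mul (muQ μ w)⁻¹).mono (K' := N) (by omega) le_rfl le_rfl
      refine ((h4.add h2).congr fun z _ => ?_).mono le_rfl le_rfl ?_
      · field_simp
        ring
      · have e1 : ‖(muQ μ w)⁻¹‖ * (Cx * ((1 + 2 * R) * scale lam l) ^ s) ≤ ρ ^ t := by
          rw [norm_inv, inv_mul_le_iff₀ hμw0, Real.mul_rpow (by positivity) hsc.le]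
          rw [div_mul_eq_mul_div, div_lt_iff₀ hρt] at hbig
          linarith
        have e2 : ‖-(muQ μ w)⁻¹‖ * (C * ‖muQ μ w‖ * ρ' ^ t) = C * (δ⁻¹) ^ t * ρ ^ t := by
          rw [norm_neg, norm_inv, hρ', Real.mul_rpow (by positivity) hρ.le]
          field_simp
        rw [e2]
        have e3 : 0 ≤ Bf * ((δ * ρ₁)⁻¹) ^ t * ρ ^ t := by positivity
        linarith
  obtain ⟨C₁, hC₁, hlp⟩ := exists_lpPiece_bound hlam hθ hNt (by positivity) hall
  obtain ⟨C₂, hlp₂⟩ := exists_norm_lpPiece_le hlam θ hBf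
  obtain ⟨l, y, hly⟩ := hns (C₁ + |C₂|)
  change _ < _ / (scale lam l + ‖y - y₀‖) ^ s₀ at hly
  have hX0 : 0 < scale lam l + ‖y - y₀‖ := add_pos_of_pos_of_nonneg (scale_pos hlam l)
    (norm_nonneg _)
  set X := scale lam l + ‖y - y₀‖ with hX
  have hXs : 0 < X ^ s₀ := Real.rpow_pos_of_pos hX0 _
  rw [lt_div_iff₀ hXs] at hly
  -- For X ≤ 1 the order t ≥ s₀ contradicts the irregularity; for X > 1 the uniform bound on the
  -- pieces does.
  rcases le_or_gt X 1 with hX1 | hX1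
  · have h1 : X ^ t ≤ X ^ s₀ := Real.rpow_le_rpow_of_exponent_ge hX0 hX1 hs₀t
    have h2 := hlp l y
    have h3 : 0 ≤ |C₂| * X ^ s₀ := by positivity
    nlinarith
  · have h1 : 1 ≤ X ^ s₀ := Real.one_le_rpow hX1.le hs₀.le
    have h2 := hlp₂ l y
    have h3 := le_abs_self C₂
    have h4 : |C₂| * 1 ≤ |C₂| * X ^ s₀ := by gcongr
    have h5 : 0 ≤ C₁ * X ^ s₀ := by positivity
    nlinarith

lemma IsSelfAffineTile.alphaAt_le_tau0 (hT : IsSelfAffineTile lam γ T)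
    (hlam : 2 ≤ lam) (hc : c ∈ interior T) (hμ : ∀ i, 0 < ‖μ i‖ ∧ ‖μ i‖ < 1)
    (hφT : ∀ y, y ∉ interior T → φ y = 0) {B : ℝ} (hB : ∀ y, ‖φ y‖ ≤ B)
    {θ : 𝓢(E n, ℂ)} (hθ : IsLPGenerator lam θ)
    (hsm : ∀ i : Fin m, MemSmooth lam T c φ (subdomain lam γ T i))
    (hns : NonSmoothSomewhere lam θ T (series lam γ μ φ)) (x : E n) :
    alphaAt lam T c (series lam γ μ φ) x ≤ tau0 lam γ T μ x := by
  refine iSup₂_le fun s hs => ?_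
  rcases hs with rfl | ⟨hs, hf⟩
  · refine le_tau0_of_norm_muQ_le hlam hT.isCompact hμ (C := 1) fun l w _ => ?_
    simpa using norm_muQ_le_one (fun i => (hμ i).2.le) w
  · obtain ⟨C, hC⟩ := hT.exists_norm_muQ_le_of_memPointwise hlam hc hμ hφT hB hθ hsm hns hs hf
    exact le_tau0_of_norm_muQ_le hlam hT.isCompact hμ hC

end UpperBounds

end SelfAffine

end

/-! ### The theorem. -/

open SelfAffine in
theorem theorem4 {n m : ℕ} (hn : 0 < n) (lam : ℕ) (hlam : 2 ≤ lam)
    (γ : Fin m → Fin n → ℤ) (T : Set (E n)) (hT : IsSelfAffineTile lam γ T)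
    (c : E n) (hc : c ∈ interior T)
    (μ : Fin m → ℂ) (hμ : ∀ i, 0 < ‖μ i‖ ∧ ‖μ i‖ < 1)
    (φ : E n → ℂ) (hφm : AEStronglyMeasurable φ volume)
    (hφb : ∃ C : ℝ, ∀ y, ‖φ y‖ ≤ C) (hφT : ∀ y, y ∉ interior T → φ y = 0)
    (θ : 𝓢(E n, ℂ)) (hθ : IsLPGenerator lam θ)
    (f : E n → ℂ) (hf : f = series lam γ μ φ) :
    (∀ x ∈ T, min (alpha lam T c φ) (tau0 lam γ T μ x) ≤ alphaAt lam T c f x) ∧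
    (∀ (x : E n) (hx : x ∈ Omega lam γ T),
      BddAbove (Set.range fun l : ℕ => Delta lam γ T hx l / Delta lam γ T hx (l + 1)) →
      min (⨅ i : Fin m, alphaOn lam T c φ (subdomain lam γ T i)) (tau1 lam γ T μ hx) ≤
        alphaAt lam T c f x) ∧
    ((∀ i : Fin m, MemSmooth lam T c φ (subdomain lam γ T i)) →
      NonSmoothSomewhere lam θ T f →
      (∀ x ∈ T, alphaAt lam T c f x ≤ tau0 lam γ T μ x) ∧
      (∀ (x : E n) (hx : x ∈ Omega lam γ T),
        BddAbove (Set.range fun l : ℕ => Delta lam γ T hx l / Delta lam γ T hx (l + 1)) →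
        alphaAt lam T c f x = tau0 lam γ T μ x ∧ tau0 lam γ T μ x = tau1 lam γ T μ hx)) := by
  subst hf
  obtain ⟨B, hB⟩ := hφb
  have hlow : ∀ (x : E n) (hx : x ∈ Omega lam γ T),
      BddAbove (Set.range fun l : ℕ => Delta lam γ T hx l / Delta lam γ T hx (l + 1)) →
      min (⨅ i : Fin m, alphaOn lam T c φ (subdomain lam γ T i)) (tau1 lam γ T μ hx) ≤
        alphaAt lam T c (series lam γ μ φ) x :=
    fun x hx hbdd => hT.min_alphaOn_tau1_le hlam hn hc hμ hφT hB hx hbdd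
  refine ⟨fun x _ => hT.min_alpha_tau0_le hlam hc hμ hφT hB x, hlow, fun hsm hns => ?_⟩
  have hup := hT.alphaAt_le_tau0 hlam hc hμ hφT hB hθ hsm hns
  refine ⟨fun x _ => hup x, fun x hx hbdd => ?_⟩
  have h1 := hT.tau0_le_tau1 hlam hn hμ hx hbdd
  have h2 := hlow x hx hbdd
  -- Smoothness makes every local exponent of φ infinite, so the minimum in (ii) is τ₁ and the chain
  -- of inequalities closes.
  simp only [alphaOn_eq_top (hsm _), iInf_top, top_inf_eq] at h2
  exact ⟨le_antisymm (hup x) (h1.trans h2), le_antisymm h1 (h2.trans (hup x))⟩
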